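/- **Theorem 1.1.** Let $N\ge 1$ and let $\Omega\subset\mathbb{R}^N$ be a smooth bounded domain (a nonempty bounded connected open set with $C^\infty$ boundary). Write $e_3=(0,0,1)$ and let $H^1(\Omega,\mathbb{S}^2)$ be the set of $m\in H^1(\Omega,\mathbb{R}^3)$ with $|m|=1$ a.e. in $\Omega$. For $\kappa\ge 0$ and $m\in H^1(\Omega,\mathbb{S}^2)$ put $$\mathcal{E}_\kappa(m)=\int_\Omega|\nabla m|^2\,dx+\kappa^2\int_\Omega (m\cdot e_3)^2\,dx,$$ for $\gamma>0$ put $$\mathcal{E}_{\kappa,\gamma}(m)=\mathcal{E}_\kappa(m)+\frac1{\gamma^2}\int_{\partial\Omega}|m\times e_3|^2\,d\mathcal{H}^{N-1},$$ where the boundary values of $m$ are understood in the sense of traces, and for $\gamma=0$ put $\mathcal{E}_{\kappa,0}(m)=\mathcal{E}_\kappa(m)$ if $m-e_3\in H^1_0(\Omega,\mathbb{R}^3)$ or $m+e_3\in H^1_0(\Omega,\mathbb{R}^3)$, and $\mathcal{E}_{\kappa,0}(m)=+\infty$ otherwise. A global minimizer of $\mathcal{E}_{\kappa,\gamma}$ is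 a minimizer over $H^1(\Omega,\mathbb{S}^2)$. Maps are identified when they agree a.e. in $\Omega$. Then: (i) For every $\gamma\in[0,\infty)$ there is $\kappa_\gamma>0$, depending only on $\gamma$ and $\Omega$, such that for every $\kappa\in[0,\kappa_\gamma)$ the global minimizers of $\mathcal{E}_{\kappa,\gamma}$ are exactly the two constant maps $e_3$ and $-e_3$. In particular (case $\gamma=0$), $\pm e_3$ are the only solutions of the Dirichlet problem $\min\mathcal{E}_{\kappa,0}$ for $\kappa\in[0,\kappa_0)$. (ii) For every $\kappa\in(0,\infty)$ there is $\gamma_\kappa>0$, depending only on $\kappa$ and $\Omega$, such that for every $\gamma\in(\gamma_\kappa,\infty)$ the global minimizers of $\mathcal{E}_{\kappa,\gamma}$ are exactly the constant maps $e$ with $e\in\mathbb{S}^2$ and $e\cdot e_3=0$. -/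

import Mathlib

open MeasureTheory Filter Topology
open scoped ENNReal ContDiff

namespace PenalizedDirichlet

noncomputable section

/-- The Euclidean space `ℝ^N`. -/
abbrev Space (N : ℕ) : Type := EuclideanSpace ℝ (Fin N)

/-- The target space `ℝ³`. -/
abbrev Vec3 : Type := EuclideanSpace ℝ (Fin 3)

/-- The vertical unit vector `(0,0,1)`. -/
def e3 : Vec3 := !₂[0, 0, 1]

/-- The cross product of `ℝ³`, as an operation on the Euclidean space. -/
def cross (v w : Vec3) : Vec3 :=
  WithLp.toLp 2 (crossProduct (WithLp.ofLp v) (WithLp.ofLp w))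

/-- The `i`-th vector of the standard basis of `ℝ^N`. -/
def basisVec {N : ℕ} (i : Fin N) : Space N := EuclideanSpace.single i 1

/-- Smooth bounded domains: bounded connected nonempty open sets which, near each boundary point
and in suitable orthonormal coordinates, are the strict epigraph of a smooth function of the first
`N - 1` coordinates. The direction of the last axis is `ν`, and a function of the other coordinates
is a function `f` on `ℝ^N` which is invariant under translations along `ν`. -/
structure IsSmoothBoundedDomain {N : ℕ} (Ω : Set (Space N)) : Prop where
  isOpen : IsOpen Ω
  isConnected : IsConnected Ω
  isBounded : Bornology.IsBounded Ω
  smooth_boundary : ∀ x ∈ frontier Ω, ∃ (r : ℝ) (ν : Space N) (f : Space N → ℝ),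
    0 < r ∧ ‖ν‖ = 1 ∧ ContDiff ℝ ∞ f ∧ (∀ (y : Space N) (t : ℝ), f (y + t • ν) = f y) ∧
    Ω ∩ Metric.ball x r = {y | f y < inner ℝ ν y} ∩ Metric.ball x r

/-- Test functions: smooth real functions with compact support contained in `Ω`. -/
structure IsTestFunction {N : ℕ} (Ω : Set (Space N)) (φ : Space N → ℝ) : Prop where
  contDiff : ContDiff ℝ ∞ φ
  hasCompactSupport : HasCompactSupport φ
  tsupport_subset : tsupport φ ⊆ Ω

/-- `g` belongs to `L²(Ω, ℝ³)` and is the weak partial derivative `∂ᵢ u` of `u` in `Ω`. -/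
def IsWeakPartial {N : ℕ} (Ω : Set (Space N)) (i : Fin N) (u g : Space N → Vec3) : Prop :=
  MemLp g 2 (volume.restrict Ω) ∧
  ∀ φ : Space N → ℝ, IsTestFunction Ω φ →
    ∫ x in Ω, (fderiv ℝ φ x (basisVec i)) • u x = - ∫ x in Ω, φ x • g x

/-- The Sobolev space `H¹(Ω, ℝ³)`. -/
structure MemH1 {N : ℕ} (Ω : Set (Space N)) (u : Space N → Vec3) : Prop where
  memLp : MemLp u 2 (volume.restrict Ω)
  exists_weakPartial : ∀ i : Fin N, ∃ g, IsWeakPartial Ω i u g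

open Classical in
/-- The weak partial derivative `∂ᵢ u` in `L²(Ω, ℝ³)` (unique up to null subsets of `Ω`);
it is used for functions in `H¹(Ω, ℝ³)` only. -/
def weakPartial {N : ℕ} (Ω : Set (Space N)) (i : Fin N) (u : Space N → Vec3) :
    Space N → Vec3 :=
  if h : ∃ g, IsWeakPartial Ω i u g then h.choose else 0

/-- The functions `Φ k`, smooth on the whole space, converge to `u` in `H¹(Ω, ℝ³)`. -/
structure SmoothApprox {N : ℕ} (Ω : Set (Space N)) (Φ : ℕ → Space N → Vec3)
    (u : Space N → Vec3) : Prop where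
  contDiff : ∀ k, ContDiff ℝ ∞ (Φ k)
  tendsto : Tendsto (fun k => eLpNorm (fun x => Φ k x - u x) 2 (volume.restrict Ω))
    atTop (𝓝 0)
  tendsto_partial : ∀ i : Fin N,
    Tendsto (fun k => eLpNorm (fun x => fderiv ℝ (Φ k) x (basisVec i) - weakPartial Ω i u x) 2
      (volume.restrict Ω)) atTop (𝓝 0)

/-- The space `H¹₀(Ω, ℝ³)`: the closure in `H¹` of the smooth functions with compact support
in `Ω`. -/
def MemH10 {N : ℕ} (Ω : Set (Space N)) (u : Space N → Vec3) : Prop :=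
  MemH1 Ω u ∧ ∃ Φ : ℕ → Space N → Vec3, SmoothApprox Ω Φ u ∧
    ∀ k, HasCompactSupport (Φ k) ∧ tsupport (Φ k) ⊆ Ω

/-- The surface measure on `∂Ω`: the `(N-1)`-dimensional Hausdorff measure with the Euclidean
normalization (the counting measure if `N = 1`), restricted to `∂Ω`. -/
def surfaceMeasure {N : ℕ} (Ω : Set (Space N)) : Measure (Space N) :=
  (Measure.euclideanHausdorffMeasure (N - 1)).restrict (frontier Ω)

/-- `g` is the boundary trace of `u`: the map that sends a function smooth up to the boundary to
its restriction to `∂Ω`, extended by continuity from `H¹(Ω)` to `L²(∂Ω)`. -/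
def IsTrace {N : ℕ} (Ω : Set (Space N)) (u g : Space N → Vec3) : Prop :=
  MemLp g 2 (surfaceMeasure Ω) ∧
  ∃ Φ : ℕ → Space N → Vec3, SmoothApprox Ω Φ u ∧
    Tendsto (fun k => eLpNorm (fun x => Φ k x - g x) 2 (surfaceMeasure Ω)) atTop (𝓝 0)

open Classical in
/-- The boundary trace of `u`, for `u` in `H¹(Ω, ℝ³)`. On a smooth bounded domain it exists and is
unique up to null sets of the surface measure. -/
def trace {N : ℕ} (Ω : Set (Space N)) (u : Space N → Vec3) : Space N → Vec3 :=
  if h : ∃ g, IsTrace Ω u g then h.choose else 0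

/-- The set `H¹(Ω, 𝕊²)`. -/
structure MemH1Sphere {N : ℕ} (Ω : Set (Space N)) (m : Space N → Vec3) : Prop where
  memH1 : MemH1 Ω m
  norm_eq_one : ∀ᵐ x ∂(volume.restrict Ω), ‖m x‖ = 1

/-- `∫_Ω |∇m|² + κ² ∫_Ω (m · e₃)²`. -/
def bulkEnergy {N : ℕ} (Ω : Set (Space N)) (κ : ℝ) (m : Space N → Vec3) : ℝ≥0∞ :=
  (∫⁻ x in Ω, ∑ i : Fin N, ‖weakPartial Ω i m x‖ₑ ^ 2) +
    ENNReal.ofReal (κ ^ 2) * ∫⁻ x in Ω, ENNReal.ofReal ((inner ℝ (m x) e3) ^ 2)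

/-- `∫_{∂Ω} |m × e₃|²`, with `m` understood in the sense of traces. -/
def boundaryEnergy {N : ℕ} (Ω : Set (Space N)) (m : Space N → Vec3) : ℝ≥0∞ :=
  ∫⁻ x, ‖cross (trace Ω m x) e3‖ₑ ^ 2 ∂(surfaceMeasure Ω)

open Classical in
/-- The energy `E_{κ,γ}`: for `γ > 0` the boundary term is penalized, for `γ = 0` one of the
boundary conditions `m = e₃`, `m = -e₃` is imposed on all of `∂Ω`. -/
def energy {N : ℕ} (Ω : Set (Space N)) (κ γ : ℝ) (m : Space N → Vec3) : ℝ≥0∞ :=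
  if γ = 0 then
    if MemH10 Ω (fun x => m x + e3) ∨ MemH10 Ω (fun x => m x - e3) then bulkEnergy Ω κ m else ⊤
  else bulkEnergy Ω κ m + ENNReal.ofReal (1 / γ ^ 2) * boundaryEnergy Ω m

/-- `m` is a global minimizer of `E_{κ,γ}` on `H¹(Ω, 𝕊²)`. -/
def IsGlobalMinimizer {N : ℕ} (Ω : Set (Space N)) (κ γ : ℝ) (m : Space N → Vec3) : Prop :=
  MemH1Sphere Ω m ∧ ∀ m' : Space N → Vec3, MemH1Sphere Ω m' → energy Ω κ γ m ≤ energy Ω κ γ m'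

/-- `m` coincides with the constant `c` as an element of `H¹(Ω, ℝ³)`. -/
def IsConstOn {N : ℕ} (Ω : Set (Space N)) (m : Space N → Vec3) (c : Vec3) : Prop :=
  m =ᵐ[volume.restrict Ω] fun _ => c

end

end PenalizedDirichlet

/-!
The proof compares a competitor `m` with the constant maps. Since `|m| = 1`, the horizontal part
`∫_Ω |m × e₃|²` and the vertical part `∫_Ω (m · e₃)²` add up to the volume of `Ω`.

For small `κ`, the constants `±e₃` have energy `κ² |Ω|`. A competitor can only gain
`κ² ∫_Ω |m × e₃|²` in the anisotropy term. The Friedrichs inequality, applied to `m × e₃`, bounds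
`∫_Ω |m × e₃|²` by a constant times the Dirichlet and boundary energies (if `γ = 0`, the boundary
values `±e₃` make the boundary term vanish). Hence for small `κ` the gain is outweighed, and equality
forces the weak gradient and the horizontal part to vanish
(`IsSmoothBoundedDomain.exists_lintegral_cross_le`,
`IsSmoothBoundedDomain.isGlobalMinimizer_iff_vertical`).

For large `γ`, the horizontal constants have energy `γ⁻² |∂Ω|`. The trace of `m` has unit length, so
a competitor gains at most `γ⁻² ∫_{∂Ω} (m · e₃)²` in the boundary term, and the trace inequality,
applied to the vertical component, bounds this integral by a constant times the Dirichlet and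
anisotropy energies (`IsSmoothBoundedDomain.exists_surfaceMeasure_le`,
`IsSmoothBoundedDomain.isGlobalMinimizer_iff_horizontal`).

The two inequalities, the existence and uniqueness of traces, and the density of smooth functions
up to the boundary are proved from scratch. Near the boundary, `Ω` is the epigraph of a Lipschitz
function in orthonormal coordinates (`BoundaryChart`). Integration along vertical segments gives the
`L¹` inequalities for smooth scalar functions (`IsSmoothBoundedDomain.exists_trace_ineq`,
`IsSmoothBoundedDomain.exists_friedrichs_ineq`), and the `L²` inequalities follow with `‖Φ‖²` in
place of the function. Density is obtained by mollification with kernels supported in an inward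
cone, after a partition of unity (`IsSmoothBoundedDomain.exists_smoothApprox`).

That the trace of a sphere-valued map has at least unit length in the mean
(`MemH1Sphere.surfaceMeasure_univ_le`) also follows from the `L¹` inequality: if smooth maps `Φ k`
converge to `m` in `H¹`, the scalar functions `1 - ‖Φ k‖²` converge to zero in `W^{1,1}`, because
`m` is orthogonal to its weak derivatives.
-/

namespace PenalizedDirichlet

/-! ### Orthonormal coordinates and boundary charts -/

/-- Orthonormal coordinates of `ℝ^{n+1}`, split as `n` horizontal coordinates and one vertical
coordinate. The product `Space n × ℝ` carries the maximum norm, so that orthonormality is recorded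
as the Pythagorean identity `norm_sq`. -/
structure AxisCoords (n : ℕ) where
  toEquiv : (Space n × ℝ) ≃L[ℝ] Space (n + 1)
  norm_sq : ∀ p, ‖toEquiv p‖ ^ 2 = ‖p.1‖ ^ 2 + p.2 ^ 2

namespace AxisCoords

variable {n : ℕ} (Λ : AxisCoords n)

lemma norm_le (p : Space n × ℝ) : ‖Λ.toEquiv p‖ ≤ ‖p.1‖ + |p.2| := by
  have h := Λ.norm_sq p
  refine abs_le_of_sq_le_sq' ?_ (by positivity) |>.2
  rw [h]
  nlinarith [norm_nonneg p.1, abs_nonneg p.2, sq_abs p.2,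
    mul_nonneg (norm_nonneg p.1) (abs_nonneg p.2)]

lemma norm_fst_le (x : Space (n + 1)) : ‖(Λ.toEquiv.symm x).1‖ ≤ ‖x‖ := by
  have h := Λ.norm_sq (Λ.toEquiv.symm x)
  rw [ContinuousLinearEquiv.apply_symm_apply] at h
  exact abs_le_of_sq_le_sq' (by nlinarith [sq_nonneg (Λ.toEquiv.symm x).2]) (norm_nonneg _) |>.2

lemma abs_snd_le (x : Space (n + 1)) : |(Λ.toEquiv.symm x).2| ≤ ‖x‖ := by
  have h := Λ.norm_sq (Λ.toEquiv.symm x)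
  rw [ContinuousLinearEquiv.apply_symm_apply] at h
  exact abs_le_of_sq_le_sq (by nlinarith [sq_nonneg ‖(Λ.toEquiv.symm x).1‖]) (norm_nonneg _)

lemma norm_vert : ‖Λ.toEquiv (0, 1)‖ = 1 := by
  have h := Λ.norm_sq (0, 1)
  simp only [norm_zero] at h
  nlinarith [norm_nonneg (Λ.toEquiv (0, 1))]

/-- Every unit vector is the vertical axis of some orthonormal coordinates. -/
lemma exists_vert_eq {ν : Space (n + 1)} (hν : ‖ν‖ = 1) :
    ∃ Λ : AxisCoords n, Λ.toEquiv (0, 1) = ν ∧ ∀ p, inner ℝ ν (Λ.toEquiv p) = p.2 := by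
  have hν0 : ν ≠ 0 := by rintro rfl; simp at hν
  have hfr : Module.finrank ℝ (ℝ ∙ ν)ᗮ = n := by
    have : Fact (Module.finrank ℝ (Space (n + 1)) = n + 1) := ⟨by simp⟩
    exact Submodule.finrank_orthogonal_span_singleton hν0
  let b : OrthonormalBasis (Fin n) ℝ (ℝ ∙ ν)ᗮ := (stdOrthonormalBasis ℝ _).reindex (finCongr hfr)
  let e : (ℝ ∙ ν)ᗮ ≃ₗᵢ[ℝ] Space n := b.repr
  let f : Space n × ℝ →ₗ[ℝ] Space (n + 1) :=
    ((ℝ ∙ ν)ᗮ.subtype ∘ₗ e.symm.toLinearEquiv.toLinearMap).coprod (LinearMap.toSpanSingleton ℝ _ ν)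
  have hf : ∀ p, f p = (e.symm p.1 : Space (n + 1)) + p.2 • ν := fun p => by
    simp [f, LinearMap.coprod_apply]
  have horth : ∀ y : Space n, inner ℝ ν (e.symm y : Space (n + 1)) = 0 := fun y =>
    Submodule.mem_orthogonal_singleton_iff_inner_right.1 (e.symm y).2
  have hnorm : ∀ p, ‖f p‖ ^ 2 = ‖p.1‖ ^ 2 + p.2 ^ 2 := fun p => by
    have h1 : inner ℝ (e.symm p.1 : Space (n + 1)) (p.2 • ν) = 0 := by
      rw [inner_smul_right, real_inner_comm, horth, mul_zero]
    have h2 := norm_add_sq_eq_norm_sq_add_norm_sq_of_inner_eq_zero _ _ h1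
    have h3 : ‖(e.symm p.1 : Space (n + 1))‖ = ‖p.1‖ := e.symm.norm_map p.1
    rw [hf, pow_two, h2, norm_smul, hν, mul_one, Real.norm_eq_abs, abs_mul_abs_self, h3]
    ring
  have hinj : Function.Injective f := by
    rw [injective_iff_map_eq_zero]
    intro p hp
    have h := hnorm p
    rw [hp, norm_zero] at h
    have h1 : ‖p.1‖ = 0 := by nlinarith [sq_nonneg p.2, norm_nonneg p.1]
    have h2 : p.2 = 0 := by nlinarith [sq_nonneg p.2, norm_nonneg p.1]
    exact Prod.ext (norm_eq_zero.1 h1) h2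
  let L := f.linearEquivOfInjective hinj (by simp)
  have hL : ∀ p, L p = f p := fun p => rfl
  refine ⟨⟨L.toContinuousLinearEquiv, fun p => ?_⟩, ?_, fun p => ?_⟩
  · exact hnorm p
  · change f (0, 1) = ν
    simp [hf]
  · change inner ℝ ν (f p) = p.2
    rw [hf, inner_add_right, horth, inner_smul_right, real_inner_self_eq_norm_sq, hν]
    simp

/-- Fubini's theorem in orthonormal coordinates. The constant is `1`, but only its finiteness and
positivity matter here. -/
lemma exists_lintegral_eq : ∃ c : ℝ≥0∞, c ≠ 0 ∧ c ≠ ⊤ ∧ ∀ F : Space (n + 1) → ℝ≥0∞,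
    Measurable F → ∫⁻ x, F x = c * ∫⁻ y : Space n, ∫⁻ t : ℝ, F (Λ.toEquiv (y, t)) := by
  have : (volume : Measure (Space n × ℝ)).IsAddHaarMeasure :=
    Measure.prod.instIsAddHaarMeasure _ _
  have hΛ : (Measure.map Λ.toEquiv (volume : Measure (Space n × ℝ))).IsAddHaarMeasure :=
    ContinuousLinearEquiv.isAddHaarMeasure_map _ _
  have h := Measure.isAddLeftInvariant_eq_smul (volume : Measure (Space (n + 1)))
    (Measure.map Λ.toEquiv (volume : Measure (Space n × ℝ)))
  set c := Measure.addHaarScalarFactor (volume : Measure (Space (n + 1)))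
    (Measure.map Λ.toEquiv (volume : Measure (Space n × ℝ))) with hc
  refine ⟨c, ?_, by simp, fun F hF => ?_⟩
  · intro h0
    have : c = 0 := by simpa using h0
    rw [this, zero_smul] at h
    exact NeZero.ne (volume : Measure (Space (n + 1))) h
  · rw [h, lintegral_smul_measure, lintegral_map hF Λ.toEquiv.continuous.measurable,
      Measure.volume_eq_prod, lintegral_prod (fun p => F (Λ.toEquiv p))
        (hF.comp Λ.toEquiv.continuous.measurable).aemeasurable]
    rfl

/-- Fubini's theorem in the coordinates sheared by a function `g` of the horizontal variables. -/
lemma exists_lintegral_eq_shear : ∃ c : ℝ≥0∞, c ≠ 0 ∧ c ≠ ⊤ ∧ ∀ F : Space (n + 1) → ℝ≥0∞,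
    Measurable F → ∀ g : Space n → ℝ,
      ∫⁻ x, F x = c * ∫⁻ y : Space n, ∫⁻ s : ℝ, F (Λ.toEquiv (y, g y + s)) := by
  obtain ⟨c, h0, h1, h⟩ := Λ.exists_lintegral_eq
  refine ⟨c, h0, h1, fun F hF g => ?_⟩
  rw [h F hF]
  congr 2 with y
  exact (lintegral_add_left_eq_self (μ := volume) (fun t => F (Λ.toEquiv (y, t))) (g y)).symm

end AxisCoords

/-- A Lipschitz map of constant `K` increases the `d`-dimensional measure at most by `K ^ d`. -/
lemma _root_.LipschitzOnWith.euclideanHausdorffMeasure_image_le {X Y : Type*}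
    [EMetricSpace X] [EMetricSpace Y] [MeasurableSpace X] [BorelSpace X] [MeasurableSpace Y]
    [BorelSpace Y] {K : NNReal} {f : X → Y} {s : Set X} (h : LipschitzOnWith K f s) (d : ℕ) :
    Measure.euclideanHausdorffMeasure d (f '' s) ≤
      (K : ℝ≥0∞) ^ d * Measure.euclideanHausdorffMeasure d s := by
  simp_rw [Measure.euclideanHausdorffMeasure_def, Measure.smul_apply, ENNReal.smul_def, smul_eq_mul]
  have := h.hausdorffMeasure_image_le (d := d) (by positivity)
  rw [ENNReal.rpow_natCast] at this
  calc _ ≤ _ := mul_le_mul_right this _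
    _ = _ := by ring

/-- A neighbourhood of a boundary point in which `Ω` is the strict epigraph of a Lipschitz function
`g` over the ball `B(y₀, δ)`, with height measured from the graph and ranging over `(-h, h)`. -/
structure BoundaryChart {n : ℕ} (Ω : Set (Space (n + 1))) extends AxisCoords n where
  g : Space n → ℝ
  continuous_g : Continuous g
  y₀ : Space n
  δ : ℝ
  h : ℝ
  h_pos : 0 < h
  L : NNReal
  lipschitz_g : LipschitzOnWith L g (Metric.ball y₀ δ)
  mem_iff : ∀ y ∈ Metric.ball y₀ δ, ∀ s : ℝ, |s| < h → (toEquiv (y, g y + s) ∈ Ω ↔ 0 < s)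
  mem_frontier_iff : ∀ y ∈ Metric.ball y₀ δ, ∀ s : ℝ, |s| < h →
    (toEquiv (y, g y + s) ∈ frontier Ω ↔ s = 0)

namespace BoundaryChart

variable {n : ℕ} {Ω : Set (Space (n + 1))} (c : BoundaryChart Ω)

/-- The point at height `s` above the boundary point over `y`. -/
def point (y : Space n) (s : ℝ) : Space (n + 1) := c.toEquiv (y, c.g y + s)

/-- The horizontal coordinates of a point. -/
def proj (x : Space (n + 1)) : Space n := (c.toEquiv.symm x).1

/-- The height of a point above the graph. -/
def height (x : Space (n + 1)) : ℝ := (c.toEquiv.symm x).2 - c.g (c.proj x)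

/-- The open set covered by the chart. -/
def dom : Set (Space (n + 1)) := {x | c.proj x ∈ Metric.ball c.y₀ c.δ ∧ |c.height x| < c.h}

lemma continuous_proj : Continuous c.proj := continuous_fst.comp c.toEquiv.symm.continuous

lemma continuous_height : Continuous c.height :=
  (continuous_snd.comp c.toEquiv.symm.continuous).sub (c.continuous_g.comp c.continuous_proj)

lemma continuous_point : Continuous fun p : Space n × ℝ => c.point p.1 p.2 :=
  c.toEquiv.continuous.comp
    (continuous_fst.prodMk ((c.continuous_g.comp continuous_fst).add continuous_snd))

@[simp] lemma proj_point (y : Space n) (s : ℝ) : c.proj (c.point y s) = y := by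
  simp [proj, point]

@[simp] lemma height_point (y : Space n) (s : ℝ) : c.height (c.point y s) = s := by
  simp [height, point, proj]

@[simp] lemma point_proj_height (x : Space (n + 1)) : c.point (c.proj x) (c.height x) = x := by
  simp [height, point, proj]

lemma isOpen_dom : IsOpen c.dom :=
  (Metric.isOpen_ball.preimage c.continuous_proj).inter
    (isOpen_lt (c.continuous_height.abs) continuous_const)

lemma point_mem_dom {y : Space n} {s : ℝ} :
    c.point y s ∈ c.dom ↔ y ∈ Metric.ball c.y₀ c.δ ∧ |s| < c.h := by
  simp [dom]

lemma mem_iff_of_mem_dom {x : Space (n + 1)} (hx : x ∈ c.dom) : x ∈ Ω ↔ 0 < c.height x := by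
  conv_lhs => rw [← c.point_proj_height x]
  exact c.mem_iff _ hx.1 _ hx.2

lemma mem_frontier_iff_of_mem_dom {x : Space (n + 1)} (hx : x ∈ c.dom) :
    x ∈ frontier Ω ↔ c.height x = 0 := by
  conv_lhs => rw [← c.point_proj_height x]
  exact c.mem_frontier_iff _ hx.1 _ hx.2

end BoundaryChart

/-- Near a boundary point, and in suitable orthonormal coordinates, the domain and its boundary are
described by the sign of the height above the graph of a smooth function. -/
lemma IsSmoothBoundedDomain.exists_graph {n : ℕ} {Ω : Set (Space (n + 1))}
    (hΩ : IsSmoothBoundedDomain Ω) {x : Space (n + 1)} (hx : x ∈ frontier Ω) :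
    ∃ (r : ℝ) (Λ : AxisCoords n) (g : Space n → ℝ), 0 < r ∧ ContDiff ℝ ∞ g ∧
      (∀ y s, Λ.toEquiv (y, g y + s) ∈ Metric.ball x r →
        (Λ.toEquiv (y, g y + s) ∈ Ω ↔ 0 < s)) ∧
      ∀ y s, Λ.toEquiv (y, g y + s) ∈ Metric.ball x r →
        (Λ.toEquiv (y, g y + s) ∈ frontier Ω ↔ s = 0) := by
  obtain ⟨r, ν, f, hr, hν, hf, hinv, heq⟩ := hΩ.smooth_boundary x hx
  obtain ⟨Λ, hΛν, hΛ⟩ := AxisCoords.exists_vert_eq hν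
  obtain ⟨g, hg, hfg⟩ : ∃ g : Space n → ℝ, ContDiff ℝ ∞ g ∧ ∀ y t, f (Λ.toEquiv (y, t)) = g y := by
    refine ⟨fun y => f (Λ.toEquiv (y, 0)), ?_, fun y t => ?_⟩
    · have : ContDiff ℝ ∞ fun y : Space n => Λ.toEquiv (y, (0 : ℝ)) :=
        Λ.toEquiv.contDiff.comp (contDiff_id.prodMk contDiff_const)
      exact hf.comp this
    · have : Λ.toEquiv (y, t) = Λ.toEquiv (y, 0) + t • ν := by
        rw [← hΛν, ← map_smul, ← map_add]; simp
      rw [this, hinv]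
  have hmem : ∀ y s, Λ.toEquiv (y, g y + s) ∈ Metric.ball x r →
      (Λ.toEquiv (y, g y + s) ∈ Ω ↔ 0 < s) := fun y s hb => by
    have h1 : Λ.toEquiv (y, g y + s) ∈ Ω ∩ Metric.ball x r ↔
      Λ.toEquiv (y, g y + s) ∈ {y | f y < inner ℝ ν y} ∩ Metric.ball x r := by rw [heq]
    simp only [Set.mem_inter_iff, hb, and_true, Set.mem_ofPred_eq, hfg, hΛ] at h1
    rw [h1]; simp
  refine ⟨r, Λ, g, hr, hg, hmem, fun y s hb => ?_⟩
  rw [hΩ.isOpen.frontier_eq, Set.mem_sdiff, hmem y s hb]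
  have hcont : Continuous fun s' : ℝ => Λ.toEquiv (y, g y + s') :=
    Λ.toEquiv.continuous.comp (continuous_const.prodMk (continuous_const.add continuous_id))
  constructor
  · rintro ⟨h1, h2⟩
    by_contra hs
    have hs' : s < 0 := lt_of_le_of_ne (not_lt.1 h2) hs
    -- below the graph there is a neighbourhood disjoint from the domain
    obtain ⟨ht, hht, htz, hts⟩ : ∃ ht : Space (n + 1) → ℝ, Continuous ht ∧
        (∀ z, Λ.toEquiv ((Λ.toEquiv.symm z).1, g (Λ.toEquiv.symm z).1 + ht z) = z) ∧
        ht (Λ.toEquiv (y, g y + s)) = s :=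
      ⟨fun z => (Λ.toEquiv.symm z).2 - g (Λ.toEquiv.symm z).1,
        (continuous_snd.comp Λ.toEquiv.symm.continuous).sub
          (hg.continuous.comp (continuous_fst.comp Λ.toEquiv.symm.continuous)),
        fun z => by simp, by simp⟩
    have hopen : IsOpen (Metric.ball x r ∩ {z | ht z < 0}) :=
      Metric.isOpen_ball.inter (isOpen_lt hht continuous_const)
    obtain ⟨z, ⟨hz1, hz2⟩, hz3⟩ := mem_closure_iff.1 h1 _ hopen ⟨hb, hts.trans_lt hs'⟩
    have := (hmem _ (ht z) (by rw [htz]; exact hz1)).1 (by rw [htz]; exact hz3)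
    exact absurd this (not_lt.2 (le_of_lt hz2))
  · rintro rfl
    refine ⟨?_, lt_irrefl _⟩
    have h1 : Tendsto (fun s' : ℝ => Λ.toEquiv (y, g y + s')) (𝓝[>] 0)
        (𝓝 (Λ.toEquiv (y, g y + 0))) := hcont.continuousAt.tendsto.mono_left nhdsWithin_le_nhds
    refine mem_closure_of_tendsto h1 ?_
    filter_upwards [h1.eventually (Metric.isOpen_ball.mem_nhds hb), self_mem_nhdsWithin]
      with s' h3 h4
    exact (hmem y s' h3).2 h4

/-- Every boundary point of a smooth domain lies in the range of a boundary chart. -/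
lemma IsSmoothBoundedDomain.exists_boundaryChart {n : ℕ} {Ω : Set (Space (n + 1))}
    (hΩ : IsSmoothBoundedDomain Ω) {x : Space (n + 1)} (hx : x ∈ frontier Ω) :
    ∃ c : BoundaryChart Ω, x ∈ c.dom := by
  obtain ⟨r, Λ, g, hr, hg, hmem, hfront⟩ := hΩ.exists_graph hx
  obtain ⟨y₀, s₀, hx0, hy0, hs0'⟩ : ∃ (y₀ : Space n) (s₀ : ℝ), Λ.toEquiv (y₀, g y₀ + s₀) = x ∧
      (Λ.toEquiv.symm x).1 = y₀ ∧ (Λ.toEquiv.symm x).2 - g y₀ = s₀ :=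
    ⟨_, _, by simp, rfl, rfl⟩
  have hs0 : s₀ = 0 := (hfront y₀ s₀ (by rw [hx0]; exact Metric.mem_ball_self hr)).1
    (by rw [hx0]; exact hx)
  subst hs0
  have hg1 : ContDiff ℝ 1 g := hg.of_le (by simp)
  obtain ⟨L, t, ht, hL⟩ := hg1.contDiffAt.exists_lipschitzOnWith (x := y₀)
  have hcont : Continuous fun p : Space n × ℝ => Λ.toEquiv (p.1, g p.1 + p.2) :=
    Λ.toEquiv.continuous.comp
      (continuous_fst.prodMk ((hg.continuous.comp continuous_fst).add continuous_snd))
  have hx0' : Λ.toEquiv (y₀, g y₀ + 0) ∈ Metric.ball x r := by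
    rw [hx0]; exact Metric.mem_ball_self hr
  obtain ⟨ε, hε, hsub⟩ := Metric.isOpen_iff.1 (Metric.isOpen_ball.preimage hcont) (y₀, 0) hx0'
  obtain ⟨δ₁, hδ₁, ht'⟩ := Metric.mem_nhds_iff.1 ht
  have hball : ∀ y ∈ Metric.ball y₀ (min ε δ₁), ∀ s : ℝ, |s| < ε →
      Λ.toEquiv (y, g y + s) ∈ Metric.ball x r := fun y hy s hs => by
    have : (y, s) ∈ Metric.ball (y₀, (0 : ℝ)) ε := by
      rw [Metric.mem_ball, Prod.dist_eq, max_lt_iff]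
      exact ⟨lt_of_lt_of_le hy (min_le_left _ _), by simpa using hs⟩
    have h3 := hsub this
    rw [Set.mem_preimage] at h3
    exact h3
  refine ⟨{ toAxisCoords := Λ
            g := g, continuous_g := hg.continuous, y₀ := y₀, δ := min ε δ₁, h := ε, h_pos := hε
            L := L
            lipschitz_g := hL.mono ((Metric.ball_subset_ball (min_le_right _ _)).trans ht')
            mem_iff := fun y hy s hs => hmem y s (hball y hy s hs)
            mem_frontier_iff := fun y hy s hs => hfront y s (hball y hy s hs) }, ?_⟩
  have h0 : (0 : ℝ) < min ε δ₁ := lt_min hε hδ₁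
  simp only [BoundaryChart.dom, BoundaryChart.proj, BoundaryChart.height, Set.mem_ofPred_eq,
    hy0, hs0', abs_zero]
  exact ⟨Metric.mem_ball_self h0, hε⟩

/-! ### The trace and Friedrichs inequalities for smooth functions -/

lemma enorm_le_add_lintegral_deriv {f : ℝ → ℝ} (hf : ContDiff ℝ 1 f) {l u a b : ℝ}
    (ha : a ∈ Set.Icc l u) (hb : b ∈ Set.Icc l u) :
    ‖f b‖ₑ ≤ ‖f a‖ₑ + ∫⁻ r in Set.Ioo l u, ‖deriv f r‖ₑ := by
  have hd : Continuous (deriv f) := hf.continuous_deriv le_rfl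
  have h1 : ∫ r in a..b, deriv f r = f b - f a :=
    intervalIntegral.integral_deriv_eq_sub (fun x _ => (hf.differentiable one_ne_zero) x)
      (hd.intervalIntegrable a b)
  have h2 : f b = f a + ∫ r in a..b, deriv f r := by rw [h1]; ring
  rw [h2]
  refine (enorm_add_le _ _).trans (add_le_add le_rfl ?_)
  have h3 : ‖∫ r in a..b, deriv f r‖ₑ ≤ ∫⁻ r in Set.uIoc a b, ‖deriv f r‖ₑ := by
    rw [← ofReal_norm, intervalIntegral.norm_intervalIntegral_eq, ofReal_norm]
    exact enorm_integral_le_lintegral_enorm _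
  refine h3.trans ?_
  rw [restrict_Ioo_eq_restrict_Icc]
  exact lintegral_mono_set (Set.uIoc_subset_uIcc.trans (Set.uIcc_subset_Icc ha hb))

namespace AxisCoords

variable {n : ℕ} (Λ : AxisCoords n)

/-- The fundamental theorem of calculus along a vertical segment. -/
lemma enorm_le_add_lintegral_fderiv {ψ : Space (n + 1) → ℝ} (hψ : ContDiff ℝ 1 ψ) (y : Space n)
    (t : ℝ) {l u a b : ℝ} (ha : a ∈ Set.Icc l u) (hb : b ∈ Set.Icc l u) :
    ‖ψ (Λ.toEquiv (y, t + b))‖ₑ ≤ ‖ψ (Λ.toEquiv (y, t + a))‖ₑ +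
      ∫⁻ r in Set.Ioo l u, ‖fderiv ℝ ψ (Λ.toEquiv (y, t + r))‖ₑ := by
  have hline : ∀ r : ℝ, HasDerivAt (fun r : ℝ => Λ.toEquiv (y, t + r)) (Λ.toEquiv (0, 1)) r :=
    fun r => Λ.toEquiv.toContinuousLinearMap.hasFDerivAt.comp_hasDerivAt r
      ((hasDerivAt_const r y).prodMk ((hasDerivAt_id r).const_add t))
  have hline' : ContDiff ℝ 1 fun r : ℝ => Λ.toEquiv (y, t + r) :=
    Λ.toEquiv.contDiff.comp (contDiff_const.prodMk (contDiff_const.add contDiff_id))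
  refine (enorm_le_add_lintegral_deriv (hψ.comp hline') ha hb).trans ?_
  refine add_le_add le_rfl (lintegral_mono fun r => ?_)
  have hd : HasDerivAt (ψ ∘ fun r : ℝ => Λ.toEquiv (y, t + r))
      (fderiv ℝ ψ (Λ.toEquiv (y, t + r)) (Λ.toEquiv (0, 1))) r :=
    ((hψ.differentiable one_ne_zero) _).hasFDerivAt.comp_hasDerivAt r (hline r)
  rw [hd.deriv]
  have := (fderiv ℝ ψ (Λ.toEquiv (y, t + r))).le_opNorm (Λ.toEquiv (0, 1))
  rw [Λ.norm_vert, mul_one] at this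
  exact enorm_le_iff_norm_le.2 this

end AxisCoords

/-- The Poincaré inequality in `L¹` for functions with compact support in a fixed ball. -/
lemma exists_lintegral_enorm_le_of_support_subset (n : ℕ) (R : ℝ) :
    ∃ C : ℝ≥0∞, C ≠ ⊤ ∧ ∀ ψ : Space (n + 1) → ℝ, ContDiff ℝ 1 ψ →
      Function.support ψ ⊆ Metric.ball 0 R → ∫⁻ x, ‖ψ x‖ₑ ≤ C * ∫⁻ x, ‖fderiv ℝ ψ x‖ₑ := by
  obtain ⟨Λ, -⟩ := AxisCoords.exists_vert_eq (n := n) (ν := EuclideanSpace.single 0 1) (by simp)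
  obtain ⟨c, -, hc, hF⟩ := Λ.exists_lintegral_eq
  refine ⟨ENNReal.ofReal (R + R), by simp, fun ψ hψ hs => ?_⟩
  have hmψ : Measurable fun x => ‖ψ x‖ₑ := hψ.continuous.measurable.enorm
  have hmd : Measurable fun x => ‖fderiv ℝ ψ x‖ₑ :=
    (hψ.continuous_fderiv one_ne_zero).measurable.enorm
  rw [hF _ hmψ, hF _ hmd, mul_left_comm]
  gcongr
  have hzero : ∀ (y : Space n) (t : ℝ), t ∉ Set.Ioo (-R) R → ψ (Λ.toEquiv (y, t)) = 0 :=
    fun y t ht => by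
      by_contra h0
      have h1 := mem_ball_zero_iff.1 (hs h0)
      have h2 := (Λ.abs_snd_le (Λ.toEquiv (y, t))).trans_lt h1
      rw [ContinuousLinearEquiv.symm_apply_apply] at h2
      exact ht (abs_lt.1 h2)
  rw [← lintegral_const_mul' _ _ (by simp)]
  refine lintegral_mono fun y => ?_
  have hbound : ∀ t : ℝ, ‖ψ (Λ.toEquiv (y, t))‖ₑ ≤ (Set.Ioo (-R) R).indicator
      (fun _ => ∫⁻ r, ‖fderiv ℝ ψ (Λ.toEquiv (y, r))‖ₑ) t := fun t => by
    by_cases ht : t ∈ Set.Ioo (-R) R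
    · rw [Set.indicator_of_mem ht]
      have := Λ.enorm_le_add_lintegral_fderiv hψ y 0 (l := -R) (u := R) (a := -R) (b := t)
        ⟨le_rfl, by linarith [ht.1, ht.2]⟩ ⟨ht.1.le, ht.2.le⟩
      simp only [zero_add] at this
      rw [hzero y (-R) (by simp), enorm_zero, zero_add] at this
      exact this.trans (setLIntegral_le_lintegral _ _)
    · rw [hzero y t ht]; simp
  refine (lintegral_mono hbound).trans ?_
  rw [lintegral_indicator_const measurableSet_Ioo, Real.volume_Ioo, mul_comm]
  simp

namespace BoundaryChart

variable {n : ℕ} {Ω : Set (Space (n + 1))} (c : BoundaryChart Ω)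

lemma measurable_comp_point {F : Space (n + 1) → ℝ≥0∞} (hF : Measurable F) :
    Measurable fun p : Space n × ℝ => F (c.point p.1 p.2) :=
  hF.comp c.continuous_point.measurable

lemma measurable_lintegral_point {F : Space (n + 1) → ℝ≥0∞} (hF : Measurable F) (T : Set ℝ) :
    Measurable fun y : Space n => ∫⁻ s in T, F (c.point y s) :=
  (c.measurable_comp_point hF).lintegral_prod_right'

/-- Fubini's theorem in the interior part of a boundary chart. -/
lemma exists_setLIntegral_eq (hΩ : IsOpen Ω) : ∃ k : ℝ≥0∞, k ≠ 0 ∧ k ≠ ⊤ ∧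
    ∀ F : Space (n + 1) → ℝ≥0∞, Measurable F → ∫⁻ x in Ω ∩ c.dom, F x =
      k * ∫⁻ y in Metric.ball c.y₀ c.δ, ∫⁻ s in Set.Ioo 0 c.h, F (c.point y s) := by
  obtain ⟨k, h0, h1, hk⟩ := c.exists_lintegral_eq_shear
  refine ⟨k, h0, h1, fun F hF => ?_⟩
  have hm : MeasurableSet (Ω ∩ c.dom) := (hΩ.inter c.isOpen_dom).measurableSet
  rw [← lintegral_indicator hm, hk _ (hF.indicator hm) c.g,
    ← lintegral_indicator Metric.isOpen_ball.measurableSet]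
  congr 2 with y
  by_cases hy : y ∈ Metric.ball c.y₀ c.δ
  · rw [Set.indicator_of_mem hy, ← lintegral_indicator measurableSet_Ioo]
    congr 1 with s
    have hiff : c.point y s ∈ Ω ∩ c.dom ↔ s ∈ Set.Ioo 0 c.h := by
      rw [Set.mem_inter_iff, c.point_mem_dom, Set.mem_Ioo, abs_lt]
      constructor
      · rintro ⟨h2, -, h3⟩
        exact ⟨(c.mem_iff y hy s (abs_lt.2 h3)).1 h2, h3.2⟩
      · rintro ⟨h2, h3⟩
        have h4 : -c.h < s := by linarith [c.h_pos]
        exact ⟨(c.mem_iff y hy s (abs_lt.2 ⟨h4, h3⟩)).2 h2, hy, h4, h3⟩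
    change (Ω ∩ c.dom).indicator F (c.point y s) = _
    by_cases hs : s ∈ Set.Ioo 0 c.h
    · rw [Set.indicator_of_mem hs, Set.indicator_of_mem (hiff.2 hs)]
    · rw [Set.indicator_of_notMem hs, Set.indicator_of_notMem (fun h => hs (hiff.1 h))]
  · rw [Set.indicator_of_notMem hy]
    refine (lintegral_congr fun s => ?_).trans lintegral_zero
    exact Set.indicator_of_notMem (fun h => hy (c.point_mem_dom.1 h.2).1) _

lemma lipschitzOnWith_point :
    LipschitzOnWith (1 + c.L) (fun y => c.point y 0) (Metric.ball c.y₀ c.δ) := by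
  refine LipschitzOnWith.of_dist_le_mul fun y hy y' hy' => ?_
  have h1 : c.point y 0 - c.point y' 0 = c.toEquiv (y - y', c.g y - c.g y') := by
    simp only [point, add_zero, ← map_sub, Prod.mk_sub_mk]
  have h2 := c.lipschitz_g.dist_le_mul y hy y' hy'
  rw [Real.dist_eq] at h2
  have h3 := c.norm_le (y - y', c.g y - c.g y')
  rw [dist_eq_norm, h1]
  simp only at h3
  rw [← dist_eq_norm] at h3
  push_cast
  linarith

lemma lipschitzWith_proj : LipschitzWith 1 c.proj := by
  refine LipschitzWith.of_dist_le_mul fun x x' => ?_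
  have h := c.norm_fst_le (x - x')
  rw [map_sub] at h
  rw [dist_eq_norm, dist_eq_norm, NNReal.coe_one, one_mul]
  exact h

/-- The graph map sends the part of a ball lying under `A` onto the part of `A` in the boundary. -/
lemma image_point_eq (A : Set (Space (n + 1))) :
    (fun y => c.point y 0) '' ((fun y => c.point y 0) ⁻¹' A ∩ Metric.ball c.y₀ c.δ) =
      A ∩ (frontier Ω ∩ c.dom) := by
  ext x
  constructor
  · rintro ⟨y, ⟨hy1, hy2⟩, rfl⟩
    exact ⟨hy1, (c.mem_frontier_iff y hy2 0 (by simpa using c.h_pos)).2 rfl,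
      c.point_mem_dom.2 ⟨hy2, by simpa using c.h_pos⟩⟩
  · rintro ⟨h1, h2, h3⟩
    have h4 := (c.mem_frontier_iff_of_mem_dom h3).1 h2
    have h5 : c.point (c.proj x) 0 = x := by rw [← h4, c.point_proj_height]
    exact ⟨c.proj x, ⟨by rw [Set.mem_preimage, h5]; exact h1, h3.1⟩, h5⟩

lemma measurable_point_zero : Measurable fun y => c.point y 0 :=
  (c.continuous_point.comp (continuous_id.prodMk continuous_const)).measurable

/-- The graph map increases surface measure at most by a constant factor. -/
lemma lintegral_frontier_le {F : Space (n + 1) → ℝ≥0∞} (hF : Measurable F) :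
    ∫⁻ x in frontier Ω ∩ c.dom, F x ∂(Measure.euclideanHausdorffMeasure n) ≤
      ((1 + c.L : NNReal) : ℝ≥0∞) ^ n * ∫⁻ y in Metric.ball c.y₀ c.δ, F (c.point y 0) := by
  have hle : (Measure.euclideanHausdorffMeasure n).restrict (frontier Ω ∩ c.dom) ≤
      (((1 + c.L : NNReal) : ℝ≥0∞) ^ n) •
        Measure.map (fun y => c.point y 0) (volume.restrict (Metric.ball c.y₀ c.δ)) := by
    refine Measure.le_iff.2 fun A hA => ?_
    rw [Measure.restrict_apply hA, Measure.smul_apply,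
      Measure.map_apply c.measurable_point_zero hA,
      Measure.restrict_apply (c.measurable_point_zero hA), ← c.image_point_eq, smul_eq_mul,
      ← EuclideanSpace.euclideanHausdorffMeasure_eq_volume]
    exact (c.lipschitzOnWith_point.mono Set.inter_subset_right).euclideanHausdorffMeasure_image_le n
  refine (lintegral_mono' hle le_rfl).trans ?_
  rw [lintegral_smul_measure, lintegral_map hF c.measurable_point_zero, smul_eq_mul]

/-- The projection of the graph to the horizontal plane does not increase surface measure. -/
lemma le_lintegral_frontier {F : Space (n + 1) → ℝ≥0∞} (hF : Measurable F) :
    ∫⁻ y in Metric.ball c.y₀ c.δ, F (c.point y 0) ≤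
      ∫⁻ x in frontier Ω ∩ c.dom, F x ∂(Measure.euclideanHausdorffMeasure n) := by
  have hle : Measure.map (fun y => c.point y 0) (volume.restrict (Metric.ball c.y₀ c.δ)) ≤
      (Measure.euclideanHausdorffMeasure n).restrict (frontier Ω ∩ c.dom) := by
    refine Measure.le_iff.2 fun A hA => ?_
    rw [Measure.restrict_apply hA, Measure.map_apply c.measurable_point_zero hA,
      Measure.restrict_apply (c.measurable_point_zero hA), ← c.image_point_eq,
      ← EuclideanSpace.euclideanHausdorffMeasure_eq_volume]
    set B := (fun y => c.point y 0) ⁻¹' A ∩ Metric.ball c.y₀ c.δ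
    have h1 : B = c.proj '' ((fun y => c.point y 0) '' B) := by
      rw [Set.image_image]; simp
    have h2 := (c.lipschitzWith_proj.lipschitzOnWith
      (s := (fun y => c.point y 0) '' B)).euclideanHausdorffMeasure_image_le n
    rw [← h1] at h2
    simpa using h2
  rw [← lintegral_map hF c.measurable_point_zero]
  exact lintegral_mono' hle le_rfl

variable {ψ : Space (n + 1) → ℝ}

lemma enorm_point_le (hψ : ContDiff ℝ 1 ψ) (y : Space n) {a b : ℝ} (ha : a ∈ Set.Icc 0 c.h)
    (hb : b ∈ Set.Icc 0 c.h) : ‖ψ (c.point y b)‖ₑ ≤ ‖ψ (c.point y a)‖ₑ +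
      ∫⁻ r in Set.Ioo 0 c.h, ‖fderiv ℝ ψ (c.point y r)‖ₑ :=
  c.enorm_le_add_lintegral_fderiv hψ y (c.g y) ha hb

/-- The trace inequality within a boundary chart. -/
lemma exists_lintegral_frontier_le (hΩ : IsOpen Ω) : ∃ C : ℝ≥0∞, C ≠ ⊤ ∧
    ∀ ψ : Space (n + 1) → ℝ, ContDiff ℝ 1 ψ →
      ∫⁻ x in frontier Ω ∩ c.dom, ‖ψ x‖ₑ ∂(Measure.euclideanHausdorffMeasure n) ≤
        C * ∫⁻ x in Ω, (‖ψ x‖ₑ + ‖fderiv ℝ ψ x‖ₑ) := by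
  obtain ⟨k, hk0, hk1, hk⟩ := c.exists_setLIntegral_eq hΩ
  set H := ENNReal.ofReal c.h with hH
  have hH0 : H ≠ 0 := by simpa [hH] using c.h_pos
  have hH1 : H ≠ ⊤ := by simp [hH]
  have hkH0 : k * H ≠ 0 := mul_ne_zero hk0 hH0
  have hkH1 : k * H ≠ ⊤ := ENNReal.mul_ne_top hk1 hH1
  refine ⟨((1 + c.L : NNReal) : ℝ≥0∞) ^ n * ((k * H)⁻¹ * (1 + H)), ?_, fun ψ hψ => ?_⟩
  · exact ENNReal.mul_ne_top (by simp) (ENNReal.mul_ne_top (ENNReal.inv_ne_top.2 hkH0)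
      (by simp [hH1]))
  have hmψ : Measurable fun x => ‖ψ x‖ₑ := hψ.continuous.measurable.enorm
  have hmd : Measurable fun x => ‖fderiv ℝ ψ x‖ₑ :=
    (hψ.continuous_fderiv one_ne_zero).measurable.enorm
  refine (c.lintegral_frontier_le hmψ).trans ?_
  rw [mul_assoc]
  gcongr
  set J := ∫⁻ y in Metric.ball c.y₀ c.δ, ‖ψ (c.point y 0)‖ₑ
  have hpt : ∀ y, H * ‖ψ (c.point y 0)‖ₑ ≤ (∫⁻ s in Set.Ioo 0 c.h, ‖ψ (c.point y s)‖ₑ) +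
      H * ∫⁻ r in Set.Ioo 0 c.h, ‖fderiv ℝ ψ (c.point y r)‖ₑ := fun y => by
    calc H * ‖ψ (c.point y 0)‖ₑ = ∫⁻ _ in Set.Ioo 0 c.h, ‖ψ (c.point y 0)‖ₑ := by
          rw [setLIntegral_const, Real.volume_Ioo, sub_zero, mul_comm]
      _ ≤ ∫⁻ s in Set.Ioo 0 c.h, (‖ψ (c.point y s)‖ₑ +
            ∫⁻ r in Set.Ioo 0 c.h, ‖fderiv ℝ ψ (c.point y r)‖ₑ) :=
          setLIntegral_mono' measurableSet_Ioo fun s hs =>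
            c.enorm_point_le hψ y ⟨hs.1.le, hs.2.le⟩ ⟨le_rfl, c.h_pos.le⟩
      _ = _ := by
          rw [lintegral_add_right _ measurable_const, setLIntegral_const, Real.volume_Ioo, sub_zero,
            mul_comm H]
  have hJ : H * J ≤ (∫⁻ y in Metric.ball c.y₀ c.δ, ∫⁻ s in Set.Ioo 0 c.h, ‖ψ (c.point y s)‖ₑ) +
      H * ∫⁻ y in Metric.ball c.y₀ c.δ, ∫⁻ s in Set.Ioo 0 c.h, ‖fderiv ℝ ψ (c.point y s)‖ₑ := by
    rw [← lintegral_const_mul' _ _ hH1, ← lintegral_const_mul' _ _ hH1,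
      ← lintegral_add_left (c.measurable_lintegral_point hmψ _)]
    exact lintegral_mono hpt
  have hkJ : (k * H) * J ≤ (1 + H) * ∫⁻ x in Ω, (‖ψ x‖ₑ + ‖fderiv ℝ ψ x‖ₑ) := by
    calc (k * H) * J = k * (H * J) := by ring
      _ ≤ (∫⁻ x in Ω ∩ c.dom, ‖ψ x‖ₑ) + H * ∫⁻ x in Ω ∩ c.dom, ‖fderiv ℝ ψ x‖ₑ := by
          rw [hk _ hmψ, hk _ hmd]
          refine (mul_le_mul_right hJ k).trans (le_of_eq (by ring))
      _ ≤ (1 + H) * ((∫⁻ x in Ω, ‖ψ x‖ₑ) + ∫⁻ x in Ω, ‖fderiv ℝ ψ x‖ₑ) := by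
          have h1 : ∫⁻ x in Ω ∩ c.dom, ‖ψ x‖ₑ ≤ ∫⁻ x in Ω, ‖ψ x‖ₑ :=
            lintegral_mono_set Set.inter_subset_left
          have h2 : ∫⁻ x in Ω ∩ c.dom, ‖fderiv ℝ ψ x‖ₑ ≤ ∫⁻ x in Ω, ‖fderiv ℝ ψ x‖ₑ :=
            lintegral_mono_set Set.inter_subset_left
          rw [mul_add]
          refine add_le_add (h1.trans (le_mul_of_one_le_left zero_le (by simp))) ?_
          exact mul_le_mul' (by simp) h2
      _ = _ := by rw [lintegral_add_left hmψ]
  calc J = (k * H)⁻¹ * ((k * H) * J) := by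
        rw [← mul_assoc, ENNReal.inv_mul_cancel hkH0 hkH1, one_mul]
    _ ≤ (k * H)⁻¹ * ((1 + H) * ∫⁻ x in Ω, (‖ψ x‖ₑ + ‖fderiv ℝ ψ x‖ₑ)) := by gcongr
    _ = _ := by ring

/-- The collar of a boundary chart is controlled by the gradient and the boundary values. -/
lemma exists_setLIntegral_le (hΩ : IsOpen Ω) : ∃ C : ℝ≥0∞, C ≠ ⊤ ∧
    ∀ ψ : Space (n + 1) → ℝ, ContDiff ℝ 1 ψ →
      ∫⁻ x in Ω ∩ c.dom, ‖ψ x‖ₑ ≤ C * ((∫⁻ x in Ω, ‖fderiv ℝ ψ x‖ₑ) +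
        ∫⁻ x in frontier Ω, ‖ψ x‖ₑ ∂(Measure.euclideanHausdorffMeasure n)) := by
  obtain ⟨k, hk0, hk1, hk⟩ := c.exists_setLIntegral_eq hΩ
  set H := ENNReal.ofReal c.h with hH
  have hH1 : H ≠ ⊤ := by simp [hH]
  refine ⟨H + k * H, by simp [hH1, ENNReal.mul_ne_top hk1 hH1], fun ψ hψ => ?_⟩
  have hmψ : Measurable fun x => ‖ψ x‖ₑ := hψ.continuous.measurable.enorm
  have hmd : Measurable fun x => ‖fderiv ℝ ψ x‖ₑ :=
    (hψ.continuous_fderiv one_ne_zero).measurable.enorm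
  have hpt : ∀ y, ∫⁻ s in Set.Ioo 0 c.h, ‖ψ (c.point y s)‖ₑ ≤
      H * (‖ψ (c.point y 0)‖ₑ + ∫⁻ r in Set.Ioo 0 c.h, ‖fderiv ℝ ψ (c.point y r)‖ₑ) := fun y => by
    calc _ ≤ ∫⁻ _ in Set.Ioo 0 c.h, (‖ψ (c.point y 0)‖ₑ +
            ∫⁻ r in Set.Ioo 0 c.h, ‖fderiv ℝ ψ (c.point y r)‖ₑ) :=
          setLIntegral_mono' measurableSet_Ioo fun s hs =>
            c.enorm_point_le hψ y ⟨le_rfl, c.h_pos.le⟩ ⟨hs.1.le, hs.2.le⟩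
      _ = _ := by rw [setLIntegral_const, Real.volume_Ioo, sub_zero, mul_comm]
  have hmain : ∫⁻ x in Ω ∩ c.dom, ‖ψ x‖ₑ ≤ (k * H) *
      (∫⁻ y in Metric.ball c.y₀ c.δ, ‖ψ (c.point y 0)‖ₑ) +
        H * ∫⁻ x in Ω ∩ c.dom, ‖fderiv ℝ ψ x‖ₑ := by
    rw [hk _ hmψ, hk _ hmd]
    calc _ ≤ k * ∫⁻ y in Metric.ball c.y₀ c.δ, H * (‖ψ (c.point y 0)‖ₑ +
            ∫⁻ r in Set.Ioo 0 c.h, ‖fderiv ℝ ψ (c.point y r)‖ₑ) := by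
          gcongr with y; exact hpt y
      _ = _ := by
          rw [lintegral_const_mul' _ _ hH1, lintegral_add_right _ (c.measurable_lintegral_point hmd _)]
          ring
  have h1 : ∫⁻ y in Metric.ball c.y₀ c.δ, ‖ψ (c.point y 0)‖ₑ ≤
      ∫⁻ x in frontier Ω, ‖ψ x‖ₑ ∂(Measure.euclideanHausdorffMeasure n) :=
    (c.le_lintegral_frontier hmψ).trans (lintegral_mono_set Set.inter_subset_left)
  have h2 : ∫⁻ x in Ω ∩ c.dom, ‖fderiv ℝ ψ x‖ₑ ≤ ∫⁻ x in Ω, ‖fderiv ℝ ψ x‖ₑ :=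
    lintegral_mono_set Set.inter_subset_left
  refine hmain.trans ?_
  rw [mul_add, add_comm]
  exact add_le_add (mul_le_mul' (by simp) h2) (mul_le_mul' (by simp) h1)

end BoundaryChart

section SmoothFunctions

variable {n : ℕ} {Ω : Set (Space (n + 1))}

lemma IsSmoothBoundedDomain.isFiniteMeasure_restrict {N : ℕ} {Ω : Set (Space N)}
    (hΩ : IsSmoothBoundedDomain Ω) : IsFiniteMeasure (volume.restrict Ω) :=
  ⟨by rw [Measure.restrict_apply_univ]; exact hΩ.isBounded.measure_lt_top⟩

lemma IsSmoothBoundedDomain.isCompact_frontier (hΩ : IsSmoothBoundedDomain Ω) :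
    IsCompact (frontier Ω) :=
  Metric.isCompact_of_isClosed_isBounded isClosed_frontier
    (hΩ.isBounded.closure.subset frontier_subset_closure)

/-- Finitely many boundary charts cover the boundary of a smooth bounded domain. -/
lemma IsSmoothBoundedDomain.exists_finset_boundaryChart (hΩ : IsSmoothBoundedDomain Ω) :
    ∃ t : Finset (BoundaryChart Ω), frontier Ω ⊆ ⋃ c ∈ t, c.dom :=
  hΩ.isCompact_frontier.elim_finite_subcover (fun c : BoundaryChart Ω => c.dom)
    (fun c => c.isOpen_dom) fun _ hx =>
      let ⟨c, hc⟩ := hΩ.exists_boundaryChart hx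
      Set.mem_iUnion.2 ⟨c, hc⟩

lemma setLIntegral_biUnion_finset_le {α ι : Type*} [MeasurableSpace α] (μ : Measure α)
    (f : α → ℝ≥0∞) (t : Finset ι) (s : ι → Set α) :
    ∫⁻ x in ⋃ i ∈ t, s i, f x ∂μ ≤ ∑ i ∈ t, ∫⁻ x in s i, f x ∂μ := by
  classical
  induction t using Finset.induction_on with
  | empty => simp
  | insert a t ha ih =>
    rw [Finset.set_biUnion_insert, Finset.sum_insert ha]
    exact (lintegral_union_le _ _ _).trans (add_le_add le_rfl ih)

/-- Smooth cutoff functions between a compact set and an open neighbourhood. -/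
lemma exists_smooth_cutoff {N : ℕ} {K U : Set (Space N)} (hK : IsCompact K) (hU : IsOpen U)
    (hKU : K ⊆ U) : ∃ η : Space N → ℝ, ContDiff ℝ ∞ η ∧ HasCompactSupport η ∧ tsupport η ⊆ U ∧
      (∀ᶠ x in 𝓝ˢ K, η x = 1) ∧ ∀ x, η x ∈ Set.Icc 0 1 := by
  obtain ⟨K', hK', hKK', hK'U⟩ := exists_compact_between hK hU hKU
  obtain ⟨f, hf1, hf0, hf⟩ := exists_contMDiffMap_one_nhds_of_subset_interior (n := (⊤ : ℕ∞))
    (modelWithCornersSelf ℝ (Space N)) hK.isClosed hKK'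
  have hsupp : tsupport f ⊆ K' :=
    closure_minimal (fun x hx => by_contra fun h => hx (hf0 x h)) hK'.isClosed
  exact ⟨f, f.contMDiff.contDiff, hK'.of_isClosed_subset (isClosed_tsupport _) hsupp,
    hsupp.trans hK'U, hf1, hf⟩

/-- The trace inequality in `L¹`. -/
lemma IsSmoothBoundedDomain.exists_trace_ineq (hΩ : IsSmoothBoundedDomain Ω) :
    ∃ C : ℝ≥0∞, C ≠ ⊤ ∧ ∀ ψ : Space (n + 1) → ℝ, ContDiff ℝ 1 ψ →
      ∫⁻ x, ‖ψ x‖ₑ ∂(surfaceMeasure Ω) ≤ C * ∫⁻ x in Ω, (‖ψ x‖ₑ + ‖fderiv ℝ ψ x‖ₑ) := by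
  obtain ⟨t, ht⟩ := hΩ.exists_finset_boundaryChart
  choose C hC h using fun c : BoundaryChart Ω => c.exists_lintegral_frontier_le hΩ.isOpen
  refine ⟨∑ c ∈ t, C c, by simp [ENNReal.sum_eq_top, hC], fun ψ hψ => ?_⟩
  have hsub : frontier Ω ⊆ ⋃ c ∈ t, frontier Ω ∩ c.dom := by
    rw [← Set.inter_iUnion₂]
    exact Set.subset_inter le_rfl ht
  calc ∫⁻ x, ‖ψ x‖ₑ ∂(surfaceMeasure Ω)
      ≤ ∫⁻ x in ⋃ c ∈ t, frontier Ω ∩ c.dom, ‖ψ x‖ₑ ∂(Measure.euclideanHausdorffMeasure n) :=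
        lintegral_mono_set hsub
    _ ≤ ∑ c ∈ t, ∫⁻ x in frontier Ω ∩ c.dom, ‖ψ x‖ₑ ∂(Measure.euclideanHausdorffMeasure n) :=
        setLIntegral_biUnion_finset_le _ _ _ _
    _ ≤ ∑ c ∈ t, C c * ∫⁻ x in Ω, (‖ψ x‖ₑ + ‖fderiv ℝ ψ x‖ₑ) :=
        Finset.sum_le_sum fun c _ => h c ψ hψ
    _ = _ := by rw [Finset.sum_mul]

/-- The Friedrichs inequality in `L¹`: away from the boundary it is the Poincaré inequality for a
function with compact support, and in the boundary charts it is an estimate of the collar. -/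
lemma IsSmoothBoundedDomain.exists_friedrichs_ineq (hΩ : IsSmoothBoundedDomain Ω) :
    ∃ C : ℝ≥0∞, C ≠ ⊤ ∧ ∀ ψ : Space (n + 1) → ℝ, ContDiff ℝ 1 ψ →
      ∫⁻ x in Ω, ‖ψ x‖ₑ ≤
        C * ((∫⁻ x in Ω, ‖fderiv ℝ ψ x‖ₑ) + ∫⁻ x, ‖ψ x‖ₑ ∂(surfaceMeasure Ω)) := by
  obtain ⟨t, ht⟩ := hΩ.exists_finset_boundaryChart
  choose C hC h using fun c : BoundaryChart Ω => c.exists_setLIntegral_le hΩ.isOpen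
  set V : Set (Space (n + 1)) := ⋃ c ∈ t, c.dom
  have hV : IsOpen V := isOpen_biUnion fun c _ => c.isOpen_dom
  have hK : IsCompact (closure Ω \ V) := hΩ.isBounded.isCompact_closure.diff hV
  have hKΩ : closure Ω \ V ⊆ Ω := fun x hx => by
    by_contra hxΩ
    exact hx.2 (ht (by rw [hΩ.isOpen.frontier_eq]; exact ⟨hx.1, hxΩ⟩))
  obtain ⟨η, hη, hηc, hηΩ, hη1, hη01⟩ := exists_smooth_cutoff hK hΩ.isOpen hKΩ
  obtain ⟨M, hM⟩ := (hη.continuous_fderiv (by simp)).bounded_above_of_compact_support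
    (hηc.fderiv (𝕜 := ℝ))
  obtain ⟨R, hR⟩ := hΩ.isBounded.subset_ball 0
  obtain ⟨D, hD, hP⟩ := exists_lintegral_enorm_le_of_support_subset n R
  have hMM : ENNReal.ofReal M ≠ ⊤ := ENNReal.ofReal_ne_top
  have hS : ∑ c ∈ t, C c ≠ ⊤ := by simp [ENNReal.sum_eq_top, hC]
  refine ⟨D + (D * ENNReal.ofReal M + 1) * ∑ c ∈ t, C c, ?_, fun ψ hψ => ?_⟩
  · exact ENNReal.add_ne_top.2 ⟨hD, ENNReal.mul_ne_top
      (ENNReal.add_ne_top.2 ⟨ENNReal.mul_ne_top hD hMM, ENNReal.one_ne_top⟩) hS⟩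
  have hmψ : Measurable fun x => ‖ψ x‖ₑ := hψ.continuous.measurable.enorm
  have hmd : Measurable fun x => ‖fderiv ℝ ψ x‖ₑ :=
    (hψ.continuous_fderiv one_ne_zero).measurable.enorm
  set Q := (∫⁻ x in Ω, ‖fderiv ℝ ψ x‖ₑ) + ∫⁻ x, ‖ψ x‖ₑ ∂(surfaceMeasure Ω)
  have hη1' : ContDiff ℝ 1 η := hη.of_le (by simp)
  have hcollar : ∫⁻ x in Ω ∩ V, ‖ψ x‖ₑ ≤ (∑ c ∈ t, C c) * Q := by
    rw [Set.inter_iUnion₂, Finset.sum_mul]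
    exact (setLIntegral_biUnion_finset_le _ _ _ _).trans (Finset.sum_le_sum fun c _ => h c ψ hψ)
  have hcut : ∫⁻ x, ‖η x * ψ x‖ₑ ≤ D * ((∫⁻ x in Ω, ‖fderiv ℝ ψ x‖ₑ) +
      ENNReal.ofReal M * ∫⁻ x in Ω ∩ V, ‖ψ x‖ₑ) := by
    refine (hP (fun x => η x * ψ x) (hη1'.mul hψ) ?_).trans ?_
    · intro x hx
      exact hR (hηΩ (subset_tsupport _ (left_ne_zero_of_mul hx)))
    gcongr
    have hmeas : MeasurableSet (Ω ∩ V) := (hΩ.isOpen.inter hV).measurableSet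
    rw [← lintegral_const_mul' _ _ hMM, ← lintegral_indicator hΩ.isOpen.measurableSet,
      ← lintegral_indicator hmeas, ← lintegral_add_left (hmd.indicator hΩ.isOpen.measurableSet)]
    refine lintegral_mono fun x => ?_
    have hder : fderiv ℝ (fun x => η x * ψ x) x = η x • fderiv ℝ ψ x + ψ x • fderiv ℝ η x :=
      fderiv_fun_mul ((hη1'.differentiable one_ne_zero) x) ((hψ.differentiable one_ne_zero) x)
    change ‖fderiv ℝ (fun x => η x * ψ x) x‖ₑ ≤ _
    rw [hder]
    refine (enorm_add_le (η x • fderiv ℝ ψ x) (ψ x • fderiv ℝ η x)).trans (add_le_add ?_ ?_)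
    · by_cases hx : x ∈ Ω
      · rw [Set.indicator_of_mem hx, enorm_smul]
        refine mul_le_of_le_one_left zero_le ?_
        have := hη01 x
        rw [Real.enorm_of_nonneg this.1]
        exact ENNReal.ofReal_le_one.2 this.2
      · rw [image_eq_zero_of_notMem_tsupport (fun h => hx (hηΩ h)), zero_smul]
        exact (enorm_zero (E := Space (n + 1) →L[ℝ] ℝ)).trans_le zero_le
    · by_cases hx : x ∈ Ω ∩ V
      · rw [Set.indicator_of_mem hx, enorm_smul, mul_comm]
        gcongr
        rw [← ofReal_norm]
        exact ENNReal.ofReal_le_ofReal (hM x)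
      · -- off the charts the cutoff is locally constant
        have h0 : fderiv ℝ η x = 0 := by
          by_cases hxΩ : x ∈ Ω
          · have hxK : x ∈ closure Ω \ V := ⟨subset_closure hxΩ, fun h => hx ⟨hxΩ, h⟩⟩
            have : η =ᶠ[𝓝 x] fun _ => 1 := (eventually_nhdsSet_iff_forall.1 hη1) x hxK
            rw [this.fderiv_eq]; simp
          · exact image_eq_zero_of_notMem_tsupport
              (fun h => hx (absurd (hηΩ (tsupport_fderiv_subset ℝ h)) hxΩ))
        rw [h0, smul_zero]
        exact (enorm_zero (E := Space (n + 1) →L[ℝ] ℝ)).trans_le zero_le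
  have hsplit : ∫⁻ x in Ω, ‖ψ x‖ₑ ≤ (∫⁻ x, ‖η x * ψ x‖ₑ) + ∫⁻ x in Ω ∩ V, ‖ψ x‖ₑ := by
    have hmeas : MeasurableSet (Ω ∩ V) := (hΩ.isOpen.inter hV).measurableSet
    rw [← lintegral_indicator hΩ.isOpen.measurableSet, ← lintegral_indicator hmeas,
      ← lintegral_add_left (f := fun x => ‖η x * ψ x‖ₑ)
        (hη.continuous.mul hψ.continuous).measurable.enorm]
    refine lintegral_mono fun x => ?_
    by_cases hx : x ∈ Ω
    · rw [Set.indicator_of_mem hx]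
      by_cases hxV : x ∈ V
      · rw [Set.indicator_of_mem (Set.mem_inter hx hxV)]
        exact le_add_self
      · have h1 : η x = 1 :=
          ((eventually_nhdsSet_iff_forall.1 hη1) x ⟨subset_closure hx, hxV⟩).self_of_nhds
        rw [h1, one_mul]
        exact le_self_add
    · rw [Set.indicator_of_notMem hx]; exact zero_le
  have hQ1 : ∫⁻ x in Ω, ‖fderiv ℝ ψ x‖ₑ ≤ Q := le_self_add
  calc _ ≤ D * ((∫⁻ x in Ω, ‖fderiv ℝ ψ x‖ₑ) + ENNReal.ofReal M * ∫⁻ x in Ω ∩ V, ‖ψ x‖ₑ) +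
        ∫⁻ x in Ω ∩ V, ‖ψ x‖ₑ := hsplit.trans (add_le_add hcut le_rfl)
    _ ≤ D * (Q + ENNReal.ofReal M * ((∑ c ∈ t, C c) * Q)) + (∑ c ∈ t, C c) * Q := by gcongr
    _ = _ := by ring

lemma isFiniteMeasure_surfaceMeasure (hΩ : IsSmoothBoundedDomain Ω) :
    IsFiniteMeasure (surfaceMeasure Ω) := by
  obtain ⟨C, hC, h⟩ := hΩ.exists_trace_ineq
  have h1 := h (fun _ => 1) contDiff_const
  have h0 : ∀ x : Space (n + 1), ‖fderiv ℝ (fun _ : Space (n + 1) => (1 : ℝ)) x‖ₑ = 0 :=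
    fun x => by rw [fderiv_fun_const, Pi.zero_apply]; exact enorm_zero (E := Space (n + 1) →L[ℝ] ℝ)
  simp only [enorm_one, h0, add_zero, lintegral_one, Measure.restrict_apply_univ] at h1
  exact ⟨h1.trans_lt (ENNReal.mul_lt_top hC.lt_top hΩ.isBounded.measure_lt_top)⟩

/-- The squared norm of a smooth map: its gradient is controlled by the map and its partial
derivatives. -/
lemma enorm_fderiv_norm_sq_le {N : ℕ} {Φ : Space N → Vec3} (hΦ : ContDiff ℝ 1 Φ) (x : Space N) :
    ‖fderiv ℝ (fun x => ‖Φ x‖ ^ 2) x‖ₑ ≤ 2 * (‖Φ x‖ₑ * ‖fderiv ℝ Φ x‖ₑ) := by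
  have hd := ((hΦ.differentiable one_ne_zero) x).hasFDerivAt
  rw [hd.norm_sq.fderiv]
  have h : ‖(2 : ℕ) • (innerSL ℝ (Φ x)).comp (fderiv ℝ Φ x)‖ ≤ 2 * (‖Φ x‖ * ‖fderiv ℝ Φ x‖) := by
    rw [← Nat.cast_smul_eq_nsmul ℝ, norm_smul]
    have := (innerSL ℝ (Φ x)).opNorm_comp_le (fderiv ℝ Φ x)
    rw [innerSL_apply_norm] at this
    simpa using this
  rw [← ofReal_norm, ← ofReal_norm (Φ x), ← ofReal_norm (fderiv ℝ Φ x),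
    ← ENNReal.ofReal_mul (norm_nonneg _)]
  refine (ENNReal.ofReal_le_ofReal h).trans ?_
  rw [ENNReal.ofReal_mul (by norm_num), ENNReal.ofReal_ofNat]

lemma enorm_sq_le_sum_enorm_sq {N : ℕ} {F : Type*} [NormedAddCommGroup F] [NormedSpace ℝ F]
    (T : Space N →L[ℝ] F) : ‖T‖ₑ ^ 2 ≤ ∑ i, ‖T (basisVec i)‖ₑ ^ 2 := by
  have h0 : 0 ≤ ∑ i, ‖T (basisVec i)‖ ^ 2 := Finset.sum_nonneg fun i _ => sq_nonneg _
  have h : ‖T‖ ^ 2 ≤ ∑ i, ‖T (basisVec i)‖ ^ 2 := by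
    rw [← Real.sq_sqrt h0]
    refine pow_le_pow_left₀ (norm_nonneg _) (T.opNorm_le_bound (Real.sqrt_nonneg _) fun v => ?_) 2
    have hv : T v = ∑ i, v i • T (basisVec i) := by
      conv_lhs => rw [← (EuclideanSpace.basisFun (Fin N) ℝ).sum_repr v, map_sum]
      simp [basisVec]
    calc ‖T v‖ ≤ ∑ i, |v i| * ‖T (basisVec i)‖ := by
          rw [hv]
          refine (norm_sum_le _ _).trans (Finset.sum_le_sum fun i _ => ?_)
          rw [norm_smul, Real.norm_eq_abs]
      _ ≤ √(∑ i, |v i| ^ 2) * √(∑ i, ‖T (basisVec i)‖ ^ 2) := Real.sum_mul_le_sqrt_mul_sqrt _ _ _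
      _ = _ := by
          rw [mul_comm, EuclideanSpace.norm_eq]; simp
  have h2 := ENNReal.ofReal_le_ofReal h
  rw [ENNReal.ofReal_sum_of_nonneg (fun i _ => sq_nonneg _)] at h2
  simpa only [ENNReal.ofReal_pow (norm_nonneg _), ofReal_norm] using h2

lemma enorm_le_sum_enorm {N : ℕ} {F : Type*} [NormedAddCommGroup F] [NormedSpace ℝ F]
    (T : Space N →L[ℝ] F) : ‖T‖ₑ ≤ ∑ i, ‖T (basisVec i)‖ₑ := by
  refine (ENNReal.pow_le_pow_left_iff two_ne_zero).1 ((enorm_sq_le_sum_enorm_sq T).trans ?_)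
  rw [sq, Finset.sum_mul]
  refine Finset.sum_le_sum fun i _ => ?_
  rw [sq]
  exact mul_le_mul_right (Finset.single_le_sum (f := fun i => ‖T (basisVec i)‖ₑ)
    (fun _ _ => zero_le) (Finset.mem_univ i)) _

/-- Young's inequality, with the weights that absorb the first term in Friedrichs' inequality. -/
lemma two_mul_enorm_mul_le {E F : Type*} [SeminormedAddCommGroup E] [SeminormedAddCommGroup F]
    (c : NNReal) (a : E) (b : F) :
    2 * (c * (2 * (‖a‖ₑ * ‖b‖ₑ))) ≤ ‖a‖ₑ ^ 2 + 4 * (c : ℝ≥0∞) ^ 2 * ‖b‖ₑ ^ 2 := by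
  have h : 2 * (c * (2 * (‖a‖₊ * ‖b‖₊))) ≤ ‖a‖₊ ^ 2 + 4 * c ^ 2 * ‖b‖₊ ^ 2 := by
    rw [← NNReal.coe_le_coe]
    push_cast
    nlinarith [sq_nonneg (‖a‖ - 2 * c * ‖b‖)]
  rw [enorm_eq_nnnorm, enorm_eq_nnnorm]
  exact_mod_cast h

lemma lintegral_enorm_fderiv_sq_le {N : ℕ} (Ω : Set (Space N)) (Φ : Space N → Vec3) :
    ∫⁻ x in Ω, ‖fderiv ℝ Φ x‖ₑ ^ 2 ≤ ∫⁻ x in Ω, ∑ i, ‖fderiv ℝ Φ x (basisVec i)‖ₑ ^ 2 :=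
  lintegral_mono fun _ => enorm_sq_le_sum_enorm_sq _

lemma enorm_norm_sq (v : Vec3) : ‖‖v‖ ^ 2‖ₑ = ‖v‖ₑ ^ 2 := by simp [enorm_pow]

/-- The trace inequality in `L²`. -/
lemma IsSmoothBoundedDomain.exists_trace_ineq_sq (hΩ : IsSmoothBoundedDomain Ω) :
    ∃ C : ℝ≥0∞, C ≠ ⊤ ∧ ∀ Φ : Space (n + 1) → Vec3, ContDiff ℝ 1 Φ →
      ∫⁻ x, ‖Φ x‖ₑ ^ 2 ∂(surfaceMeasure Ω) ≤ C * ((∫⁻ x in Ω, ‖Φ x‖ₑ ^ 2) +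
        ∫⁻ x in Ω, ∑ i, ‖fderiv ℝ Φ x (basisVec i)‖ₑ ^ 2) := by
  obtain ⟨C, hC, h⟩ := hΩ.exists_trace_ineq
  refine ⟨C * 4, ENNReal.mul_ne_top hC (by simp), fun Φ hΦ => ?_⟩
  have h1 := h (fun x => ‖Φ x‖ ^ 2) (hΦ.norm_sq ℝ)
  simp only [enorm_norm_sq] at h1
  have hm : Measurable fun x => ‖Φ x‖ₑ ^ 2 := hΦ.continuous.measurable.enorm.pow_const 2
  have h2 : ∫⁻ x in Ω, (‖Φ x‖ₑ ^ 2 + ‖fderiv ℝ (fun x => ‖Φ x‖ ^ 2) x‖ₑ) ≤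
      4 * ((∫⁻ x in Ω, ‖Φ x‖ₑ ^ 2) + ∫⁻ x in Ω, ‖fderiv ℝ Φ x‖ₑ ^ 2) := by
    rw [← lintegral_add_left hm, ← lintegral_const_mul' _ _ (by simp)]
    refine lintegral_mono fun x => (add_le_add le_rfl (enorm_fderiv_norm_sq_le hΦ x)).trans ?_
    have h3 : ‖Φ x‖₊ ^ 2 + 2 * (‖Φ x‖₊ * ‖fderiv ℝ Φ x‖₊) ≤
        4 * (‖Φ x‖₊ ^ 2 + ‖fderiv ℝ Φ x‖₊ ^ 2) := by
      rw [← NNReal.coe_le_coe]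
      push_cast
      nlinarith [sq_nonneg (‖Φ x‖ - ‖fderiv ℝ Φ x‖)]
    rw [enorm_eq_nnnorm, enorm_eq_nnnorm]
    exact_mod_cast h3
  calc _ ≤ C * (4 * ((∫⁻ x in Ω, ‖Φ x‖ₑ ^ 2) + ∫⁻ x in Ω, ‖fderiv ℝ Φ x‖ₑ ^ 2)) :=
        h1.trans (mul_le_mul_right h2 C)
    _ ≤ C * (4 * ((∫⁻ x in Ω, ‖Φ x‖ₑ ^ 2) +
          ∫⁻ x in Ω, ∑ i, ‖fderiv ℝ Φ x (basisVec i)‖ₑ ^ 2)) := by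
        gcongr C * (4 * (_ + ?_))
        exact lintegral_enorm_fderiv_sq_le Ω Φ
    _ = _ := by ring

/-- The Friedrichs inequality in `L²`. -/
lemma IsSmoothBoundedDomain.exists_friedrichs_ineq_sq (hΩ : IsSmoothBoundedDomain Ω) :
    ∃ C : ℝ≥0∞, C ≠ ⊤ ∧ ∀ Φ : Space (n + 1) → Vec3, ContDiff ℝ 1 Φ →
      ∫⁻ x in Ω, ‖Φ x‖ₑ ^ 2 ≤ C * ((∫⁻ x in Ω, ∑ i, ‖fderiv ℝ Φ x (basisVec i)‖ₑ ^ 2) +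
        ∫⁻ x, ‖Φ x‖ₑ ^ 2 ∂(surfaceMeasure Ω)) := by
  obtain ⟨C, hC, h⟩ := hΩ.exists_friedrichs_ineq
  lift C to NNReal using hC
  refine ⟨4 * (C : ℝ≥0∞) ^ 2 + 2 * C, by simp [ENNReal.mul_eq_top], fun Φ hΦ => ?_⟩
  have h1 := h (fun x => ‖Φ x‖ ^ 2) (hΦ.norm_sq ℝ)
  simp only [enorm_norm_sq] at h1
  have hm : Measurable fun x => ‖Φ x‖ₑ ^ 2 := hΦ.continuous.measurable.enorm.pow_const 2
  set X := ∫⁻ x in Ω, ‖Φ x‖ₑ ^ 2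
  set G := ∫⁻ x in Ω, ‖fderiv ℝ Φ x‖ₑ ^ 2
  set S := ∫⁻ x, ‖Φ x‖ₑ ^ 2 ∂(surfaceMeasure Ω)
  have hXtop : X ≠ ⊤ := by
    have hint : IntegrableOn (fun x => ‖Φ x‖ ^ 2) (closure Ω) :=
      (hΦ.continuous.norm.pow 2).continuousOn.integrableOn_compact hΩ.isBounded.isCompact_closure
    have h2 := (hint.mono_set subset_closure).2
    simp only [HasFiniteIntegral, enorm_norm_sq] at h2
    exact h2.ne
  -- absorb the function itself, which occurs on the right-hand side through `‖Φ‖ ‖DΦ‖`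
  have h2 : 2 * (C * ∫⁻ x in Ω, ‖fderiv ℝ (fun x => ‖Φ x‖ ^ 2) x‖ₑ) ≤
      X + 4 * (C : ℝ≥0∞) ^ 2 * G := by
    have hc4 : 4 * (C : ℝ≥0∞) ^ 2 ≠ ⊤ := by simp [ENNReal.mul_eq_top]
    rw [← lintegral_const_mul' _ _ ENNReal.coe_ne_top, ← lintegral_const_mul' _ _ (by simp),
      ← lintegral_const_mul' _ _ hc4, ← lintegral_add_left hm]
    refine lintegral_mono fun x => le_trans ?_ (two_mul_enorm_mul_le C (Φ x) (fderiv ℝ Φ x))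
    gcongr
    exact enorm_fderiv_norm_sq_le hΦ x
  have h3 : X + X ≤ X + (4 * (C : ℝ≥0∞) ^ 2 * G + 2 * C * S) := by
    calc X + X = 2 * X := by ring
      _ ≤ 2 * (C * ((∫⁻ x in Ω, ‖fderiv ℝ (fun x => ‖Φ x‖ ^ 2) x‖ₑ) + S)) := by gcongr
      _ = 2 * (C * ∫⁻ x in Ω, ‖fderiv ℝ (fun x => ‖Φ x‖ ^ 2) x‖ₑ) + 2 * C * S := by ring
      _ ≤ X + 4 * (C : ℝ≥0∞) ^ 2 * G + 2 * C * S := by gcongr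
      _ = _ := by ring
  have h4 : X ≤ 4 * (C : ℝ≥0∞) ^ 2 * G + 2 * C * S := (ENNReal.add_le_add_iff_left hXtop).1 h3
  have h5 := lintegral_enorm_fderiv_sq_le Ω Φ
  calc X ≤ 4 * (C : ℝ≥0∞) ^ 2 * G + 2 * C * S := h4
    _ ≤ (4 * (C : ℝ≥0∞) ^ 2 + 2 * C) * G + (4 * (C : ℝ≥0∞) ^ 2 + 2 * C) * S := by
        gcongr
        · exact le_self_add
        · exact le_add_self
    _ = (4 * (C : ℝ≥0∞) ^ 2 + 2 * C) * (G + S) := by ring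
    _ ≤ _ := by gcongr

end SmoothFunctions

/-! ### Mollification -/

section Mollification

variable {N : ℕ}

/-- The mollification `K ⋆ F` of a map into `ℝ³` by a scalar kernel. -/
noncomputable def mollify (K : Space N → ℝ) (F : Space N → Vec3) : Space N → Vec3 :=
  convolution K F (ContinuousLinearMap.lsmul ℝ ℝ) volume

lemma mollify_apply (K : Space N → ℝ) (F : Space N → Vec3) (x : Space N) :
    mollify K F x = ∫ y, K (x - y) • F y := convolution_lsmul_swap

/-- A mollifying kernel with support in the set `S`. -/
structure IsKernel (S : Set (Space N)) (K : Space N → ℝ) : Prop where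
  contDiff : ContDiff ℝ ∞ K
  hasCompactSupport : HasCompactSupport K
  support_subset : Function.support K ⊆ S
  nonneg : ∀ x, 0 ≤ K x
  integral_eq_one : ∫ x, K x = 1

lemma exists_isKernel (p : Space N) {r : ℝ} (hr : 0 < r) : ∃ K, IsKernel (Metric.ball p r) K := by
  let b : ContDiffBump p := ⟨r / 2, r, by linarith, by linarith⟩
  exact ⟨b.normed volume, b.contDiff_normed, b.hasCompactSupport_normed,
    b.support_normed_eq.subset, b.nonneg_normed, b.integral_normed⟩

/-- Translations act continuously on `L²`. -/
lemma exists_eLpNorm_translate_sub_le {F : Space N → Vec3} (hF : MemLp F 2 volume) {ε : ℝ≥0∞}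
    (hε : ε ≠ 0) : ∃ δ > 0, ∀ t : Space N, ‖t‖ < δ →
      eLpNorm (fun x => F (x - t) - F x) 2 volume ≤ ε := by
  have : Fact ((1 : ℝ≥0∞) ≤ 2) := ⟨by norm_num⟩
  let g : C(Space N, C(Space N, Space N)) :=
    ContinuousMap.curry ⟨fun p : Space N × Space N => p.2 - p.1, by fun_prop⟩
  have hg : ∀ t, MeasurePreserving (g t) (volume : Measure (Space N)) volume :=
    fun t => measurePreserving_sub_right volume t
  have hcont : Continuous fun t => Lp.compMeasurePreserving (g t) (hg t) (hF.toLp F) :=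
    Continuous.compMeasurePreservingLp continuous_const g.continuous hg (by simp)
  have h0 : Lp.compMeasurePreserving (g 0) (hg 0) (hF.toLp F) = hF.toLp F := by
    rw [Lp.toLp_compMeasurePreserving]
    congr 1
    ext x
    simp [g]
  have h1 := (EMetric.tendsto_nhds.1 (hcont.tendsto 0)) ε (pos_iff_ne_zero.2 hε)
  obtain ⟨δ, hδ, h2⟩ := Metric.eventually_nhds_iff.1 h1
  refine ⟨δ, hδ, fun t ht => ?_⟩
  have h3 := h2 (y := t) (by simpa using ht)
  rw [h0, Lp.toLp_compMeasurePreserving, Lp.edist_toLp_toLp] at h3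
  exact h3.le

/-- The mollification error in `L²` is at most the largest translation error over the support of
the kernel: this is Jensen's inequality for the probability measure `K(t) dt`. -/
lemma eLpNorm_mollify_sub_le {S : Set (Space N)} {K : Space N → ℝ} (hK : IsKernel S K)
    {F : Space N → Vec3} (hF : MemLp F 2 volume) {ε : ℝ≥0∞}
    (h : ∀ t ∈ S, eLpNorm (fun x => F (x - t) - F x) 2 volume ≤ ε) :
    eLpNorm (fun x => mollify K F x - F x) 2 volume ≤ ε := by
  have hKc : Continuous K := hK.contDiff.continuous
  have hKi : Integrable K := hKc.integrable_of_hasCompactSupport hK.hasCompactSupport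
  let ρ : Measure (Space N) := volume.withDensity fun t => ENNReal.ofReal (K t)
  have hKm : Measurable fun t => ENNReal.ofReal (K t) := hKc.measurable.ennreal_ofReal
  have hρ : IsProbabilityMeasure ρ := ⟨by
    rw [withDensity_apply _ MeasurableSet.univ, Measure.restrict_univ,
      ← ofReal_integral_eq_lintegral_ofReal hKi (Eventually.of_forall hK.nonneg),
      hK.integral_eq_one, ENNReal.ofReal_one]⟩
  have hFl : LocallyIntegrable F volume := hF.locallyIntegrable (by norm_num)
  have hρac : ρ ≪ volume := withDensity_absolutelyContinuous _ _
  have hmeas : AEStronglyMeasurable (fun p : Space N × Space N => F (p.1 - p.2) - F p.1)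
      (volume.prod ρ) := by
    have h1 : AEStronglyMeasurable (fun p : Space N × Space N => F (p.1 - p.2) - F p.1)
        (volume.prod volume) :=
      (hF.1.comp_quasiMeasurePreserving
        (quasiMeasurePreserving_sub_of_right_invariant volume volume)).sub
        (hF.1.comp_quasiMeasurePreserving Measure.quasiMeasurePreserving_fst)
    exact h1.mono_ac (Measure.AbsolutelyContinuous.rfl.prod hρac)
  have hpt : ∀ᵐ x, ‖mollify K F x - F x‖ₑ ^ 2 ≤ ∫⁻ t, ‖F (x - t) - F x‖ₑ ^ 2 ∂ρ := by
    filter_upwards [hmeas.prodMk_left] with x hx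
    have h1 : mollify K F x - F x = ∫ t, K t • (F (x - t) - F x) := by
      have hi1 : Integrable fun t => K t • F (x - t) :=
        (hK.hasCompactSupport.convolutionExists_left (ContinuousLinearMap.lsmul ℝ ℝ) hKc hFl x)
      have hi2 : Integrable fun t => K t • F x := hKi.smul_const _
      simp_rw [smul_sub]
      rw [integral_sub hi1 hi2, integral_smul_const, hK.integral_eq_one, one_smul]
      rfl
    have h2 : ‖mollify K F x - F x‖ₑ ≤ ∫⁻ t, ‖F (x - t) - F x‖ₑ ∂ρ := by
      rw [h1, lintegral_withDensity_eq_lintegral_mul₀' hKm.aemeasurable hx.enorm]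
      refine (enorm_integral_le_lintegral_enorm _).trans (le_of_eq (lintegral_congr fun t => ?_))
      rw [enorm_smul, Real.enorm_of_nonneg (hK.nonneg t), Pi.mul_apply]
    have h3 : eLpNorm (fun t => F (x - t) - F x) 1 ρ ≤ eLpNorm (fun t => F (x - t) - F x) 2 ρ :=
      eLpNorm_le_eLpNorm_of_exponent_le (by norm_num) hx
    rw [eLpNorm_one_eq_lintegral_enorm] at h3
    calc _ ≤ (eLpNorm (fun t => F (x - t) - F x) 2 ρ) ^ 2 := by gcongr; exact h2.trans h3
      _ = _ := by
        have := eLpNorm_nnreal_pow_eq_lintegral (p := 2) (f := fun t => F (x - t) - F x) (μ := ρ)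
          two_ne_zero
        simpa using this
  have hsq : ∀ f : Space N → Vec3, (eLpNorm f 2 volume) ^ 2 = ∫⁻ x, ‖f x‖ₑ ^ 2 := fun f => by
    simpa using eLpNorm_nnreal_pow_eq_lintegral (p := 2) (f := f) (μ := volume) two_ne_zero
  have hmain : (eLpNorm (fun x => mollify K F x - F x) 2 volume) ^ 2 ≤ ε ^ 2 := by
    rw [hsq]
    refine (lintegral_mono_ae hpt).trans ?_
    rw [lintegral_lintegral_swap (hmeas.enorm.pow_const 2)]
    have hS : ∀ᵐ t ∂ρ, ∫⁻ x, ‖F (x - t) - F x‖ₑ ^ 2 ≤ ε ^ 2 := by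
      refine (ae_withDensity_iff hKm).2 (Eventually.of_forall fun t ht => ?_)
      have : t ∈ S := hK.support_subset (fun h0 => ht (by rw [h0, ENNReal.ofReal_zero]))
      rw [← hsq]
      gcongr
      exact h t this
    calc _ ≤ ∫⁻ _, ε ^ 2 ∂ρ := lintegral_mono_ae hS
      _ = ε ^ 2 := by simp
  exact (ENNReal.pow_le_pow_left_iff two_ne_zero).1 hmain

lemma contDiff_mollify {S : Set (Space N)} {K : Space N → ℝ} (hK : IsKernel S K)
    {F : Space N → Vec3} (hF : LocallyIntegrable F volume) : ContDiff ℝ ∞ (mollify K F) :=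
  hK.hasCompactSupport.contDiff_convolution_left _ hK.contDiff hF

lemma fderiv_mollify {S : Set (Space N)} {K : Space N → ℝ} (hK : IsKernel S K)
    {F : Space N → Vec3} (hF : LocallyIntegrable F volume) (x v : Space N) :
    fderiv ℝ (mollify K F) x v = ∫ y, (fderiv ℝ K (x - y) v) • F y := by
  have hK1 : ContDiff ℝ 1 K := hK.contDiff.of_le (by simp)
  have h1 := (hK.hasCompactSupport.hasFDerivAt_convolution_left (ContinuousLinearMap.lsmul ℝ ℝ)
    hK1 hF x).fderiv
  have hex : ConvolutionExistsAt (fderiv ℝ K) F x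
      ((ContinuousLinearMap.lsmul ℝ ℝ).precompL (Space N)) volume :=
    (hK.hasCompactSupport.fderiv (𝕜 := ℝ)).convolutionExists_left _
      (hK1.continuous_fderiv one_ne_zero) hF x
  have h2 : fderiv ℝ (mollify K F) x v = ∫ t, (fderiv ℝ K t v) • F (x - t) := by
    change fderiv ℝ (convolution K F (ContinuousLinearMap.lsmul ℝ ℝ) volume) x v = _
    rw [h1, convolution_def, ContinuousLinearMap.integral_apply hex]
    rfl
  rw [h2]
  have h3 := integral_sub_left_eq_self (fun t => (fderiv ℝ K t v) • F (x - t)) volume x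
  rw [← h3]
  simp

end Mollification

/-! ### Smooth approximation of cut-off Sobolev maps -/

section Cutoff

variable {N : ℕ} {Ω : Set (Space N)}

lemma memLp_smul_of_hasCompactSupport {f : Space N → ℝ} (hf : Continuous f)
    (hc : HasCompactSupport f) {u : Space N → Vec3} {p : ℝ≥0∞} {μ : Measure (Space N)}
    (hu : MemLp u p μ) : MemLp (fun x => f x • u x) p μ := by
  obtain ⟨C, hC⟩ := hf.bounded_above_of_compact_support hc
  have h1 : MemLp f ⊤ μ := memLp_top_of_bound hf.aestronglyMeasurable C (Eventually.of_forall hC)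
  exact hu.smul h1

lemma continuous_partial {f : Space N → ℝ} (hf : ContDiff ℝ ∞ f) (v : Space N) :
    Continuous fun x => fderiv ℝ f x v :=
  (hf.continuous_fderiv (by simp)).clm_apply continuous_const

/-- The product rule for the weak partial derivative of `χ u`, tested with functions that need not
be supported in `Ω` as long as `φ χ` is. -/
lemma IsWeakPartial.integral_cutoff [IsFiniteMeasure (volume.restrict Ω)] {i : Fin N}
    {u g : Space N → Vec3} (hu : MemLp u 2 (volume.restrict Ω)) (h : IsWeakPartial Ω i u g)
    {χ φ : Space N → ℝ} (hχ : ContDiff ℝ ∞ χ) (hχc : HasCompactSupport χ) (hφ : ContDiff ℝ ∞ φ)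
    (hφc : HasCompactSupport φ) (hsupp : tsupport φ ∩ tsupport χ ⊆ Ω) :
    ∫ x in Ω, fderiv ℝ φ x (basisVec i) • χ x • u x =
      -∫ x in Ω, φ x • (χ x • g x + fderiv ℝ χ x (basisVec i) • u x) := by
  have htest : IsTestFunction Ω fun x => φ x * χ x :=
    ⟨hφ.mul hχ, hφc.mul_right, fun x hx => hsupp ⟨tsupport_mul_subset_left hx,
      tsupport_mul_subset_right hx⟩⟩
  have hder : ∀ x, fderiv ℝ (fun x => φ x * χ x) x (basisVec i) =
      φ x * fderiv ℝ χ x (basisVec i) + χ x * fderiv ℝ φ x (basisVec i) := fun x => by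
    rw [fderiv_fun_mul ((hφ.differentiable (by simp)) x) ((hχ.differentiable (by simp)) x)]
    simp
  have hdχc : HasCompactSupport fun x => fderiv ℝ χ x (basisVec i) :=
    (hχc.fderiv_apply (𝕜 := ℝ) _)
  have hdφc : HasCompactSupport fun x => fderiv ℝ φ x (basisVec i) :=
    (hφc.fderiv_apply (𝕜 := ℝ) _)
  have hi1 : Integrable (fun x => φ x • χ x • g x) (volume.restrict Ω) :=
    (memLp_smul_of_hasCompactSupport hφ.continuous hφc
      (memLp_smul_of_hasCompactSupport hχ.continuous hχc h.1)).integrable (by norm_num)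
  have hi2 : Integrable (fun x => φ x • fderiv ℝ χ x (basisVec i) • u x) (volume.restrict Ω) :=
    (memLp_smul_of_hasCompactSupport hφ.continuous hφc
      (memLp_smul_of_hasCompactSupport (continuous_partial hχ _) hdχc hu)).integrable (by norm_num)
  have hi3 : Integrable (fun x => fderiv ℝ φ x (basisVec i) • χ x • u x) (volume.restrict Ω) :=
    (memLp_smul_of_hasCompactSupport (continuous_partial hφ _) hdφc
      (memLp_smul_of_hasCompactSupport hχ.continuous hχc hu)).integrable (by norm_num)
  have h1 := h.2 _ htest
  simp_rw [hder, add_smul, mul_smul] at h1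
  simp_rw [smul_add]
  have h2 : ∀ x, χ x • fderiv ℝ φ x (basisVec i) • u x = fderiv ℝ φ x (basisVec i) • χ x • u x :=
    fun x => smul_comm _ _ _
  simp_rw [h2] at h1
  rw [integral_add hi2 hi3] at h1
  rw [integral_add hi1 hi2, ← add_eq_zero_iff_eq_neg]
  rw [← add_eq_zero_iff_eq_neg] at h1
  rw [← h1]
  abel

/-- Mollification of a cut-off function commutes with the partial derivatives at the points `x` for
which the kernel at `x` meets the support of the cutoff only inside `Ω`. -/
lemma fderiv_mollify_cutoff [IsFiniteMeasure (volume.restrict Ω)] (hΩ : MeasurableSet Ω)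
    {i : Fin N} {u g : Space N → Vec3} (hu : MemLp u 2 (volume.restrict Ω))
    (h : IsWeakPartial Ω i u g) {χ : Space N → ℝ} (hχ : ContDiff ℝ ∞ χ)
    (hχc : HasCompactSupport χ) {S : Set (Space N)} {K : Space N → ℝ} (hK : IsKernel S K)
    (hS : IsClosed S) {x : Space N} (hx : ∀ y ∈ tsupport χ, x - y ∈ S → y ∈ Ω) :
    fderiv ℝ (mollify K (Ω.indicator fun y => χ y • u y)) x (basisVec i) =
      mollify K (Ω.indicator fun y => χ y • g y + fderiv ℝ χ y (basisVec i) • u y) x := by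
  have hv : MemLp (Ω.indicator fun y => χ y • u y) 2 volume :=
    (memLp_indicator_iff_restrict hΩ).2 (memLp_smul_of_hasCompactSupport hχ.continuous hχc hu)
  rw [fderiv_mollify hK (hv.locallyIntegrable (by norm_num)), mollify_apply]
  have hφ : ContDiff ℝ ∞ fun y => K (x - y) := hK.contDiff.comp (contDiff_const.sub contDiff_id)
  have hφc : HasCompactSupport fun y => K (x - y) :=
    hK.hasCompactSupport.comp_homeomorph (Homeomorph.subLeft x)
  have hder : ∀ y, fderiv ℝ (fun y => K (x - y)) y (basisVec i) =
      -fderiv ℝ K (x - y) (basisVec i) := fun y => by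
    have h1 : HasFDerivAt (fun y => x - y) (-ContinuousLinearMap.id ℝ (Space N)) y :=
      (hasFDerivAt_id y).const_sub x
    have h2 : HasFDerivAt K (fderiv ℝ K (x - y)) (x - y) :=
      ((hK.contDiff.differentiable (by simp)) _).hasFDerivAt
    have h3 := (h2.comp y h1).fderiv
    rw [Function.comp_def] at h3
    rw [h3]
    simp
  have hsupp : tsupport (fun y => K (x - y)) ∩ tsupport χ ⊆ Ω := fun y hy => by
    refine hx y hy.2 ?_
    have h1 : tsupport (fun y => K (x - y)) ⊆ (fun y => x - y) ⁻¹' S :=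
      closure_minimal (fun z hz => hK.support_subset hz) (hS.preimage (by fun_prop))
    exact h1 hy.1
  have hmain := h.integral_cutoff hu hχ hχc hφ hφc hsupp
  simp_rw [hder, neg_smul, integral_neg, neg_inj] at hmain
  have hind : ∀ (f : Space N → ℝ) (w : Space N → Vec3),
      ∫ y, f y • Ω.indicator w y = ∫ y in Ω, f y • w y := fun f w => by
    rw [← integral_indicator hΩ]
    congr 1 with y
    by_cases hy : y ∈ Ω
    · simp [hy]
    · simp [hy]
  rw [hind, hind]
  exact hmain

/-- Small translations along a cone of directions move the points of `Ω` into `Ω`, or out of `S`. -/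
def HasInwardCone (Ω S : Set (Space N)) : Prop :=
  ∃ (a : Space N) (c τ₀ : ℝ), 0 < c ∧ 0 < τ₀ ∧ ∀ τ, 0 < τ → τ < τ₀ → ∀ x ∈ Ω,
    ∀ w ∈ Metric.closedBall (τ • a) (c * τ), x + w ∈ S → x + w ∈ Ω

/-- If the support of the cutoff `χ` has an inward cone, then `χ u` is approximated in `H¹(Ω)` by
mollification with kernels supported in the opposite cone. -/
lemma exists_smooth_approx_cutoff [IsFiniteMeasure (volume.restrict Ω)] (hΩ : MeasurableSet Ω)
    {u : Space N → Vec3} {g : Fin N → Space N → Vec3} (hu : MemLp u 2 (volume.restrict Ω))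
    (h : ∀ i, IsWeakPartial Ω i u (g i)) {χ : Space N → ℝ} (hχ : ContDiff ℝ ∞ χ)
    (hχc : HasCompactSupport χ) (hcone : HasInwardCone Ω (tsupport χ)) {ε : ℝ≥0∞} (hε : ε ≠ 0) :
    ∃ Φ : Space N → Vec3, ContDiff ℝ ∞ Φ ∧
      eLpNorm (fun x => Φ x - χ x • u x) 2 (volume.restrict Ω) ≤ ε ∧
      ∀ i, eLpNorm (fun x => fderiv ℝ Φ x (basisVec i) -
        (χ x • g i x + fderiv ℝ χ x (basisVec i) • u x)) 2 (volume.restrict Ω) ≤ ε := by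
  obtain ⟨a, c, τ₀, hc, hτ₀, hcone⟩ := hcone
  have hdχc : ∀ i, HasCompactSupport fun x => fderiv ℝ χ x (basisVec i) :=
    fun i => hχc.fderiv_apply (𝕜 := ℝ) _
  have hF : MemLp (Ω.indicator fun y => χ y • u y) 2 volume :=
    (memLp_indicator_iff_restrict hΩ).2 (memLp_smul_of_hasCompactSupport hχ.continuous hχc hu)
  have hG : ∀ i, MemLp (Ω.indicator fun y => χ y • g i y + fderiv ℝ χ y (basisVec i) • u y) 2
      volume := fun i =>
    (memLp_indicator_iff_restrict hΩ).2
      ((memLp_smul_of_hasCompactSupport hχ.continuous hχc (h i).1).add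
        (memLp_smul_of_hasCompactSupport (continuous_partial hχ _) (hdχc i) hu))
  obtain ⟨δ, hδ, hFδ⟩ := exists_eLpNorm_translate_sub_le hF hε
  choose δ' hδ' hGδ using fun i => exists_eLpNorm_translate_sub_le (hG i) hε
  -- a scale below all the thresholds
  obtain ⟨τ, hτ, hτ1, hτ2, hτ3⟩ : ∃ τ : ℝ, 0 < τ ∧ τ < τ₀ ∧ (‖a‖ + c) * τ < δ ∧
      ∀ i, (‖a‖ + c) * τ < δ' i := by
    have hev : Tendsto (fun τ : ℝ => (‖a‖ + c) * τ) (𝓝[>] 0) (𝓝 0) := by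
      have h1 : Continuous fun τ : ℝ => (‖a‖ + c) * τ := by fun_prop
      simpa using (h1.tendsto 0).mono_left nhdsWithin_le_nhds
    have h1 : ∀ᶠ τ : ℝ in 𝓝[>] 0, 0 < τ := self_mem_nhdsWithin
    have h2 : ∀ᶠ τ : ℝ in 𝓝[>] 0, τ < τ₀ := (eventually_lt_nhds hτ₀).filter_mono nhdsWithin_le_nhds
    have h3 := hev.eventually (eventually_lt_nhds hδ)
    have h4 : ∀ᶠ τ : ℝ in 𝓝[>] 0, ∀ i, (‖a‖ + c) * τ < δ' i :=
      eventually_all.2 fun i => hev.eventually (eventually_lt_nhds (hδ' i))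
    exact (h1.and (h2.and (h3.and h4))).exists
  -- the kernel averages over the points `x + w` with `w` in the inward cone
  obtain ⟨K, hK⟩ := exists_isKernel (-(τ • a)) (mul_pos hc hτ)
  have hnorm : ∀ t ∈ Metric.ball (-(τ • a)) (c * τ), ‖t‖ ≤ (‖a‖ + c) * τ := fun t ht => by
    have h1 := mem_ball_iff_norm.1 ht
    have h2 : ‖t‖ ≤ ‖t - -(τ • a)‖ + ‖-(τ • a)‖ := by
      simpa using norm_add_le (t - -(τ • a)) (-(τ • a))
    rw [norm_neg, norm_smul, Real.norm_of_nonneg hτ.le] at h2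
    linarith
  refine ⟨mollify K (Ω.indicator fun y => χ y • u y),
    contDiff_mollify hK (hF.locallyIntegrable (by norm_num)), ?_, fun i => ?_⟩
  · have h1 := eLpNorm_mollify_sub_le hK hF fun t ht => hFδ t ((hnorm t ht).trans_lt hτ2)
    refine le_trans (le_of_eq ?_)
      ((eLpNorm_mono_measure _ (Measure.restrict_le_self (s := Ω))).trans h1)
    refine eLpNorm_congr_ae (ae_restrict_of_forall_mem hΩ fun x hx => ?_)
    simp [hx]
  · have h1 := eLpNorm_mollify_sub_le hK (hG i) fun t ht => hGδ i t ((hnorm t ht).trans_lt (hτ3 i))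
    refine le_trans (le_of_eq ?_)
      ((eLpNorm_mono_measure _ (Measure.restrict_le_self (s := Ω))).trans h1)
    refine eLpNorm_congr_ae (ae_restrict_of_forall_mem hΩ fun x hx => ?_)
    have hK' : IsKernel (Metric.closedBall (-(τ • a)) (c * τ)) K :=
      { hK with support_subset := hK.support_subset.trans Metric.ball_subset_closedBall }
    have h2 := fderiv_mollify_cutoff hΩ hu (h i) hχ hχc hK' Metric.isClosed_closedBall (x := x) ?_
    · simp only [h2, Set.indicator_of_mem hx]
    · intro y hy hxy
      have h3 := hcone τ hτ hτ1 x hx (y - x) (by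
        rw [mem_closedBall_iff_norm] at hxy ⊢
        rwa [← norm_neg, show -(y - x - τ • a) = x - y - -(τ • a) by abel]) (by simpa using hy)
      simpa using h3

/-- Finite smooth partitions of unity on a compact set. -/
lemma exists_partition_of_unity {ι : Type*} [Fintype ι] {s : Set (Space N)} (hs : IsCompact s)
    (U : ι → Set (Space N)) (hU : ∀ i, IsOpen (U i)) (hsU : s ⊆ ⋃ i, U i) :
    ∃ χ : ι → Space N → ℝ, (∀ i, ContDiff ℝ ∞ (χ i)) ∧ (∀ i, HasCompactSupport (χ i)) ∧
      (∀ i, tsupport (χ i) ⊆ U i) ∧ ∀ x ∈ s, ∑ i, χ i x = 1 := by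
  obtain ⟨R, hR⟩ := hs.isBounded.subset_ball 0
  obtain ⟨f, hf⟩ := SmoothPartitionOfUnity.exists_isSubordinate
    (modelWithCornersSelf ℝ (Space N)) hs.isClosed (fun i => U i ∩ Metric.ball 0 R)
    (fun i => (hU i).inter Metric.isOpen_ball) (by
      rw [← Set.iUnion_inter]; exact Set.subset_inter hsU hR)
  refine ⟨fun i => f i, fun i => (f i).contMDiff.contDiff, fun i => ?_,
    fun i => (hf i).trans Set.inter_subset_left, fun x hx => ?_⟩
  · exact Metric.isCompact_of_isClosed_isBounded (isClosed_tsupport _)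
      (Metric.isBounded_ball.subset ((hf i).trans Set.inter_subset_right))
  · have := f.sum_eq_one hx
    rwa [finsum_eq_sum_of_fintype] at this

lemma hasInwardCone_of_subset {S : Set (Space N)} (hS : S ⊆ Ω) : HasInwardCone Ω S :=
  ⟨0, 1, 1, one_pos, one_pos, fun _ _ _ _ _ _ _ h => hS h⟩

/-- In a boundary chart, moving upwards is an inward direction; the opening of the cone is the
inverse of the Lipschitz constant of the graph. -/
lemma BoundaryChart.hasInwardCone {n : ℕ} {Ω : Set (Space (n + 1))} (c : BoundaryChart Ω)
    {S : Set (Space (n + 1))} (hS : IsCompact S) (hSd : S ⊆ c.dom) : HasInwardCone Ω S := by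
  obtain ⟨ε, hε, hthick⟩ := hS.exists_thickening_subset_open c.isOpen_dom hSd
  have hL : (0 : ℝ) ≤ c.L := c.L.2
  refine ⟨c.toEquiv (0, 1), 1 / (2 * (1 + (c.L : ℝ))), ε / 2, by positivity, by positivity,
    fun τ hτ hτε x hx w hw hxw => ?_⟩
  set κ := 1 / (2 * (1 + (c.L : ℝ))) with hκ
  have hκ1 : κ * (1 + c.L) = 1 / 2 := by rw [hκ]; field_simp
  have hκ0 : 0 < κ := by positivity
  have hκ2 : κ ≤ 1 / 2 := by nlinarith
  have hw1 : ‖w - τ • c.toEquiv (0, 1)‖ ≤ κ * τ := mem_closedBall_iff_norm.1 hw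
  have hwn : ‖w‖ < ε := by
    have h1 : ‖w‖ ≤ ‖w - τ • c.toEquiv (0, 1)‖ + ‖τ • c.toEquiv (0, 1)‖ := by
      simpa using norm_add_le (w - τ • c.toEquiv (0, 1)) (τ • c.toEquiv (0, 1))
    rw [norm_smul, c.norm_vert, Real.norm_of_nonneg hτ.le] at h1
    nlinarith
  have hxd : x ∈ c.dom := by
    refine hthick (Metric.mem_thickening_iff.2 ⟨x + w, hxw, ?_⟩)
    simpa [dist_eq_norm] using hwn
  have hxwd : x + w ∈ c.dom := hSd hxw
  rw [c.mem_iff_of_mem_dom hxwd]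
  have hhx := (c.mem_iff_of_mem_dom hxd).1 hx
  have hv : c.toEquiv.symm (w - τ • c.toEquiv (0, 1)) =
      ((c.toEquiv.symm w).1, (c.toEquiv.symm w).2 - τ) := by
    rw [map_sub, map_smul, ContinuousLinearEquiv.symm_apply_apply]
    ext <;> simp
  have hv1 := (c.norm_fst_le (w - τ • c.toEquiv (0, 1))).trans hw1
  have hv2 := (c.abs_snd_le (w - τ • c.toEquiv (0, 1))).trans hw1
  rw [hv] at hv1 hv2
  simp only at hv1 hv2
  have hlip := c.lipschitz_g.dist_le_mul _ hxwd.1 _ hxd.1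
  have hp : c.proj (x + w) - c.proj x = (c.toEquiv.symm w).1 := by simp [BoundaryChart.proj]
  rw [Real.dist_eq, dist_eq_norm, hp] at hlip
  have hh : c.height (x + w) = c.height x + (c.toEquiv.symm w).2 -
      (c.g (c.proj (x + w)) - c.g (c.proj x)) := by
    simp only [BoundaryChart.height, map_add, Prod.snd_add]; ring
  rw [hh]
  have h1 := (abs_le.1 hv2).1
  have h2 := (abs_le.1 hlip).2
  have h3 : (c.L : ℝ) * ‖(c.toEquiv.symm w).1‖ ≤ c.L * (κ * τ) := mul_le_mul_of_nonneg_left hv1 hL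
  nlinarith

end Cutoff

/-! ### Weak derivatives and constant maps -/

section WeakDerivatives

variable {N : ℕ} {Ω : Set (Space N)}

lemma IsWeakPartial.congr {i : Fin N} {u v g : Space N → Vec3} (h : IsWeakPartial Ω i u g)
    (huv : u =ᵐ[volume.restrict Ω] v) : IsWeakPartial Ω i v g := by
  refine ⟨h.1, fun φ hφ => ?_⟩
  rw [← h.2 φ hφ]
  refine integral_congr_ae ?_
  filter_upwards [huv] with x hx
  rw [hx]

lemma IsWeakPartial.congr_partial {i : Fin N} {u g g' : Space N → Vec3} (h : IsWeakPartial Ω i u g) (hg : g =ᵐ[volume.restrict Ω] g') :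
    IsWeakPartial Ω i u g' := by
  refine ⟨h.1.ae_eq hg, fun φ hφ => ?_⟩
  rw [h.2 φ hφ]
  congr 1
  refine integral_congr_ae ?_
  filter_upwards [hg] with x hx
  rw [hx]

/-- Weak partial derivatives are unique. -/
lemma IsWeakPartial.ae_eq (hΩ : IsOpen Ω) {i : Fin N} {u g g' : Space N → Vec3}
    (h : IsWeakPartial Ω i u g) (h' : IsWeakPartial Ω i u g') : g =ᵐ[volume.restrict Ω] g' := by
  have hl : LocallyIntegrable (fun x => g x - g' x) (volume.restrict Ω) :=
    (h.1.sub h'.1).locallyIntegrable (by norm_num)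
  have hzero : ∀ φ : Space N → ℝ, ContDiff ℝ ∞ φ → HasCompactSupport φ → tsupport φ ⊆ Ω →
      ∫ x, φ x • (g x - g' x) ∂(volume.restrict Ω) = 0 := fun φ h1 h2 h3 => by
    have hi : Integrable (fun x => φ x • g x) (volume.restrict Ω) := by
      exact (h.1.locallyIntegrable (by norm_num)).integrable_smul_left_of_hasCompactSupport
        h1.continuous h2
    have hi' : Integrable (fun x => φ x • g' x) (volume.restrict Ω) := by
      exact (h'.1.locallyIntegrable (by norm_num)).integrable_smul_left_of_hasCompactSupport
        h1.continuous h2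
    simp_rw [smul_sub]
    have e1 := h.2 φ ⟨h1, h2, h3⟩
    rw [h'.2 φ ⟨h1, h2, h3⟩, neg_inj] at e1
    rw [integral_sub hi hi', e1, sub_self]
  have h1 := hΩ.ae_eq_zero_of_integral_contDiff_smul_eq_zero (hl.locallyIntegrableOn Ω) hzero
  filter_upwards [h1, ae_restrict_mem hΩ.measurableSet] with x hx1 hx2
  exact sub_eq_zero.1 (hx1 hx2)

lemma MemH1.isWeakPartial {u : Space N → Vec3} (h : MemH1 Ω u) (i : Fin N) :
    IsWeakPartial Ω i u (weakPartial Ω i u) := by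
  have := h.exists_weakPartial i
  rw [weakPartial, dif_pos this]
  exact this.choose_spec

lemma integral_fderiv_eq_zero {φ : Space N → ℝ} (hφ : IsTestFunction Ω φ) (v : Space N) :
    ∫ x in Ω, fderiv ℝ φ x v = 0 := by
  rw [setIntegral_eq_integral_of_forall_compl_eq_zero]
  · have h1 : HasCompactSupport fun x => fderiv ℝ φ x v :=
      hφ.hasCompactSupport.fderiv_apply (𝕜 := ℝ) _
    have h2 := integral_mul_fderiv_eq_neg_fderiv_mul_of_integrable (μ := volume) (𝕜 := ℝ)
      (f := fun _ : Space N => (1 : ℝ)) (g := φ) (v := v) (by simp)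
      (by simpa using (continuous_partial hφ.contDiff v).integrable_of_hasCompactSupport h1)
      (by simpa using hφ.contDiff.continuous.integrable_of_hasCompactSupport hφ.hasCompactSupport)
      (fun x _ => by fun_prop) (fun x _ => (hφ.contDiff.differentiable (by simp)) x)
    simpa using h2
  · intro x hx
    have : fderiv ℝ φ x = 0 := image_eq_zero_of_notMem_tsupport fun h =>
      hx (hφ.tsupport_subset (tsupport_fderiv_subset ℝ h))
    rw [this]; rfl

/-- Adding a constant does not change the weak derivatives. -/
lemma IsWeakPartial.add_const [IsFiniteMeasure (volume.restrict Ω)] {i : Fin N}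
    {u g : Space N → Vec3} (hu : MemLp u 2 (volume.restrict Ω)) (h : IsWeakPartial Ω i u g)
    (c : Vec3) : IsWeakPartial Ω i (fun x => u x + c) g := by
  refine ⟨h.1, fun φ hφ => ?_⟩
  have h1 : HasCompactSupport fun x => fderiv ℝ φ x (basisVec i) :=
    hφ.hasCompactSupport.fderiv_apply (𝕜 := ℝ) _
  have h2 := continuous_partial hφ.contDiff (basisVec i)
  simp_rw [smul_add]
  rw [integral_add, integral_smul_const, integral_fderiv_eq_zero hφ, zero_smul, add_zero, h.2 φ hφ]
  · exact (memLp_smul_of_hasCompactSupport h2 h1 hu).integrable (by norm_num)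
  · exact (memLp_smul_of_hasCompactSupport h2 h1 (memLp_const c)).integrable
      (by norm_num : (1 : ℝ≥0∞) ≤ 2)

lemma isWeakPartial_const [IsFiniteMeasure (volume.restrict Ω)] (i : Fin N) (c : Vec3) :
    IsWeakPartial Ω i (fun _ => c) 0 := by
  have h0 : IsWeakPartial Ω i (fun _ => 0) 0 := ⟨MemLp.zero', fun φ _ => by simp⟩
  simpa using h0.add_const MemLp.zero' c

lemma memH1_of_isConstOn [IsFiniteMeasure (volume.restrict Ω)] {m : Space N → Vec3} {c : Vec3}
    (h : IsConstOn Ω m c) : MemH1 Ω m :=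
  ⟨(memLp_const c).ae_eq h.symm, fun i => ⟨0, (isWeakPartial_const i c).congr h.symm⟩⟩

lemma weakPartial_of_isConstOn [IsFiniteMeasure (volume.restrict Ω)] (hΩ : IsOpen Ω)
    {m : Space N → Vec3} {c : Vec3} (h : IsConstOn Ω m c) (i : Fin N) :
    weakPartial Ω i m =ᵐ[volume.restrict Ω] 0 :=
  ((memH1_of_isConstOn h).isWeakPartial i).ae_eq hΩ ((isWeakPartial_const i c).congr h.symm)

/-- A map in `L²` that is approximated in `L²` by constants is constant. -/
lemma exists_ae_eq_const_of_approx {μ : Measure (Space N)} [IsFiniteMeasure μ]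
    {u : Space N → Vec3} (hu : MemLp u 2 μ)
    (h : ∀ ε : ℝ≥0∞, ε ≠ 0 → ∃ c : Vec3, eLpNorm (fun x => c - u x) 2 μ ≤ ε) :
    ∃ c : Vec3, u =ᵐ[μ] fun _ => c := by
  have : Fact ((1 : ℝ≥0∞) ≤ 2) := ⟨by norm_num⟩
  let T : Vec3 →L[ℝ] Lp Vec3 2 μ := Lp.constL 2 μ ℝ
  have hclosed : IsClosed (LinearMap.range T.toLinearMap : Set (Lp Vec3 2 μ)) :=
    Submodule.closed_of_finiteDimensional _
  have hmem : hu.toLp u ∈ closure (LinearMap.range T.toLinearMap : Set (Lp Vec3 2 μ)) := by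
    refine EMetric.mem_closure_iff.2 fun ε hε => ?_
    obtain ⟨ε', hε', hlt⟩ := exists_between hε
    obtain ⟨c, hc⟩ := h ε' hε'.ne'
    refine ⟨T c, ⟨c, rfl⟩, ?_⟩
    have h1 : T c = (memLp_const c).toLp _ := rfl
    rw [edist_comm, h1, Lp.edist_toLp_toLp]
    exact hc.trans_lt hlt
  rw [hclosed.closure_eq] at hmem
  obtain ⟨c, hc⟩ := hmem
  have h1 : (memLp_const c).toLp (fun _ => c) = hu.toLp u := hc
  exact ⟨c, ((MemLp.toLp_eq_toLp_iff _ _).1 h1).symm⟩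

/-- A map with vanishing weak gradient is constant on balls compactly contained in the domain, since
its mollifications are. -/
lemma exists_ae_eq_const_ball [IsFiniteMeasure (volume.restrict Ω)] (hΩ : IsOpen Ω)
    {u : Space N → Vec3} (hu : MemLp u 2 (volume.restrict Ω))
    (h : ∀ i, IsWeakPartial Ω i u 0) {x₀ : Space N} {r : ℝ} (hr : 0 < r)
    (hball : Metric.closedBall x₀ (2 * r) ⊆ Ω) :
    ∃ c : Vec3, u =ᵐ[volume.restrict (Metric.ball x₀ r)] fun _ => c := by
  obtain ⟨χ, hχ, hχc, hχΩ, hχ1, -⟩ :=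
    exists_smooth_cutoff (isCompact_closedBall x₀ (2 * r)) hΩ hball
  have hbΩ : Metric.ball x₀ r ⊆ Ω := fun x hx =>
    hball (Metric.ball_subset_closedBall (Metric.ball_subset_ball (by linarith) hx))
  have hF : MemLp (Ω.indicator fun y => χ y • u y) 2 volume :=
    (memLp_indicator_iff_restrict hΩ.measurableSet).2
      (memLp_smul_of_hasCompactSupport hχ.continuous hχc hu)
  have : IsFiniteMeasure (volume.restrict (Metric.ball x₀ r)) :=
    ⟨by rw [Measure.restrict_apply_univ]; exact measure_ball_lt_top⟩
  refine exists_ae_eq_const_of_approx (hu.mono_measure (Measure.restrict_mono hbΩ le_rfl))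
    fun ε hε => ?_
  obtain ⟨δ, hδ, hFδ⟩ := exists_eLpNorm_translate_sub_le hF hε
  obtain ⟨K, hK⟩ := exists_isKernel (0 : Space N) (lt_min hδ hr)
  set f := mollify K (Ω.indicator fun y => χ y • u y) with hf
  have hK' : IsKernel (Metric.closedBall 0 (min δ r)) K :=
    { hK with support_subset := hK.support_subset.trans Metric.ball_subset_closedBall }
  have hfd : ContDiff ℝ ∞ f := contDiff_mollify hK (hF.locallyIntegrable (by norm_num))
  have hder : ∀ x ∈ Metric.ball x₀ r, fderiv ℝ f x = 0 := fun x hx => by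
    have hcomp : ∀ i, fderiv ℝ f x (basisVec i) = 0 := fun i => by
      rw [hf, fderiv_mollify_cutoff hΩ.measurableSet hu (h i) hχ hχc hK' Metric.isClosed_closedBall
        (fun y hy _ => hχΩ hy), mollify_apply]
      refine (integral_congr_ae (Eventually.of_forall fun y => ?_)).trans (integral_zero _ _)
      by_cases hy : y ∈ Metric.closedBall x₀ (2 * r)
      · have h1 : χ =ᶠ[𝓝 y] fun _ => 1 := eventually_nhdsSet_iff_forall.1 hχ1 y hy
        have h2 : fderiv ℝ χ y = 0 := by rw [h1.fderiv_eq]; simp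
        have h3 : Ω.indicator (fun y => χ y • (0 : Space N → Vec3) y +
            fderiv ℝ χ y (basisVec i) • u y) y = 0 := by
          rw [Set.indicator_of_mem (hball hy), h2]; simp
        simp only [h3, smul_zero]
      · have h1 : K (x - y) = 0 := by
          by_contra h0
          have h2 := mem_ball_zero_iff.1 (hK.support_subset h0)
          have h3 : dist y x < r := by
            rw [dist_comm, dist_eq_norm]; exact h2.trans_le (min_le_right _ _)
          refine hy (Metric.mem_closedBall.2 ((dist_triangle y x x₀).trans ?_))
          linarith [Metric.mem_ball.1 hx]
        simp only [h1, zero_smul]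
    ext v j
    have hv : fderiv ℝ f x v = ∑ i, v i • fderiv ℝ f x (basisVec i) := by
      conv_lhs => rw [← (EuclideanSpace.basisFun (Fin N) ℝ).sum_repr v, map_sum]
      simp [basisVec]
    rw [hv]
    simp [hcomp]
  have hconst : ∀ x ∈ Metric.ball x₀ r, f x = f x₀ := fun x hx =>
    (convex_ball x₀ r).is_const_of_fderivWithin_eq_zero (𝕜 := ℝ)
      (hfd.differentiable (by simp)).differentiableOn
      (fun y hy => by rw [fderivWithin_of_isOpen Metric.isOpen_ball hy, hder y hy]) hx
      (Metric.mem_ball_self hr)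
  refine ⟨f x₀, ?_⟩
  have h1 := eLpNorm_mollify_sub_le hK hF fun t ht =>
    hFδ t ((mem_ball_zero_iff.1 ht).trans_le (min_le_left _ _))
  refine le_trans (le_of_eq ?_) ((eLpNorm_mono_measure _
    (Measure.restrict_le_self (s := Metric.ball x₀ r))).trans h1)
  refine eLpNorm_congr_ae (ae_restrict_of_forall_mem Metric.isOpen_ball.measurableSet
    fun x hx => ?_)
  have h2 : χ x = 1 := (eventually_nhdsSet_iff_forall.1 hχ1 x
    (Metric.ball_subset_closedBall (Metric.ball_subset_ball (by linarith) hx))).self_of_nhds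
  change f x₀ - u x = f x - Ω.indicator (fun y => χ y • u y) x
  rw [hconst x hx, Set.indicator_of_mem (hbΩ hx), h2, one_smul]

/-- On a connected open set a map with vanishing weak gradient is constant. -/
lemma exists_isConstOn_of_weakPartial_eq_zero [IsFiniteMeasure (volume.restrict Ω)]
    (hΩ : IsOpen Ω) (hc : IsConnected Ω) {u : Space N → Vec3}
    (hu : MemLp u 2 (volume.restrict Ω)) (h : ∀ i, IsWeakPartial Ω i u 0) :
    ∃ c : Vec3, IsConstOn Ω u c := by
  classical
  have hloc : ∀ x ∈ Ω, ∃ r > 0, ∃ c : Vec3, Metric.ball x r ⊆ Ω ∧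
      u =ᵐ[volume.restrict (Metric.ball x r)] fun _ => c := fun x hx => by
    obtain ⟨R, hR, hRΩ⟩ := Metric.isOpen_iff.1 hΩ x hx
    have hsub : Metric.closedBall x (2 * (R / 4)) ⊆ Ω :=
      (Metric.closedBall_subset_ball (by linarith)).trans hRΩ
    obtain ⟨c, hc⟩ := exists_ae_eq_const_ball hΩ hu h (by linarith : 0 < R / 4) hsub
    exact ⟨R / 4, by linarith, c, (Metric.ball_subset_ball (by linarith)).trans hRΩ, hc⟩
  choose! r hr c hrΩ hcr using hloc
  -- the local constants agree on overlapping balls, hence everywhere by connectedness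
  have hover : ∀ x ∈ Ω, ∀ y ∈ Ω, y ∈ Metric.ball x (r x) → c y = c x := fun x hx y hy hyx => by
    have hopen : IsOpen (Metric.ball x (r x) ∩ Metric.ball y (r y)) :=
      Metric.isOpen_ball.inter Metric.isOpen_ball
    have hpos : volume (Metric.ball x (r x) ∩ Metric.ball y (r y)) ≠ 0 :=
      (hopen.measure_pos volume ⟨y, hyx, Metric.mem_ball_self (hr y hy)⟩).ne'
    have h1 := ae_restrict_of_ae_restrict_of_subset
      (Set.inter_subset_left (t := Metric.ball y (r y))) (hcr x hx)
    have h2 := ae_restrict_of_ae_restrict_of_subset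
      (Set.inter_subset_right (s := Metric.ball x (r x))) (hcr y hy)
    have : (ae (volume.restrict (Metric.ball x (r x) ∩ Metric.ball y (r y)))).NeBot := by
      rw [ae_neBot]; exact Measure.restrict_eq_zero.not.2 hpos
    obtain ⟨z, hz1, hz2⟩ := (h1.and h2).exists
    exact hz2.symm.trans hz1
  obtain ⟨x₀, hx₀⟩ := hc.nonempty
  have hcont : ContinuousOn (fun x => decide (c x = c x₀)) Ω := fun x hx => by
    refine (continuousWithinAt_const (b := decide (c x = c x₀))).congr_of_eventuallyEq ?_ rfl
    filter_upwards [self_mem_nhdsWithin, mem_nhdsWithin_of_mem_nhds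
      (Metric.ball_mem_nhds x (hr x hx))] with y hy1 hy2
    rw [hover x hx y hy1 hy2]
  have hall : ∀ x ∈ Ω, c x = c x₀ := fun x hx => by
    simpa using hc.isPreconnected.constant hcont hx hx₀
  refine ⟨c x₀, ?_⟩
  refine (ae_restrict_iff' hΩ.measurableSet).2 ?_
  rw [ae_iff]
  refine measure_null_of_locally_null _ fun x hx => ?_
  have hxΩ : x ∈ Ω := by
    by_contra h0
    exact hx fun h1 => absurd h1 h0
  refine ⟨_, inter_mem_nhdsWithin _ (Metric.ball_mem_nhds x (hr x hxΩ)), ?_⟩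
  have h1 := (ae_restrict_iff' Metric.isOpen_ball.measurableSet).1 (hcr x hxΩ)
  refine measure_mono_null ?_ (ae_iff.1 h1)
  rintro y ⟨hy1, hy2⟩ hy3
  refine hy1 fun _ => ?_
  rw [hy3 hy2, hall x hxΩ]

end WeakDerivatives

/-! ### Density of smooth maps and boundary traces -/

lemma continuous_fderiv_basisVec {N : ℕ} {Φ : Space N → Vec3} (hΦ : ContDiff ℝ ∞ Φ) (i : Fin N) :
    Continuous fun x => fderiv ℝ Φ x (basisVec i) :=
  (hΦ.continuous_fderiv (by simp)).clm_apply continuous_const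

/-- Smooth maps on the whole space are dense in `H¹` of a smooth bounded domain. -/
lemma IsSmoothBoundedDomain.exists_smoothApprox {n : ℕ} {Ω : Set (Space (n + 1))}
    (hΩ : IsSmoothBoundedDomain Ω) {u : Space (n + 1) → Vec3} (hu : MemH1 Ω u) :
    ∃ Φ, SmoothApprox Ω Φ u := by
  have := hΩ.isFiniteMeasure_restrict
  obtain ⟨t, ht⟩ := hΩ.exists_finset_boundaryChart
  let U : Option t → Set (Space (n + 1)) := fun o => o.elim Ω fun c => c.1.dom
  have hU : ∀ o, IsOpen (U o) := fun o => by
    cases o with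
    | none => exact hΩ.isOpen
    | some c => exact c.1.isOpen_dom
  have hcover : closure Ω ⊆ ⋃ o, U o := fun x hx => by
    by_cases hxΩ : x ∈ Ω
    · exact Set.mem_iUnion.2 ⟨none, hxΩ⟩
    · have : x ∈ frontier Ω := by rw [hΩ.isOpen.frontier_eq]; exact ⟨hx, hxΩ⟩
      obtain ⟨c, hc, hxc⟩ := Set.mem_iUnion₂.1 (ht this)
      exact Set.mem_iUnion.2 ⟨some ⟨c, hc⟩, hxc⟩
  obtain ⟨χ, hχ, hχc, hχU, hχ1⟩ :=
    exists_partition_of_unity hΩ.isBounded.isCompact_closure U hU hcover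
  have hcone : ∀ o, HasInwardCone Ω (tsupport (χ o)) := fun o => by
    cases o with
    | none => exact hasInwardCone_of_subset (hχU none)
    | some c => exact c.1.hasInwardCone (hχc _) (hχU (some c))
  have hε : ∀ k : ℕ, ((k : ℝ≥0∞) + 1)⁻¹ ≠ 0 := fun k =>
    ENNReal.inv_ne_zero.2 (by simp)
  choose Φ hΦ hΦu hΦd using fun (k : ℕ) (o : Option t) =>
    exists_smooth_approx_cutoff hΩ.isOpen.measurableSet hu.memLp hu.isWeakPartial (hχ o) (hχc o)
      (hcone o) (hε k)
  have hlim : Tendsto (fun k : ℕ => ∑ _ : Option t, ((k : ℝ≥0∞) + 1)⁻¹) atTop (𝓝 0) := by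
    have h1 : Tendsto (fun k : ℕ => ((k : ℝ≥0∞) + 1)⁻¹) atTop (𝓝 0) := by
      have := (tendsto_add_atTop_iff_nat 1).2 ENNReal.tendsto_inv_nat_nhds_zero
      simpa using this
    have h2 := tendsto_finsetSum (Finset.univ : Finset (Option t))
      fun (_ : Option t) _ => h1
    simpa only [Finset.sum_const_zero] using h2
  refine ⟨fun k x => ∑ o, Φ k o x, fun k => ContDiff.sum fun o _ => hΦ k o, ?_, fun i => ?_⟩
  · refine tendsto_of_tendsto_of_tendsto_of_le_of_le tendsto_const_nhds hlim (fun _ => zero_le)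
      fun k => ?_
    have hm : ∀ o ∈ Finset.univ, AEStronglyMeasurable (fun x => Φ k o x - χ o x • u x)
        (volume.restrict Ω) := fun o _ =>
      (hΦ k o).continuous.aestronglyMeasurable.sub
        ((hχ o).continuous.aestronglyMeasurable.smul hu.memLp.1)
    refine le_trans (le_of_eq ?_) ((eLpNorm_sum_le hm (by norm_num)).trans
      (Finset.sum_le_sum fun o _ => hΦu k o))
    refine eLpNorm_congr_ae (ae_restrict_of_forall_mem hΩ.isOpen.measurableSet fun x hx => ?_)
    rw [Finset.sum_apply, Finset.sum_sub_distrib, ← Finset.sum_smul, hχ1 x (subset_closure hx),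
      one_smul]
  · refine tendsto_of_tendsto_of_tendsto_of_le_of_le tendsto_const_nhds hlim (fun _ => zero_le)
      fun k => ?_
    have hm : ∀ o ∈ Finset.univ, AEStronglyMeasurable (fun x => fderiv ℝ (Φ k o) x (basisVec i) -
        (χ o x • weakPartial Ω i u x + fderiv ℝ (χ o) x (basisVec i) • u x))
        (volume.restrict Ω) := fun o _ =>
      (continuous_fderiv_basisVec (hΦ k o) i).aestronglyMeasurable.sub
        (((hχ o).continuous.aestronglyMeasurable.smul (hu.isWeakPartial i).1.1).add
          ((continuous_partial (hχ o) _).aestronglyMeasurable.smul hu.memLp.1))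
    refine le_trans (le_of_eq ?_) ((eLpNorm_sum_le hm (by norm_num)).trans
      (Finset.sum_le_sum fun o _ => hΦd k o i))
    refine eLpNorm_congr_ae (ae_restrict_of_forall_mem hΩ.isOpen.measurableSet fun x hx => ?_)
    have hd : fderiv ℝ (fun x => ∑ o, Φ k o x) x = ∑ o, fderiv ℝ (Φ k o) x :=
      fderiv_fun_sum fun o _ => ((hΦ k o).differentiable (by simp)) x
    -- the gradients of a partition of unity sum up to zero
    have hd0 : ∑ o, fderiv ℝ (χ o) x = 0 := by
      rw [← fderiv_fun_sum fun o _ => ((hχ o).differentiable (by simp)) x]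
      have : (fun x => ∑ o, χ o x) =ᶠ[𝓝 x] fun _ => 1 := by
        filter_upwards [hΩ.isOpen.mem_nhds hx] with y hy
        exact hχ1 y (subset_closure hy)
      rw [this.fderiv_eq]; simp
    have hd' := DFunLike.congr_fun hd (basisVec i)
    have hd0' := DFunLike.congr_fun hd0 (basisVec i)
    rw [sum_apply] at hd' hd0'
    rw [Finset.sum_apply, Finset.sum_sub_distrib, Finset.sum_add_distrib, ← Finset.sum_smul,
      ← Finset.sum_smul, hχ1 x (subset_closure hx), one_smul, hd0', ← hd']
    simp

section L2

variable {α : Type*} [MeasurableSpace α] {μ : Measure α}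

lemma eLpNorm_two_sq {E : Type*} [NormedAddCommGroup E] (f : α → E) :
    (eLpNorm f 2 μ) ^ 2 = ∫⁻ x, ‖f x‖ₑ ^ 2 ∂μ := by
  simpa using eLpNorm_nnreal_pow_eq_lintegral (p := 2) (f := f) (μ := μ) two_ne_zero

/-- Convergence in `L²` implies convergence of the `L²` norms. -/
lemma tendsto_lintegral_enorm_sq {f : ℕ → α → Vec3} {g : α → Vec3}
    (hf : ∀ k, AEStronglyMeasurable (f k) μ) (hg : MemLp g 2 μ)
    (h : Tendsto (fun k => eLpNorm (fun x => f k x - g x) 2 μ) atTop (𝓝 0)) :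
    Tendsto (fun k => ∫⁻ x, ‖f k x‖ₑ ^ 2 ∂μ) atTop (𝓝 (∫⁻ x, ‖g x‖ₑ ^ 2 ∂μ)) := by
  simp_rw [← eLpNorm_two_sq]
  refine ENNReal.Tendsto.pow ?_
  have hup : ∀ k, eLpNorm (f k) 2 μ ≤ eLpNorm g 2 μ + eLpNorm (fun x => f k x - g x) 2 μ :=
    fun k => by
      have h1 := eLpNorm_add_le hg.1 ((hf k).sub hg.1) (p := 2) (by norm_num)
      rwa [add_sub_cancel] at h1
  have hlo : ∀ k, eLpNorm g 2 μ - eLpNorm (fun x => f k x - g x) 2 μ ≤ eLpNorm (f k) 2 μ :=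
    fun k => by
      have h1 := eLpNorm_sub_le (hf k) ((hf k).sub hg.1) (p := 2) (by norm_num)
      rw [sub_sub_cancel] at h1
      exact tsub_le_iff_right.2 h1
  refine tendsto_of_tendsto_of_tendsto_of_le_of_le ?_ ?_ hlo hup
  · simpa using ENNReal.Tendsto.sub tendsto_const_nhds h (Or.inl hg.2.ne)
  · simpa using (tendsto_const_nhds (x := eLpNorm g 2 μ)).add h

/-- If `f k → f` and `g k → g` in `L²`, then the scalar products converge in `L¹`. -/
lemma tendsto_lintegral_inner_sub {f g : ℕ → α → Vec3} {f₀ g₀ : α → Vec3}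
    (hf : ∀ k, AEStronglyMeasurable (f k) μ) (hg : ∀ k, AEStronglyMeasurable (g k) μ)
    (hf₀ : MemLp f₀ 2 μ) (hg₀ : MemLp g₀ 2 μ)
    (h : Tendsto (fun k => eLpNorm (fun x => f k x - f₀ x) 2 μ) atTop (𝓝 0))
    (h' : Tendsto (fun k => eLpNorm (fun x => g k x - g₀ x) 2 μ) atTop (𝓝 0)) :
    Tendsto (fun k => ∫⁻ x, ‖inner ℝ (f k x) (g k x) - inner ℝ (f₀ x) (g₀ x)‖ₑ ∂μ) atTop
      (𝓝 0) := by
  have hholder : ∀ a b : α → Vec3, AEStronglyMeasurable a μ → AEStronglyMeasurable b μ →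
      ∫⁻ x, ‖a x‖ₑ * ‖b x‖ₑ ∂μ ≤ eLpNorm a 2 μ * eLpNorm b 2 μ := fun a b ha hb => by
    have h1 := ENNReal.lintegral_mul_le_Lp_mul_Lq μ Real.HolderConjugate.two_two ha.enorm hb.enorm
    simpa [eLpNorm_eq_lintegral_rpow_enorm_toReal, eLpNorm'] using h1
  have hbound : ∀ k, ∫⁻ x, ‖inner ℝ (f k x) (g k x) - inner ℝ (f₀ x) (g₀ x)‖ₑ ∂μ ≤
      eLpNorm (fun x => f k x - f₀ x) 2 μ * (eLpNorm (fun x => g k x - g₀ x) 2 μ + eLpNorm g₀ 2 μ) +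
        eLpNorm f₀ 2 μ * eLpNorm (fun x => g k x - g₀ x) 2 μ := fun k => by
    have hd := (hf k).sub hf₀.1
    have hd' := (hg k).sub hg₀.1
    have hpt : ∀ x, ‖inner ℝ (f k x) (g k x) - inner ℝ (f₀ x) (g₀ x)‖ₑ ≤
        ‖f k x - f₀ x‖ₑ * ‖g k x‖ₑ + ‖f₀ x‖ₑ * ‖g k x - g₀ x‖ₑ := fun x => by
      have h1 : inner ℝ (f k x) (g k x) - inner ℝ (f₀ x) (g₀ x) =
          inner ℝ (f k x - f₀ x) (g k x) + inner ℝ (f₀ x) (g k x - g₀ x) := by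
        rw [inner_sub_left, inner_sub_right]; ring
      have hin : ∀ v w : Vec3, ‖inner ℝ v w‖ₑ ≤ ‖v‖ₑ * ‖w‖ₑ := fun v w => by
        rw [← ofReal_norm, ← ofReal_norm v, ← ofReal_norm w, ← ENNReal.ofReal_mul (norm_nonneg _)]
        exact ENNReal.ofReal_le_ofReal (norm_inner_le_norm v w)
      rw [h1]
      exact (enorm_add_le _ _).trans (add_le_add (hin _ _) (hin _ _))
    refine (lintegral_mono hpt).trans ?_
    rw [lintegral_add_left' (f := fun x => ‖f k x - f₀ x‖ₑ * ‖g k x‖ₑ)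
      (hd.enorm.mul (hg k).enorm)]
    refine add_le_add ((hholder _ _ hd (hg k)).trans ?_) (hholder _ _ hf₀.1 hd')
    have h1 := eLpNorm_add_le hd' hg₀.1 (p := 2) (by norm_num)
    rw [sub_add_cancel] at h1
    exact mul_le_mul' le_rfl h1
  refine tendsto_of_tendsto_of_tendsto_of_le_of_le tendsto_const_nhds ?_ (fun _ => zero_le) hbound
  have e1 : Tendsto (fun k => eLpNorm (fun x => g k x - g₀ x) 2 μ + eLpNorm g₀ 2 μ) atTop
      (𝓝 (0 + eLpNorm g₀ 2 μ)) := h'.add tendsto_const_nhds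
  rw [zero_add] at e1
  have e2 := ENNReal.Tendsto.mul h (Or.inr hg₀.2.ne) e1 (Or.inr ENNReal.zero_ne_top)
  have e3 := ENNReal.Tendsto.const_mul (a := eLpNorm f₀ 2 μ) h' (Or.inr hf₀.2.ne)
  simpa using e2.add e3

end L2

section Trace

variable {n : ℕ} {Ω : Set (Space (n + 1))}

/-- The distance in `H¹(Ω)` between a smooth map and a Sobolev map. -/
noncomputable def h1Dist {N : ℕ} (Ω : Set (Space N)) (Φ u : Space N → Vec3) : ℝ≥0∞ :=
  eLpNorm (fun x => Φ x - u x) 2 (volume.restrict Ω) +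
    ∑ i, eLpNorm (fun x => fderiv ℝ Φ x (basisVec i) - weakPartial Ω i u x) 2 (volume.restrict Ω)

lemma SmoothApprox.tendsto_h1Dist {N : ℕ} {Ω : Set (Space N)} {Φ : ℕ → Space N → Vec3}
    {u : Space N → Vec3} (h : SmoothApprox Ω Φ u) :
    Tendsto (fun k => h1Dist Ω (Φ k) u) atTop (𝓝 0) := by
  have h1 := tendsto_finsetSum (Finset.univ : Finset (Fin N)) fun i _ => h.tendsto_partial i
  simpa [h1Dist] using h.tendsto.add h1

/-- The trace inequality for the difference of two smooth maps near the same Sobolev map. -/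
lemma IsSmoothBoundedDomain.exists_eLpNorm_surface_sub_le (hΩ : IsSmoothBoundedDomain Ω) :
    ∃ C : ℝ≥0∞, C ≠ ⊤ ∧ ∀ Φ Ψ : Space (n + 1) → Vec3, ContDiff ℝ ∞ Φ → ContDiff ℝ ∞ Ψ →
      ∀ u, MemH1 Ω u → eLpNorm (fun x => Φ x - Ψ x) 2 (surfaceMeasure Ω) ≤
        C * (h1Dist Ω Φ u + h1Dist Ω Ψ u) := by
  obtain ⟨C, hC, h⟩ := hΩ.exists_trace_ineq_sq
  refine ⟨C + 1, by simp [hC], fun Φ Ψ hΦ hΨ u hu => ?_⟩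
  have hT := h (fun x => Φ x - Ψ x) ((hΦ.sub hΨ).of_le (by simp))
  have hd : ∀ x i, fderiv ℝ (fun x => Φ x - Ψ x) x (basisVec i) =
      fderiv ℝ Φ x (basisVec i) - fderiv ℝ Ψ x (basisVec i) := fun x i => by
    rw [fderiv_fun_sub ((hΦ.differentiable (by simp)) x) ((hΨ.differentiable (by simp)) x)]
    rfl
  simp_rw [hd] at hT
  have hmeas : ∀ i ∈ Finset.univ, AEMeasurable (fun x => ‖fderiv ℝ Φ x (basisVec i) -
      fderiv ℝ Ψ x (basisVec i)‖ₑ ^ 2) (volume.restrict Ω) := fun i _ =>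
    (((continuous_fderiv_basisVec hΦ i).sub (continuous_fderiv_basisVec hΨ i)).enorm.measurable.pow_const 2).aemeasurable
  rw [lintegral_finsetSum' _ hmeas] at hT
  simp_rw [← eLpNorm_two_sq] at hT
  set a := eLpNorm (fun x => Φ x - Ψ x) 2 (volume.restrict Ω)
  set b := fun i => eLpNorm (fun x => fderiv ℝ Φ x (basisVec i) - fderiv ℝ Ψ x (basisVec i)) 2
    (volume.restrict Ω) with hb
  have htri : ∀ p q r : Space (n + 1) → Vec3, Continuous p → Continuous q →
      AEStronglyMeasurable r (volume.restrict Ω) →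
      eLpNorm (fun x => p x - q x) 2 (volume.restrict Ω) ≤
        eLpNorm (fun x => p x - r x) 2 (volume.restrict Ω) +
          eLpNorm (fun x => q x - r x) 2 (volume.restrict Ω) := fun p q r hp hq hr => by
    have h1 := eLpNorm_sub_le (hp.aestronglyMeasurable.sub hr) (hq.aestronglyMeasurable.sub hr)
      (p := 2) (by norm_num)
    rwa [sub_sub_sub_cancel_right] at h1
  have hsum : a + ∑ i, b i ≤ h1Dist Ω Φ u + h1Dist Ω Ψ u := by
    calc a + ∑ i, b i ≤ _ + ∑ i, _ := add_le_add
          (htri Φ Ψ u hΦ.continuous hΨ.continuous hu.memLp.1)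
          (Finset.sum_le_sum fun i _ => htri _ _ _ (continuous_fderiv_basisVec hΦ i) (continuous_fderiv_basisVec hΨ i)
            (hu.isWeakPartial i).1.1)
      _ = _ := by rw [Finset.sum_add_distrib, h1Dist, h1Dist]; ring
  have hsq : a ^ 2 + ∑ i, b i ^ 2 ≤ (a + ∑ i, b i) ^ 2 := by
    have h1 : ∑ i, b i ^ 2 ≤ (∑ i, b i) ^ 2 := Finset.sum_sq_le_sq_sum_of_nonneg fun _ _ => zero_le
    calc _ ≤ a ^ 2 + (∑ i, b i) ^ 2 := by gcongr
      _ ≤ a ^ 2 + (∑ i, b i) ^ 2 + 2 * a * ∑ i, b i := le_self_add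
      _ = _ := by ring
  have hC1 : C ≤ (C + 1) ^ 2 := by
    calc C ≤ C + (C ^ 2 + C + 1) := le_self_add
      _ = _ := by ring
  refine (ENNReal.pow_le_pow_left_iff two_ne_zero).1 ?_
  calc _ ≤ C * (a ^ 2 + ∑ i, b i ^ 2) := hT
    _ ≤ (C + 1) ^ 2 * (h1Dist Ω Φ u + h1Dist Ω Ψ u) ^ 2 := by
        gcongr
        exact hsq.trans (by gcongr)
    _ = _ := by rw [mul_pow]

lemma memLp_surface (hΩ : IsSmoothBoundedDomain Ω) {Φ : Space (n + 1) → Vec3}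
    (hΦ : Continuous Φ) : MemLp Φ 2 (surfaceMeasure Ω) := by
  have := isFiniteMeasure_surfaceMeasure hΩ
  obtain ⟨C, hC⟩ := hΩ.isCompact_frontier.exists_bound_of_continuousOn hΦ.continuousOn
  exact MemLp.of_bound hΦ.aestronglyMeasurable C
    (ae_restrict_of_forall_mem isClosed_frontier.measurableSet hC)

/-- Sobolev maps on smooth bounded domains have boundary traces. -/
lemma IsSmoothBoundedDomain.exists_isTrace (hΩ : IsSmoothBoundedDomain Ω)
    {u : Space (n + 1) → Vec3} (hu : MemH1 Ω u) : ∃ g, IsTrace Ω u g := by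
  have : Fact ((1 : ℝ≥0∞) ≤ 2) := ⟨by norm_num⟩
  obtain ⟨Φ, hΦ⟩ := hΩ.exists_smoothApprox hu
  obtain ⟨C, hC, h⟩ := hΩ.exists_eLpNorm_surface_sub_le
  have hmem : ∀ k, MemLp (Φ k) 2 (surfaceMeasure Ω) := fun k =>
    memLp_surface hΩ (hΦ.contDiff k).continuous
  have hlim : Tendsto (fun k => C * h1Dist Ω (Φ k) u) atTop (𝓝 0) := by
    simpa using ENNReal.Tendsto.const_mul (a := C) hΦ.tendsto_h1Dist (Or.inr hC)
  have hcau : CauchySeq fun k => (hmem k).toLp (Φ k) := by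
    refine EMetric.cauchySeq_iff.2 fun ε hε => ?_
    obtain ⟨K, hK⟩ := eventually_atTop.1
      (hlim.eventually (eventually_lt_nhds (ENNReal.half_pos hε.ne')))
    refine ⟨K, fun k hk l hl => ?_⟩
    rw [Lp.edist_toLp_toLp]
    refine (h (Φ k) (Φ l) (hΦ.contDiff k) (hΦ.contDiff l) u hu).trans_lt ?_
    rw [mul_add, ← ENNReal.add_halves ε]
    exact ENNReal.add_lt_add (hK k hk) (hK l hl)
  obtain ⟨G, hG⟩ := cauchySeq_tendsto_of_complete hcau
  refine ⟨G, Lp.memLp G, Φ, hΦ, ?_⟩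
  have h1 := (Lp.tendsto_Lp_iff_tendsto_eLpNorm' _ _).1 hG
  refine h1.congr fun k => eLpNorm_congr_ae ?_
  filter_upwards [(hmem k).coeFn_toLp] with x hx
  simp [hx]

lemma MemH1.isTrace (hΩ : IsSmoothBoundedDomain Ω) {u : Space (n + 1) → Vec3} (hu : MemH1 Ω u) :
    IsTrace Ω u (trace Ω u) := by
  have := hΩ.exists_isTrace hu
  rw [trace, dif_pos this]
  exact this.choose_spec

/-- The trace of a constant is that constant. -/
lemma IsTrace.ae_eq_of_isConstOn (hΩ : IsSmoothBoundedDomain Ω) {u g : Space (n + 1) → Vec3}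
    (hg : IsTrace Ω u g) {c : Vec3} (hc : IsConstOn Ω u c) :
    g =ᵐ[surfaceMeasure Ω] fun _ => c := by
  have := hΩ.isFiniteMeasure_restrict
  obtain ⟨hgm, Φ, hΦ, hlim⟩ := hg
  obtain ⟨C, hC, h⟩ := hΩ.exists_eLpNorm_surface_sub_le
  have h0 : h1Dist Ω (fun _ => c) u = 0 := by
    have e1 : eLpNorm (fun x => c - u x) 2 (volume.restrict Ω) = 0 := by
      rw [← eLpNorm_zero (μ := volume.restrict Ω) (p := 2) (ε := Vec3)]
      refine eLpNorm_congr_ae ?_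
      filter_upwards [hc] with x hx
      simp [hx]
    have e2 : ∀ i, eLpNorm (fun x => fderiv ℝ (fun _ : Space (n + 1) => c) x (basisVec i) -
        weakPartial Ω i u x) 2 (volume.restrict Ω) = 0 := fun i => by
      rw [← eLpNorm_zero (μ := volume.restrict Ω) (p := 2) (ε := Vec3)]
      refine eLpNorm_congr_ae ?_
      filter_upwards [weakPartial_of_isConstOn hΩ.isOpen hc i] with x hx
      simp [hx]
    simp only [h1Dist, e1, e2, Finset.sum_const_zero, add_zero]
  have hle : ∀ k, eLpNorm (fun x => g x - c) 2 (surfaceMeasure Ω) ≤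
      eLpNorm (fun x => Φ k x - g x) 2 (surfaceMeasure Ω) + C * h1Dist Ω (Φ k) u := fun k => by
    have hΦm : AEStronglyMeasurable (Φ k) (surfaceMeasure Ω) :=
      (hΦ.contDiff k).continuous.aestronglyMeasurable
    have e1 := eLpNorm_sub_le (hΦm.sub aestronglyMeasurable_const (g := fun _ => c))
      (hΦm.sub hgm.1) (p := 2) (by norm_num)
    have e2 := h (Φ k) (fun _ => c) (hΦ.contDiff k) contDiff_const u (memH1_of_isConstOn hc)
    rw [h0, add_zero] at e2
    have e3 : (Φ k - fun _ => c) - (Φ k - g) = fun x => g x - c := by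
      ext x; simp
    rw [e3] at e1
    exact e1.trans ((add_le_add e2 le_rfl).trans_eq (add_comm _ _))
  have hlim0 : Tendsto (fun k => eLpNorm (fun x => Φ k x - g x) 2 (surfaceMeasure Ω) +
      C * h1Dist Ω (Φ k) u) atTop (𝓝 0) := by
    simpa using hlim.add (ENNReal.Tendsto.const_mul (a := C) hΦ.tendsto_h1Dist (Or.inr hC))
  have hz := le_antisymm (ge_of_tendsto' hlim0 hle) zero_le
  rw [eLpNorm_eq_zero_iff (f := fun x => g x - c) (hgm.1.sub aestronglyMeasurable_const)
    (by norm_num)] at hz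
  filter_upwards [hz] with x hx
  exact sub_eq_zero.1 hx

end Trace

/-! ### Horizontal and vertical components -/

section Vectors

lemma inner_e3 (v : Vec3) : inner ℝ v e3 = v 2 := by
  simp [e3, PiLp.inner_apply, Fin.sum_univ_three]

lemma norm_e3 : ‖e3‖ = 1 := by
  simp [e3, EuclideanSpace.norm_eq, Fin.sum_univ_three]

lemma cross_e3 (v : Vec3) : cross v e3 = !₂[v 1, -v 0, 0] := by
  ext i
  fin_cases i <;> simp [cross, e3, crossProduct]

/-- The linear map `v ↦ v × e₃`. -/
noncomputable def crossE3 : Vec3 →L[ℝ] Vec3 :=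
  LinearMap.toContinuousLinearMap
    { toFun := fun v => cross v e3
      map_add' := fun v w => by simp [cross]
      map_smul' := fun c v => by simp [cross] }

@[simp] lemma crossE3_apply (v : Vec3) : crossE3 v = cross v e3 := rfl

/-- The orthogonal projection to the vertical axis. -/
noncomputable def vertical : Vec3 →L[ℝ] Vec3 := (innerSL ℝ e3).smulRight e3

lemma norm_vertical (v : Vec3) : ‖vertical v‖ ^ 2 = inner ℝ v e3 ^ 2 := by
  simp [vertical, norm_smul, norm_e3, real_inner_comm]

lemma norm_cross_sq_add (v : Vec3) : ‖cross v e3‖ ^ 2 + inner ℝ v e3 ^ 2 = ‖v‖ ^ 2 := by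
  rw [inner_e3, cross_e3, EuclideanSpace.norm_sq_eq, EuclideanSpace.norm_sq_eq]
  simp [Fin.sum_univ_three]
  ring

lemma norm_cross_e3_le (v : Vec3) : ‖cross v e3‖ ≤ ‖v‖ := by
  have := norm_cross_sq_add v
  exact abs_le_of_sq_le_sq' (by nlinarith [sq_nonneg (inner ℝ v e3)]) (norm_nonneg _) |>.2

lemma norm_vertical_le (v : Vec3) : ‖vertical v‖ ≤ ‖v‖ := by
  have := norm_cross_sq_add v
  have := norm_vertical v
  exact abs_le_of_sq_le_sq' (by nlinarith [sq_nonneg ‖cross v e3‖]) (norm_nonneg _) |>.2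

lemma enorm_sq_eq_ofReal {E : Type*} [SeminormedAddCommGroup E] (v : E) :
    ‖v‖ₑ ^ 2 = ENNReal.ofReal (‖v‖ ^ 2) := by
  rw [ENNReal.ofReal_pow (norm_nonneg _), ofReal_norm]

lemma enorm_vertical_sq (v : Vec3) : ‖vertical v‖ₑ ^ 2 = ENNReal.ofReal (inner ℝ v e3 ^ 2) := by
  rw [enorm_sq_eq_ofReal, norm_vertical]

lemma enorm_cross_sq_add (v : Vec3) : ‖cross v e3‖ₑ ^ 2 + ‖vertical v‖ₑ ^ 2 = ‖v‖ₑ ^ 2 := by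
  rw [enorm_sq_eq_ofReal, enorm_sq_eq_ofReal, enorm_sq_eq_ofReal,
    ← ENNReal.ofReal_add (sq_nonneg _) (sq_nonneg _), norm_vertical, norm_cross_sq_add]

lemma eq_e3_or_eq_neg_e3 {c : Vec3} (hc : ‖c‖ = 1) (h : cross c e3 = 0) : c = e3 ∨ c = -e3 := by
  have h1 := norm_cross_sq_add c
  rw [h, hc, inner_e3] at h1
  rw [cross_e3] at h
  have h2 : c 1 = 0 := by simpa using congrArg (fun v : Vec3 => v 0) h
  have h3 : c 0 = 0 := by simpa using congrArg (fun v : Vec3 => v 1) h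
  have h4 : c 2 = 1 ∨ c 2 = -1 := by simpa using h1
  rcases h4 with h4 | h4
  · left
    ext i
    fin_cases i <;> simp [e3, h2, h3, h4]
  · right
    ext i
    fin_cases i <;> simp [e3, h2, h3, h4]

end Vectors

/-! ### Inequalities for Sobolev maps -/

section Inequalities

variable {n : ℕ} {Ω : Set (Space (n + 1))}

/-- The Dirichlet energy. -/
noncomputable def dirichlet {N : ℕ} (Ω : Set (Space N)) (u : Space N → Vec3) : ℝ≥0∞ :=
  ∫⁻ x in Ω, ∑ i, ‖weakPartial Ω i u x‖ₑ ^ 2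

lemma dirichlet_eq_sum {u : Space (n + 1) → Vec3} (hu : MemH1 Ω u) :
    dirichlet Ω u = ∑ i, ∫⁻ x in Ω, ‖weakPartial Ω i u x‖ₑ ^ 2 :=
  lintegral_finsetSum' _ fun i _ => (hu.isWeakPartial i).1.1.enorm.pow_const 2

lemma lintegral_enorm_sq_lt_top {α : Type*} [MeasurableSpace α] {μ : Measure α} {f : α → Vec3}
    (hf : MemLp f 2 μ) : ∫⁻ x, ‖f x‖ₑ ^ 2 ∂μ < ⊤ := by
  rw [← eLpNorm_two_sq]
  exact ENNReal.pow_lt_top hf.2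

lemma dirichlet_lt_top {u : Space (n + 1) → Vec3} (hu : MemH1 Ω u) : dirichlet Ω u < ⊤ := by
  rw [dirichlet_eq_sum hu]
  exact ENNReal.sum_lt_top.2 fun i _ => lintegral_enorm_sq_lt_top (hu.isWeakPartial i).1

lemma weakPartial_eq_zero_of_dirichlet {u : Space (n + 1) → Vec3} (hu : MemH1 Ω u)
    (h : dirichlet Ω u = 0) (i : Fin (n + 1)) : weakPartial Ω i u =ᵐ[volume.restrict Ω] 0 := by
  rw [dirichlet_eq_sum hu, Finset.sum_eq_zero_iff] at h
  have h1 := h i (Finset.mem_univ i)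
  rw [lintegral_eq_zero_iff' ((hu.isWeakPartial i).1.1.enorm.pow_const 2)] at h1
  filter_upwards [h1] with x hx
  simpa using hx

lemma dirichlet_congr {u v : Space (n + 1) → Vec3}
    (h : ∀ i, weakPartial Ω i u =ᵐ[volume.restrict Ω] weakPartial Ω i v) :
    dirichlet Ω u = dirichlet Ω v := by
  refine lintegral_congr_ae ?_
  filter_upwards [eventually_all.2 h] with x hx
  exact Finset.sum_congr rfl fun i _ => by rw [hx i]

/-- Linear contractions of `ℝ³` are compatible with convergence in `L²`. -/
lemma tendsto_lintegral_clm {α : Type*} [MeasurableSpace α] {μ : Measure α} (P : Vec3 →L[ℝ] Vec3)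
    (hP : ∀ v, ‖P v‖ ≤ ‖v‖) {f : ℕ → α → Vec3} {g : α → Vec3}
    (hf : ∀ k, AEStronglyMeasurable (f k) μ) (hg : MemLp g 2 μ)
    (h : Tendsto (fun k => eLpNorm (fun x => f k x - g x) 2 μ) atTop (𝓝 0)) :
    Tendsto (fun k => ∫⁻ x, ‖P (f k x)‖ₑ ^ 2 ∂μ) atTop (𝓝 (∫⁻ x, ‖P (g x)‖ₑ ^ 2 ∂μ)) := by
  refine tendsto_lintegral_enorm_sq (fun k => P.continuous.comp_aestronglyMeasurable (hf k))
    (P.comp_memLp' hg) ?_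
  refine tendsto_of_tendsto_of_tendsto_of_le_of_le tendsto_const_nhds h (fun _ => zero_le)
    fun k => eLpNorm_mono fun x => ?_
  rw [← map_sub]
  exact hP _

lemma SmoothApprox.tendsto_dirichlet {u : Space (n + 1) → Vec3} (hu : MemH1 Ω u)
    {Φ : ℕ → Space (n + 1) → Vec3} (hΦ : SmoothApprox Ω Φ u) :
    Tendsto (fun k => ∫⁻ x in Ω, ∑ i, ‖fderiv ℝ (Φ k) x (basisVec i)‖ₑ ^ 2) atTop
      (𝓝 (dirichlet Ω u)) := by
  have hsum : ∀ k, ∫⁻ x in Ω, ∑ i, ‖fderiv ℝ (Φ k) x (basisVec i)‖ₑ ^ 2 =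
      ∑ i, ∫⁻ x in Ω, ‖fderiv ℝ (Φ k) x (basisVec i)‖ₑ ^ 2 := fun k =>
    lintegral_finsetSum _ fun i _ =>
      ((continuous_fderiv_basisVec (hΦ.contDiff k) i).measurable.enorm).pow_const 2
  simp_rw [hsum, dirichlet_eq_sum hu]
  exact tendsto_finsetSum _ fun i _ => tendsto_lintegral_enorm_sq
    (fun k => (continuous_fderiv_basisVec (hΦ.contDiff k) i).aestronglyMeasurable)
    (hu.isWeakPartial i).1 (hΦ.tendsto_partial i)

lemma lintegral_sum_fderiv_clm_le (P : Vec3 →L[ℝ] Vec3) (hP : ∀ v, ‖P v‖ ≤ ‖v‖)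
    {Φ : Space (n + 1) → Vec3} (hΦ : ContDiff ℝ ∞ Φ) :
    ∫⁻ x in Ω, ∑ i, ‖fderiv ℝ (fun x => P (Φ x)) x (basisVec i)‖ₑ ^ 2 ≤
      ∫⁻ x in Ω, ∑ i, ‖fderiv ℝ Φ x (basisVec i)‖ₑ ^ 2 := by
  refine lintegral_mono fun x => Finset.sum_le_sum fun i _ => ?_
  have h1 : fderiv ℝ (fun x => P (Φ x)) x = P.comp (fderiv ℝ Φ x) :=
    (P.hasFDerivAt.comp x ((hΦ.differentiable (by simp)) x).hasFDerivAt).fderiv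
  rw [h1]
  gcongr
  exact enorm_le_iff_norm_le.2 (hP _)

/-- The Friedrichs inequality for Sobolev maps with their traces, after a linear contraction of
the target. -/
lemma IsSmoothBoundedDomain.exists_friedrichs (hΩ : IsSmoothBoundedDomain Ω) :
    ∃ C : ℝ≥0∞, C ≠ ⊤ ∧ ∀ P : Vec3 →L[ℝ] Vec3, (∀ v, ‖P v‖ ≤ ‖v‖) →
      ∀ u g : Space (n + 1) → Vec3, MemH1 Ω u → IsTrace Ω u g →
        ∫⁻ x in Ω, ‖P (u x)‖ₑ ^ 2 ≤
          C * (dirichlet Ω u + ∫⁻ x, ‖P (g x)‖ₑ ^ 2 ∂(surfaceMeasure Ω)) := by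
  obtain ⟨C, hC, h⟩ := hΩ.exists_friedrichs_ineq_sq
  refine ⟨C, hC, fun P hP u g hu ⟨hg, Φ, hΦ, hlim⟩ => ?_⟩
  have hΦm : ∀ (μ : Measure (Space (n + 1))) k, AEStronglyMeasurable (Φ k) μ := fun μ k =>
    (hΦ.contDiff k).continuous.aestronglyMeasurable
  refine le_of_tendsto_of_tendsto' (tendsto_lintegral_clm P hP (hΦm _) hu.memLp hΦ.tendsto)
    (ENNReal.Tendsto.const_mul ((hΦ.tendsto_dirichlet hu).add
      (tendsto_lintegral_clm P hP (hΦm _) hg hlim)) (Or.inr hC)) fun k => ?_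
  exact (h (fun x => P (Φ k x)) ((P.contDiff.comp (hΦ.contDiff k)).of_le (by simp))).trans
    (mul_le_mul_right (add_le_add (lintegral_sum_fderiv_clm_le P hP (hΦ.contDiff k)) le_rfl) C)

/-- The trace inequality for Sobolev maps, after a linear contraction of the target. -/
lemma IsSmoothBoundedDomain.exists_trace_le (hΩ : IsSmoothBoundedDomain Ω) :
    ∃ C : ℝ≥0∞, C ≠ ⊤ ∧ ∀ P : Vec3 →L[ℝ] Vec3, (∀ v, ‖P v‖ ≤ ‖v‖) →
      ∀ u g : Space (n + 1) → Vec3, MemH1 Ω u → IsTrace Ω u g →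
        ∫⁻ x, ‖P (g x)‖ₑ ^ 2 ∂(surfaceMeasure Ω) ≤
          C * ((∫⁻ x in Ω, ‖P (u x)‖ₑ ^ 2) + dirichlet Ω u) := by
  obtain ⟨C, hC, h⟩ := hΩ.exists_trace_ineq_sq
  refine ⟨C, hC, fun P hP u g hu ⟨hg, Φ, hΦ, hlim⟩ => ?_⟩
  have hΦm : ∀ (μ : Measure (Space (n + 1))) k, AEStronglyMeasurable (Φ k) μ := fun μ k =>
    (hΦ.contDiff k).continuous.aestronglyMeasurable
  refine le_of_tendsto_of_tendsto' (tendsto_lintegral_clm P hP (hΦm _) hg hlim)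
    (ENNReal.Tendsto.const_mul ((tendsto_lintegral_clm P hP (hΦm _) hu.memLp hΦ.tendsto).add
      (hΦ.tendsto_dirichlet hu)) (Or.inr hC)) fun k => ?_
  exact (h (fun x => P (Φ k x)) ((P.contDiff.comp (hΦ.contDiff k)).of_le (by simp))).trans
    (mul_le_mul_right (add_le_add le_rfl (lintegral_sum_fderiv_clm_le P hP (hΦ.contDiff k))) C)

/-- Maps in `H¹₀` have trace zero. -/
lemma MemH10.isTrace_zero (hΩ : IsSmoothBoundedDomain Ω) {u : Space (n + 1) → Vec3}
    (hu : MemH10 Ω u) : IsTrace Ω u 0 := by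
  obtain ⟨-, Φ, hΦ, hsupp⟩ := hu
  refine ⟨MemLp.zero, Φ, hΦ, ?_⟩
  have h0 : ∀ k, eLpNorm (fun x => Φ k x - (0 : Space (n + 1) → Vec3) x) 2 (surfaceMeasure Ω) = 0 :=
    fun k => by
      rw [← eLpNorm_zero (μ := surfaceMeasure Ω) (p := 2) (ε := Vec3)]
      refine eLpNorm_congr_ae (ae_restrict_of_forall_mem isClosed_frontier.measurableSet
        fun x hx => ?_)
      rw [hΩ.isOpen.frontier_eq] at hx
      have : Φ k x = 0 := image_eq_zero_of_notMem_tsupport fun h => hx.2 ((hsupp k).2 h)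
      simp [this]
  simp only [h0]
  exact tendsto_const_nhds

/-- A Sobolev map with values in the sphere is orthogonal to its weak derivatives: for smooth
approximations `Φ k` and a test function `φ`, the integral of `∂ᵢ (φ ‖Φ k‖²)` vanishes, and in the
limit this says that the integral of `φ (m · ∂ᵢ m)` vanishes, because `‖m‖ = 1`. -/
lemma MemH1Sphere.inner_weakPartial (hΩ : IsSmoothBoundedDomain Ω) {m : Space (n + 1) → Vec3}
    (hm : MemH1Sphere Ω m) (i : Fin (n + 1)) :
    ∀ᵐ x ∂(volume.restrict Ω), inner ℝ (m x) (weakPartial Ω i m x) = 0 := by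
  obtain ⟨Φ, hΦ⟩ := hΩ.exists_smoothApprox hm.memH1
  have hm2 := hm.memH1.memLp
  have hd2 := (hm.memH1.isWeakPartial i).1
  have hΦm : ∀ k, AEStronglyMeasurable (Φ k) (volume.restrict Ω) := fun k =>
    (hΦ.contDiff k).continuous.aestronglyMeasurable
  have hDm : ∀ k, AEStronglyMeasurable (fun x => fderiv ℝ (Φ k) x (basisVec i))
      (volume.restrict Ω) := fun k => (continuous_fderiv_basisVec (hΦ.contDiff k) i).aestronglyMeasurable
  have hlim1 := tendsto_lintegral_inner_sub hΦm hΦm hm2 hm2 hΦ.tendsto hΦ.tendsto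
  have hlim2 := tendsto_lintegral_inner_sub hΦm hDm hm2 hd2 hΦ.tendsto (hΦ.tendsto_partial i)
  have hint : Integrable (fun x => inner ℝ (m x) (weakPartial Ω i m x)) (volume.restrict Ω) :=
    (hm2.norm.integrable_mul hd2.norm).mono' (hm2.1.inner hd2.1)
      (Eventually.of_forall fun x => norm_inner_le_norm _ _)
  have hzero : ∀ φ : Space (n + 1) → ℝ, ContDiff ℝ ∞ φ → HasCompactSupport φ → tsupport φ ⊆ Ω →
      ∫ x, φ x • inner ℝ (m x) (weakPartial Ω i m x) ∂(volume.restrict Ω) = 0 :=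
    fun φ hφ hφc hφΩ => by
      have hφt : IsTestFunction Ω φ := ⟨hφ, hφc, hφΩ⟩
      obtain ⟨M₁, hM₁⟩ := hφc.exists_bound_of_continuous hφ.continuous
      have hφ' := continuous_partial hφ (basisVec i)
      have hφc' : HasCompactSupport fun x => fderiv ℝ φ x (basisVec i) :=
        hφc.fderiv_apply (𝕜 := ℝ) _
      obtain ⟨M₂, hM₂⟩ := hφc'.exists_bound_of_continuous hφ'
      have hψt : ∀ k, IsTestFunction Ω fun x => φ x * ‖Φ k x‖ ^ 2 := fun k =>
        ⟨hφ.mul ((hΦ.contDiff k).norm_sq ℝ), hφc.mul_right, (tsupport_mul_subset_left).trans hφΩ⟩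
      have hfd : ∀ k x, fderiv ℝ (fun x => φ x * ‖Φ k x‖ ^ 2) x (basisVec i) =
          2 * (φ x * inner ℝ (Φ k x) (fderiv ℝ (Φ k) x (basisVec i))) +
            fderiv ℝ φ x (basisVec i) * inner ℝ (Φ k x) (Φ k x) := fun k x => by
        have h1 := ((hφ.differentiable (by simp)) x).hasFDerivAt
        have h2 := (((hΦ.contDiff k).differentiable (by simp)) x).hasFDerivAt
        have h3 : fderiv ℝ (fun x => φ x * ‖Φ k x‖ ^ 2) x = _ := (h1.mul h2.norm_sq).fderiv
        rw [h3, real_inner_self_eq_norm_sq]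
        simp
        ring
      have hF : Integrable (fun x => 2 * (φ x * inner ℝ (m x) (weakPartial Ω i m x)) +
          fderiv ℝ φ x (basisVec i) * inner ℝ (m x) (m x)) (volume.restrict Ω) := by
        have hint' : Integrable (fun x => inner ℝ (m x) (m x)) (volume.restrict Ω) :=
          (hm2.norm.integrable_mul hm2.norm).mono' (hm2.1.inner hm2.1)
            (Eventually.of_forall fun x => norm_inner_le_norm _ _)
        exact ((hint.bdd_mul hφ.continuous.aestronglyMeasurable
          (Eventually.of_forall hM₁)).const_mul 2).add
          (hint'.bdd_mul hφ'.aestronglyMeasurable (Eventually.of_forall hM₂))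
      have hconv := tendsto_integral_of_L1 _ hF.1 (F := fun k x =>
        fderiv ℝ (fun x => φ x * ‖Φ k x‖ ^ 2) x (basisVec i)) (l := atTop)
        (Eventually.of_forall fun k => ((continuous_partial (hψt k).contDiff
          (basisVec i)).integrable_of_hasCompactSupport
            ((hψt k).hasCompactSupport.fderiv_apply (𝕜 := ℝ) _)).restrict) ?_
      · simp only [fun k => integral_fderiv_eq_zero (hψt k) (basisVec i)] at hconv
        have h0 := tendsto_nhds_unique tendsto_const_nhds hconv
        have h1 : ∫ x in Ω, (2 * (φ x * inner ℝ (m x) (weakPartial Ω i m x)) +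
            fderiv ℝ φ x (basisVec i) * inner ℝ (m x) (m x)) =
            ∫ x in Ω, (2 * (φ x * inner ℝ (m x) (weakPartial Ω i m x)) +
              fderiv ℝ φ x (basisVec i)) := by
          refine integral_congr_ae ?_
          filter_upwards [hm.norm_eq_one] with x hx
          rw [real_inner_self_eq_norm_sq, hx, one_pow, mul_one]
        rw [h1, integral_add ((hint.bdd_mul hφ.continuous.aestronglyMeasurable
          (Eventually.of_forall hM₁)).const_mul 2)
          (hφ'.integrable_of_hasCompactSupport hφc').restrict, integral_fderiv_eq_zero hφt,
          integral_const_mul] at h0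
        simp only [smul_eq_mul]
        linarith
      · have hz : Tendsto (fun k => 2 * ENNReal.ofReal M₁ *
            (∫⁻ x in Ω, ‖inner ℝ (Φ k x) (fderiv ℝ (Φ k) x (basisVec i)) -
              inner ℝ (m x) (weakPartial Ω i m x)‖ₑ) + ENNReal.ofReal M₂ *
            ∫⁻ x in Ω, ‖inner ℝ (Φ k x) (Φ k x) - inner ℝ (m x) (m x)‖ₑ) atTop (𝓝 0) := by
          have := (ENNReal.Tendsto.const_mul (a := 2 * ENNReal.ofReal M₁) hlim2
            (Or.inr (by simp [ENNReal.mul_eq_top]))).add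
            (ENNReal.Tendsto.const_mul (a := ENNReal.ofReal M₂) hlim1 (Or.inr (by simp)))
          simpa using this
        refine tendsto_of_tendsto_of_tendsto_of_le_of_le tendsto_const_nhds hz (fun _ => zero_le)
          fun k => ?_
        dsimp only
        rw [← lintegral_const_mul' _ _ (by simp [ENNReal.mul_eq_top]),
          ← lintegral_const_mul' _ _ (by simp), ← lintegral_add_left' (by
            exact (((hΦm k).inner (hDm k)).sub (hm2.1.inner hd2.1)).enorm.const_mul _)]
        refine lintegral_mono fun x => ?_
        dsimp only
        have h1 : ‖φ x‖ₑ ≤ ENNReal.ofReal M₁ := by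
          rw [← ofReal_norm]; exact ENNReal.ofReal_le_ofReal (hM₁ x)
        have h2 : ‖fderiv ℝ φ x (basisVec i)‖ₑ ≤ ENNReal.ofReal M₂ := by
          rw [← ofReal_norm]; exact ENNReal.ofReal_le_ofReal (hM₂ x)
        rw [hfd k x]
        set a := inner ℝ (Φ k x) (fderiv ℝ (Φ k) x (basisVec i))
        set b := inner ℝ (m x) (weakPartial Ω i m x)
        set p := inner ℝ (Φ k x) (Φ k x)
        set q := inner ℝ (m x) (m x)
        set d := fderiv ℝ φ x (basisVec i)
        have h3 : 2 * (φ x * a) + d * p - (2 * (φ x * b) + d * q) =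
            2 * φ x * (a - b) + d * (p - q) := by ring
        have h4 : ‖(2 : ℝ)‖ₑ = 2 := by
          rw [← ofReal_norm]; simp
        rw [h3]
        refine (enorm_add_le _ _).trans ?_
        rw [enorm_mul, enorm_mul, enorm_mul, h4]
        gcongr
  have h1 := hΩ.isOpen.ae_eq_zero_of_integral_contDiff_smul_eq_zero
    (hint.locallyIntegrable.locallyIntegrableOn Ω) hzero
  filter_upwards [h1, ae_restrict_mem hΩ.isOpen.measurableSet] with x hx1 hx2
  exact hx1 hx2

end Inequalities

/-! ### Traces of sphere-valued maps -/

section Sphere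

variable {n : ℕ} {Ω : Set (Space (n + 1))}

/-- The trace of a map with values in the sphere has at least unit length, in the mean. It is
obtained as the limit of smooth maps `Φ`; the `L¹` trace inequality applies to the scalar function
`1 - ‖Φ‖²`, which converges to zero in `W^{1,1}`. -/
lemma MemH1Sphere.surfaceMeasure_univ_le (hΩ : IsSmoothBoundedDomain Ω)
    {m g : Space (n + 1) → Vec3} (hm : MemH1Sphere Ω m) (hg : IsTrace Ω m g) :
    surfaceMeasure Ω Set.univ ≤ ∫⁻ x, ‖g x‖ₑ ^ 2 ∂(surfaceMeasure Ω) := by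
  obtain ⟨hg2, Φ, hΦ, hlim⟩ := hg
  obtain ⟨C, hC, htr⟩ := hΩ.exists_trace_ineq
  have hm2 := hm.memH1.memLp
  have hΦm : ∀ (μ : Measure (Space (n + 1))) k, AEStronglyMeasurable (Φ k) μ := fun μ k =>
    (hΦ.contDiff k).continuous.aestronglyMeasurable
  have hlim1 := tendsto_lintegral_inner_sub (hΦm _) (hΦm _) hm2 hm2 hΦ.tendsto hΦ.tendsto
  have hlim2 := fun i => tendsto_lintegral_inner_sub (hΦm _)
    (fun k => (continuous_fderiv_basisVec (hΦ.contDiff k) i).aestronglyMeasurable) hm2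
    (hm.memH1.isWeakPartial i).1 hΦ.tendsto (hΦ.tendsto_partial i)
  have hlim3 := tendsto_lintegral_enorm_sq (hΦm _) hg2 hlim
  have hrhs := hlim3.add (ENNReal.Tendsto.const_mul (a := C) (hlim1.add
    (tendsto_finsetSum Finset.univ fun i _ =>
      ENNReal.Tendsto.const_mul (a := 2) (hlim2 i) (Or.inr (by simp)))) (Or.inr hC))
  simp only [mul_zero, Finset.sum_const_zero, add_zero] at hrhs
  refine ge_of_tendsto' hrhs fun k => ?_
  have hcd : ContDiff ℝ 1 (Φ k) := (hΦ.contDiff k).of_le (by simp)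
  have hψ : ContDiff ℝ 1 fun x => 1 - ‖Φ k x‖ ^ 2 := contDiff_const.sub (hcd.norm_sq ℝ)
  have hm1 : Measurable fun x => ‖Φ k x‖ₑ ^ 2 := hcd.continuous.measurable.enorm.pow_const 2
  calc surfaceMeasure Ω Set.univ = ∫⁻ _, 1 ∂(surfaceMeasure Ω) := by simp
    _ ≤ ∫⁻ x, (‖Φ k x‖ₑ ^ 2 + ‖1 - ‖Φ k x‖ ^ 2‖ₑ) ∂(surfaceMeasure Ω) := by
        refine lintegral_mono fun x => ?_
        have h1 := enorm_add_le (‖Φ k x‖ ^ 2) (1 - ‖Φ k x‖ ^ 2)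
        rw [enorm_norm_sq, add_sub_cancel] at h1
        simpa using h1
    _ = (∫⁻ x, ‖Φ k x‖ₑ ^ 2 ∂(surfaceMeasure Ω)) +
          ∫⁻ x, ‖1 - ‖Φ k x‖ ^ 2‖ₑ ∂(surfaceMeasure Ω) := lintegral_add_left hm1 _
    _ ≤ _ := add_le_add le_rfl ((htr _ hψ).trans (mul_le_mul_right ?_ C))
  have hin : ∀ i, AEMeasurable (fun x => 2 * ‖inner ℝ (Φ k x) (fderiv ℝ (Φ k) x (basisVec i)) -
      inner ℝ (m x) (weakPartial Ω i m x)‖ₑ) (volume.restrict Ω) := fun i =>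
    (((hΦm _ k).inner (continuous_fderiv_basisVec (hΦ.contDiff k) i).aestronglyMeasurable).sub
      (hm2.1.inner (hm.memH1.isWeakPartial i).1.1)).enorm.const_mul _
  calc ∫⁻ x in Ω, (‖1 - ‖Φ k x‖ ^ 2‖ₑ + ‖fderiv ℝ (fun x => 1 - ‖Φ k x‖ ^ 2) x‖ₑ)
      ≤ ∫⁻ x in Ω, (‖inner ℝ (Φ k x) (Φ k x) - inner ℝ (m x) (m x)‖ₑ +
          ∑ i, 2 * ‖inner ℝ (Φ k x) (fderiv ℝ (Φ k) x (basisVec i)) -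
            inner ℝ (m x) (weakPartial Ω i m x)‖ₑ) := by
        refine lintegral_mono_ae ?_
        filter_upwards [hm.norm_eq_one, eventually_all.2 fun i => hm.inner_weakPartial hΩ i]
          with x hx hx'
        refine add_le_add (le_of_eq ?_) ((enorm_le_sum_enorm _).trans
          (Finset.sum_le_sum fun i _ => le_of_eq ?_))
        · rw [real_inner_self_eq_norm_sq, real_inner_self_eq_norm_sq, hx, one_pow, ← enorm_neg,
            neg_sub]
        · have h1 := (hcd.differentiable one_ne_zero x).hasFDerivAt
          have h2 : fderiv ℝ (fun x => 1 - ‖Φ k x‖ ^ 2) x = _ := (h1.norm_sq.const_sub 1).fderiv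
          have h3 : fderiv ℝ (fun x => 1 - ‖Φ k x‖ ^ 2) x (basisVec i) =
              -(2 * inner ℝ (Φ k x) (fderiv ℝ (Φ k) x (basisVec i))) := by
            rw [h2]; simp
          have h4 : ‖(2 : ℝ)‖ₑ = 2 := by
            rw [← ofReal_norm]; simp
          rw [h3, hx' i, sub_zero, enorm_neg, enorm_mul, h4]
    _ = _ := by
        rw [lintegral_add_left' (f := fun x => ‖inner ℝ (Φ k x) (Φ k x) - inner ℝ (m x) (m x)‖ₑ) (((hΦm _ k).inner (hΦm _ k)).sub (hm2.1.inner hm2.1)).enorm,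
          lintegral_finsetSum' _ fun i _ => hin i]
        congr 1
        exact Finset.sum_congr rfl fun i _ => lintegral_const_mul' _ _ (by simp)

end Sphere

/-! ### The energy -/

section Energy

variable {n : ℕ} {Ω : Set (Space (n + 1))}

/-- The part `∫_Ω (m · e₃)²` of the energy. -/
noncomputable def verticalEnergy {N : ℕ} (Ω : Set (Space N)) (m : Space N → Vec3) : ℝ≥0∞ :=
  ∫⁻ x in Ω, ENNReal.ofReal ((inner ℝ (m x) e3) ^ 2)

lemma lintegral_vertical_eq {N : ℕ} (Ω : Set (Space N)) (m : Space N → Vec3) :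
    ∫⁻ x in Ω, ‖vertical (m x)‖ₑ ^ 2 = verticalEnergy Ω m :=
  lintegral_congr fun x => enorm_vertical_sq (m x)

/-- The energy without the bulk anisotropy term is obtained for `κ = 0`. -/
lemma energy_eq (κ γ : ℝ) {N : ℕ} (Ω : Set (Space N)) (m : Space N → Vec3) :
    energy Ω κ γ m = energy Ω 0 γ m + ENNReal.ofReal (κ ^ 2) * verticalEnergy Ω m := by
  unfold energy bulkEnergy verticalEnergy
  split_ifs
  · simp
  · simp
  · simp only [ne_eq, OfNat.ofNat_ne_zero, not_false_eq_true, zero_pow, ENNReal.ofReal_zero,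
      zero_mul, add_zero]
    ring

lemma dirichlet_le_energy (γ : ℝ) {N : ℕ} (Ω : Set (Space N)) (m : Space N → Vec3) :
    dirichlet Ω m ≤ energy Ω 0 γ m := by
  unfold energy bulkEnergy dirichlet
  split_ifs <;> simp

/-- For maps with values in the sphere, the horizontal and the vertical components share the
volume of the domain. -/
lemma MemH1Sphere.lintegral_cross_add {m : Space (n + 1) → Vec3} (hm : MemH1Sphere Ω m) :
    (∫⁻ x in Ω, ‖cross (m x) e3‖ₑ ^ 2) + verticalEnergy Ω m = volume Ω := by
  have h1 : AEMeasurable (fun x => ‖cross (m x) e3‖ₑ ^ 2) (volume.restrict Ω) :=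
    (crossE3.continuous.comp_aestronglyMeasurable hm.memH1.memLp.1).enorm.pow_const 2
  rw [← lintegral_vertical_eq, ← lintegral_add_left' h1]
  calc _ = ∫⁻ x in Ω, 1 := by
        refine lintegral_congr_ae ?_
        filter_upwards [hm.norm_eq_one] with x hx
        rw [enorm_cross_sq_add, ← ofReal_norm, hx]
        simp
    _ = _ := by simp

lemma MemH1Sphere.of_isConstOn (hΩ : IsSmoothBoundedDomain Ω) {m : Space (n + 1) → Vec3} {c : Vec3}
    (hc : ‖c‖ = 1) (h : IsConstOn Ω m c) : MemH1Sphere Ω m := by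
  have := hΩ.isFiniteMeasure_restrict
  exact ⟨memH1_of_isConstOn h, by filter_upwards [h] with x hx; rw [hx, hc]⟩

lemma dirichlet_of_isConstOn (hΩ : IsSmoothBoundedDomain Ω) {m : Space (n + 1) → Vec3} {c : Vec3}
    (h : IsConstOn Ω m c) : dirichlet Ω m = 0 := by
  have := hΩ.isFiniteMeasure_restrict
  have h1 := eventually_all.2 fun i => weakPartial_of_isConstOn hΩ.isOpen h i
  refine (lintegral_congr_ae (g := fun _ => 0) ?_).trans (by simp)
  filter_upwards [h1] with x hx
  simp [hx]

lemma verticalEnergy_of_isConstOn {m : Space (n + 1) → Vec3} {c : Vec3}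
    (h : IsConstOn Ω m c) :
    verticalEnergy Ω m = ENNReal.ofReal ((inner ℝ c e3) ^ 2) * volume Ω := by
  refine (lintegral_congr_ae (g := fun _ => ENNReal.ofReal ((inner ℝ c e3) ^ 2)) ?_).trans (by simp)
  filter_upwards [h] with x hx
  rw [hx]

lemma boundaryEnergy_of_isConstOn (hΩ : IsSmoothBoundedDomain Ω) {m : Space (n + 1) → Vec3}
    {c : Vec3} (h : IsConstOn Ω m c) :
    boundaryEnergy Ω m = ‖cross c e3‖ₑ ^ 2 * surfaceMeasure Ω Set.univ := by
  have := hΩ.isFiniteMeasure_restrict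
  have h1 := ((memH1_of_isConstOn h).isTrace hΩ).ae_eq_of_isConstOn hΩ h
  refine (lintegral_congr_ae (g := fun _ => ‖cross c e3‖ₑ ^ 2) ?_).trans (by simp)
  filter_upwards [h1] with x hx
  rw [hx]

/-- A Sobolev map with vanishing Dirichlet energy is constant. -/
lemma MemH1Sphere.exists_isConstOn (hΩ : IsSmoothBoundedDomain Ω) {m : Space (n + 1) → Vec3}
    (hm : MemH1Sphere Ω m) (h : dirichlet Ω m = 0) : ∃ c : Vec3, ‖c‖ = 1 ∧ IsConstOn Ω m c := by
  have := hΩ.isFiniteMeasure_restrict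
  obtain ⟨c, hc⟩ := exists_isConstOn_of_weakPartial_eq_zero hΩ.isOpen hΩ.isConnected
    hm.memH1.memLp fun i => (hm.memH1.isWeakPartial i).congr_partial
      (weakPartial_eq_zero_of_dirichlet hm.memH1 h i)
  refine ⟨c, ?_, hc⟩
  have : (ae (volume.restrict Ω)).NeBot := by
    rw [ae_neBot, Ne, Measure.restrict_eq_zero]
    exact (hΩ.isOpen.measure_pos volume hΩ.isConnected.nonempty).ne'
  obtain ⟨x, hx, hx'⟩ := (hc.and hm.norm_eq_one).exists
  rw [← hx']
  exact congrArg norm hx.symm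

end Energy

/-! ### Global minimizers -/

section Minimizers

variable {n : ℕ} {Ω : Set (Space (n + 1))}

lemma dirichlet_add_const (hΩ : IsSmoothBoundedDomain Ω) {u : Space (n + 1) → Vec3}
    (hu : MemH1 Ω u) (c : Vec3) (h : MemH1 Ω fun x => u x + c) :
    dirichlet Ω (fun x => u x + c) = dirichlet Ω u := by
  have := hΩ.isFiniteMeasure_restrict
  exact dirichlet_congr fun i =>
    (h.isWeakPartial i).ae_eq hΩ.isOpen ((hu.isWeakPartial i).add_const hu.memLp c)

lemma cross_e3_self : cross e3 e3 = 0 := by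
  rw [cross_e3]
  ext i
  fin_cases i <;> simp [e3]

lemma cross_add_e3 {v c : Vec3} (hc : cross c e3 = 0) : cross (v + c) e3 = cross v e3 := by
  rw [← crossE3_apply, map_add, crossE3_apply, crossE3_apply, hc, add_zero]

lemma cross_neg_e3 : cross (-e3) e3 = 0 := by
  rw [← crossE3_apply, map_neg, crossE3_apply, cross_e3_self, neg_zero]

/-- The coercivity estimate: the energy without bulk anisotropy controls the horizontal
component. It follows from the Friedrichs inequality for `m × e₃`, respectively for `m ± e₃` if
the boundary values are prescribed. -/
lemma IsSmoothBoundedDomain.exists_lintegral_cross_le (hΩ : IsSmoothBoundedDomain Ω) {γ : ℝ}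
    (hγ : 0 ≤ γ) : ∃ C : ℝ≥0∞, C ≠ ⊤ ∧ ∀ m : Space (n + 1) → Vec3, MemH1Sphere Ω m →
      ∫⁻ x in Ω, ‖cross (m x) e3‖ₑ ^ 2 ≤ C * energy Ω 0 γ m := by
  obtain ⟨C, hC, h⟩ := hΩ.exists_friedrichs
  have hcross := h crossE3 norm_cross_e3_le
  rcases hγ.eq_or_lt with rfl | hγ
  · refine ⟨C + 1, by simp [hC], fun m hm => ?_⟩
    have key : ∀ c : Vec3, cross c e3 = 0 → MemH10 Ω (fun x => m x + c) →
        ∫⁻ x in Ω, ‖cross (m x) e3‖ₑ ^ 2 ≤ (C + 1) * energy Ω 0 0 m := fun c hc hmc => by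
      have h1 := hcross _ _ hmc.1 (hmc.isTrace_zero hΩ)
      simp only [crossE3_apply, cross_add_e3 hc, dirichlet_add_const hΩ hm.memH1 c hmc.1] at h1
      have h2 : ∫⁻ x, ‖cross ((0 : Space (n + 1) → Vec3) x) e3‖ₑ ^ 2 ∂(surfaceMeasure Ω) = 0 := by
        simp [← crossE3_apply]
      rw [h2, add_zero] at h1
      exact h1.trans (mul_le_mul' le_self_add (dirichlet_le_energy 0 Ω m))
    by_cases h1 : MemH10 Ω (fun x => m x + e3)
    · exact key e3 cross_e3_self h1
    by_cases h2 : MemH10 Ω (fun x => m x - e3)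
    · exact key (-e3) cross_neg_e3 (by simpa only [sub_eq_add_neg] using h2)
    have h3 : energy Ω 0 0 m = ⊤ := by
      rw [energy, if_pos rfl, if_neg (by tauto)]
    rw [h3, ENNReal.mul_top (by simp)]
    exact le_top
  · refine ⟨C * (1 + ENNReal.ofReal (γ ^ 2)), ENNReal.mul_ne_top hC (by simp), fun m hm => ?_⟩
    refine (hcross _ _ hm.memH1 (hm.memH1.isTrace hΩ)).trans ?_
    rw [mul_assoc]
    refine mul_le_mul_right ?_ C
    rw [add_mul, one_mul]
    refine add_le_add (dirichlet_le_energy γ Ω m) ?_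
    have h1 : ENNReal.ofReal (γ ^ 2) * ENNReal.ofReal (1 / γ ^ 2) = 1 := by
      rw [← ENNReal.ofReal_mul (sq_nonneg _), mul_one_div_cancel (by positivity),
        ENNReal.ofReal_one]
    calc _ = ENNReal.ofReal (γ ^ 2) * (ENNReal.ofReal (1 / γ ^ 2) * boundaryEnergy Ω m) := by
          rw [← mul_assoc, h1, one_mul]; rfl
      _ ≤ _ := by
          rw [energy, if_neg hγ.ne']
          exact mul_le_mul_right le_add_self _

lemma memH10_of_isConstOn_zero (hΩ : IsSmoothBoundedDomain Ω) {u : Space (n + 1) → Vec3}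
    (h : IsConstOn Ω u 0) : MemH10 Ω u := by
  have := hΩ.isFiniteMeasure_restrict
  refine ⟨memH1_of_isConstOn h, fun _ _ => 0, ⟨fun _ => contDiff_const, ?_, fun i => ?_⟩,
    fun _ => ⟨HasCompactSupport.zero, by simp⟩⟩
  · have h1 : eLpNorm (fun x => (0 : Vec3) - u x) 2 (volume.restrict Ω) = 0 := by
      rw [← eLpNorm_zero (μ := volume.restrict Ω) (p := 2) (ε := Vec3)]
      refine eLpNorm_congr_ae ?_
      filter_upwards [h] with x hx
      simp [hx]
    simp only [h1]
    exact tendsto_const_nhds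
  · have h1 : eLpNorm (fun x => fderiv ℝ (fun _ : Space (n + 1) => (0 : Vec3)) x (basisVec i) -
        weakPartial Ω i u x) 2 (volume.restrict Ω) = 0 := by
      rw [← eLpNorm_zero (μ := volume.restrict Ω) (p := 2) (ε := Vec3)]
      refine eLpNorm_congr_ae ?_
      filter_upwards [weakPartial_of_isConstOn hΩ.isOpen h i] with x hx
      simp [hx]
    simp only [h1]
    exact tendsto_const_nhds

/-- The maps `e₃` and `-e₃` have no Dirichlet energy and no boundary energy. -/
lemma energy_zero_of_isConstOn (hΩ : IsSmoothBoundedDomain Ω) (γ : ℝ)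
    {m : Space (n + 1) → Vec3} (h : IsConstOn Ω m e3 ∨ IsConstOn Ω m (-e3)) :
    energy Ω 0 γ m = 0 := by
  obtain ⟨c, hc, hm⟩ : ∃ c, cross c e3 = 0 ∧ IsConstOn Ω m c :=
    h.elim (fun h => ⟨_, cross_e3_self, h⟩) fun h => ⟨_, cross_neg_e3, h⟩
  have hbulk : bulkEnergy Ω 0 m = 0 := by
    have : bulkEnergy Ω 0 m = dirichlet Ω m := by simp [bulkEnergy, dirichlet]
    rw [this, dirichlet_of_isConstOn hΩ hm]
  rw [energy, hbulk]
  split_ifs with h1 h2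
  · rfl
  · refine absurd ?_ h2
    rcases h with h | h
    · right
      refine memH10_of_isConstOn_zero hΩ ?_
      filter_upwards [h] with x hx
      simp [hx]
    · left
      refine memH10_of_isConstOn_zero hΩ ?_
      filter_upwards [h] with x hx
      simp [hx]
  · rw [boundaryEnergy_of_isConstOn hΩ hm, hc]
    simp

/-- For small `κ` the constant maps `±e₃` are the minimizers: relative to them, a competitor gains
`κ²` times its horizontal part in the anisotropy term, and the coercivity estimate bounds this by
`κ² C` times the other terms of its energy. -/
lemma IsSmoothBoundedDomain.isGlobalMinimizer_iff_vertical (hΩ : IsSmoothBoundedDomain Ω) {γ : ℝ}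
    (hγ : 0 ≤ γ) : ∃ κγ : ℝ, 0 < κγ ∧ ∀ κ : ℝ, 0 ≤ κ → κ < κγ → ∀ m : Space (n + 1) → Vec3,
      IsGlobalMinimizer Ω κ γ m ↔ (IsConstOn Ω m e3 ∨ IsConstOn Ω m (-e3)) := by
  obtain ⟨C, hC, hcoer⟩ := hΩ.exists_lintegral_cross_le hγ
  lift C to NNReal using hC
  refine ⟨1 / (C + 1), by positivity, fun κ hκ hκγ m => ?_⟩
  have hsmall : ENNReal.ofReal (κ ^ 2) * C < 1 := by
    rw [← ENNReal.ofReal_coe_nnreal, ← ENNReal.ofReal_mul (sq_nonneg _), ENNReal.ofReal_lt_one]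
    rw [lt_div_iff₀ (by positivity)] at hκγ
    have hC0 : (0 : ℝ) ≤ C := C.2
    have h1 : κ < 1 := by nlinarith
    nlinarith [mul_nonneg hκ hC0, mul_nonneg (mul_nonneg hκ hC0) (sub_nonneg.2 h1.le)]
  have hsphere : ∀ {m : Space (n + 1) → Vec3}, (IsConstOn Ω m e3 ∨ IsConstOn Ω m (-e3)) →
      MemH1Sphere Ω m := fun h => h.elim (MemH1Sphere.of_isConstOn hΩ norm_e3)
        (MemH1Sphere.of_isConstOn hΩ (by rw [norm_neg, norm_e3]))
  have hvol : volume Ω ≠ ⊤ := hΩ.isBounded.measure_lt_top.ne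
  have henergy : ∀ {m : Space (n + 1) → Vec3}, (IsConstOn Ω m e3 ∨ IsConstOn Ω m (-e3)) →
      energy Ω κ γ m = ENNReal.ofReal (κ ^ 2) * volume Ω := fun {m} h => by
    have h1 : verticalEnergy Ω m = volume Ω := by
      rcases h with h | h <;>
        simp [verticalEnergy_of_isConstOn h, norm_e3]
    rw [energy_eq, energy_zero_of_isConstOn hΩ γ h, h1, zero_add]
  have hsplit : ∀ {m : Space (n + 1) → Vec3}, MemH1Sphere Ω m →
      ENNReal.ofReal (κ ^ 2) * volume Ω ≤ ENNReal.ofReal (κ ^ 2) * C * energy Ω 0 γ m +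
        ENNReal.ofReal (κ ^ 2) * verticalEnergy Ω m := fun hm => by
    rw [← hm.lintegral_cross_add, mul_add, mul_assoc]
    exact add_le_add (mul_le_mul_right (hcoer _ hm) _) le_rfl
  constructor
  · rintro ⟨hm, hmin⟩
    have h1 := (hmin _ (hsphere (m := fun _ => e3) (Or.inl ae_eq_rfl))).trans_eq
      (henergy (Or.inl ae_eq_rfl))
    have h2 := h1.trans (hsplit hm)
    have hD : energy Ω κ γ m ≠ ⊤ := ne_top_of_le_ne_top (ENNReal.mul_ne_top (by simp) hvol) h1
    rw [energy_eq] at h2 hD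
    have h3 := (ENNReal.add_le_add_iff_right (ENNReal.add_ne_top.1 hD).2).1 h2
    have hD0 : energy Ω 0 γ m = 0 := by
      by_contra hne
      have h4 := ENNReal.mul_lt_mul_left hne (ENNReal.add_ne_top.1 hD).1 hsmall
      rw [one_mul] at h4
      exact absurd h3 (not_le.2 h4)
    obtain ⟨c, hc1, hc⟩ := hm.exists_isConstOn hΩ
      (le_antisymm ((dirichlet_le_energy γ Ω m).trans_eq hD0) zero_le)
    have h5 := hcoer _ hm
    have h6 : ∫⁻ x in Ω, ‖cross (m x) e3‖ₑ ^ 2 = ‖cross c e3‖ₑ ^ 2 * volume Ω := by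
      refine (lintegral_congr_ae (g := fun _ => ‖cross c e3‖ₑ ^ 2) ?_).trans (by simp)
      filter_upwards [hc] with x hx
      rw [hx]
    rw [h6, hD0, mul_zero, nonpos_iff_eq_zero, mul_eq_zero] at h5
    have h7 : cross c e3 = 0 := by
      simpa using h5.resolve_right (hΩ.isOpen.measure_pos volume hΩ.isConnected.nonempty).ne'
    rcases eq_e3_or_eq_neg_e3 hc1 h7 with rfl | rfl
    · exact Or.inl hc
    · exact Or.inr hc
  · refine fun h => ⟨hsphere h, fun m' hm' => ?_⟩
    rw [henergy h, energy_eq κ γ Ω m']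
    refine (hsplit hm').trans (add_le_add ?_ le_rfl)
    calc _ ≤ 1 * energy Ω 0 γ m' := mul_le_mul_left hsmall.le _
      _ = _ := one_mul _

/-- The lower bound on the energy for weak penalization: the boundary term can only be lowered
by a vertical component on the boundary, which is controlled by the bulk energy. -/
lemma IsSmoothBoundedDomain.exists_surfaceMeasure_le (hΩ : IsSmoothBoundedDomain Ω) :
    ∃ C : ℝ≥0∞, C ≠ ⊤ ∧ ∀ m : Space (n + 1) → Vec3, MemH1Sphere Ω m →
      surfaceMeasure Ω Set.univ ≤ boundaryEnergy Ω m +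
        C * (verticalEnergy Ω m + dirichlet Ω m) := by
  obtain ⟨C, hC, h⟩ := hΩ.exists_trace_le
  refine ⟨C, hC, fun m hm => ?_⟩
  have htr := hm.memH1.isTrace hΩ
  refine (hm.surfaceMeasure_univ_le hΩ htr).trans ?_
  have hmeas : AEMeasurable (fun x => ‖cross (trace Ω m x) e3‖ₑ ^ 2) (surfaceMeasure Ω) :=
    (crossE3.continuous.comp_aestronglyMeasurable htr.1.1).enorm.pow_const 2
  rw [lintegral_congr fun x => (enorm_cross_sq_add (trace Ω m x)).symm,
    lintegral_add_left' hmeas, ← lintegral_vertical_eq]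
  exact add_le_add le_rfl (h vertical norm_vertical_le _ _ hm.memH1 htr)

/-- For large `γ` the horizontal constants are the minimizers: relative to them, a competitor gains
in the boundary term at most `C / γ²` times its vertical and Dirichlet energies, and `C / γ²` is
smaller than the coefficients `κ²` and `1` of these two in the energy. -/
lemma IsSmoothBoundedDomain.isGlobalMinimizer_iff_horizontal (hΩ : IsSmoothBoundedDomain Ω) {κ : ℝ}
    (hκ : 0 < κ) : ∃ γκ : ℝ, 0 < γκ ∧ ∀ γ : ℝ, γκ < γ → ∀ m : Space (n + 1) → Vec3,
      IsGlobalMinimizer Ω κ γ m ↔ ∃ e : Vec3, ‖e‖ = 1 ∧ inner ℝ e e3 = 0 ∧ IsConstOn Ω m e := by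
  obtain ⟨C, hC, hbd⟩ := hΩ.exists_surfaceMeasure_le
  lift C to NNReal using hC
  have hγ0 : 0 < (C + 1) * (1 + 1 / κ) := by positivity
  refine ⟨(C + 1) * (1 + 1 / κ), hγ0, fun γ hγ m => ?_⟩
  have hγpos : 0 < γ := hγ0.trans hγ
  set s : ℝ := 1 / γ ^ 2 * C with hs
  have hs0 : 0 ≤ s := by positivity
  have hC0 : (0 : ℝ) ≤ C := C.2
  -- the threshold is chosen so that `C / γ²` is below both coefficients `1` and `κ²`
  have hs1 : s < 1 := by
    rw [hs, one_div_mul_eq_div, div_lt_one (by positivity)]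
    have h1 : (C : ℝ) + 1 < γ := lt_of_le_of_lt
      (le_mul_of_one_le_right (by positivity) (by simp [hκ.le])) hγ
    nlinarith
  have hs2 : s < κ ^ 2 := by
    rw [hs, one_div_mul_eq_div, div_lt_iff₀ (by positivity), ← mul_pow]
    have h1 : (C : ℝ) + 1 < κ * γ := by
      have h2 := mul_lt_mul_of_pos_left hγ hκ
      have h3 : κ * ((C + 1) * (1 + 1 / κ)) = (C + 1) * (κ + 1) := by field_simp
      nlinarith
    nlinarith
  set t := ENNReal.ofReal (1 / γ ^ 2) with ht
  have htC : t * C = ENNReal.ofReal s := by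
    rw [ht, hs, ENNReal.ofReal_mul (by positivity), ENNReal.ofReal_coe_nnreal]
  have hen : ∀ m : Space (n + 1) → Vec3, energy Ω κ γ m =
      t * boundaryEnergy Ω m + (ENNReal.ofReal (κ ^ 2) * verticalEnergy Ω m + dirichlet Ω m) :=
    fun m => by
      rw [energy, if_neg hγpos.ne', bulkEnergy, verticalEnergy, dirichlet]
      ring
  have hlow : ∀ {m : Space (n + 1) → Vec3}, MemH1Sphere Ω m → t * surfaceMeasure Ω Set.univ ≤
      t * boundaryEnergy Ω m + ENNReal.ofReal s * (verticalEnergy Ω m + dirichlet Ω m) :=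
    fun hm => by
      refine (mul_le_mul_right (hbd _ hm) t).trans_eq ?_
      rw [mul_add, ← mul_assoc, htC]
  have hconst : ∀ {m : Space (n + 1) → Vec3} {e : Vec3}, ‖e‖ = 1 → inner ℝ e e3 = 0 →
      IsConstOn Ω m e → energy Ω κ γ m = t * surfaceMeasure Ω Set.univ := fun {m e} h1 h2 h3 => by
    have h4 : ‖cross e e3‖ₑ ^ 2 = 1 := by
      rw [enorm_sq_eq_ofReal, eq_sub_of_add_eq (norm_cross_sq_add e), h1, h2]
      simp
    rw [hen, verticalEnergy_of_isConstOn h3, dirichlet_of_isConstOn hΩ h3,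
      boundaryEnergy_of_isConstOn hΩ h3, h2, h4]
    simp
  constructor
  · rintro ⟨hm, hmin⟩
    have hv : ‖(!₂[1, 0, 0] : Vec3)‖ = 1 := by simp [EuclideanSpace.norm_eq, Fin.sum_univ_three]
    have hv' : inner ℝ (!₂[1, 0, 0] : Vec3) e3 = 0 := by rw [inner_e3]; simp
    have h1 := (hmin _ (MemH1Sphere.of_isConstOn hΩ (m := fun _ => !₂[1, 0, 0]) hv
      ae_eq_rfl)).trans_eq (hconst hv hv' ae_eq_rfl)
    have h2 := h1.trans (hlow hm)
    have hfin := isFiniteMeasure_surfaceMeasure hΩ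
    have hE : energy Ω κ γ m ≠ ⊤ :=
      ne_top_of_le_ne_top (ENNReal.mul_ne_top (by simp [ht]) (measure_ne_top _ _)) h1
    rw [hen] at h2 hE
    have h3 := (ENNReal.add_le_add_iff_left (ENNReal.add_ne_top.1 hE).1).1 h2
    have hV : verticalEnergy Ω m ≠ ⊤ := by
      refine ne_top_of_le_ne_top (b := volume Ω) hΩ.isBounded.measure_lt_top.ne ?_
      rw [← hm.lintegral_cross_add]
      exact le_add_self
    have hA := (dirichlet_lt_top hm.memH1).ne
    have h4 := ENNReal.toReal_mono (ENNReal.mul_ne_top (by simp) (by simp [hV, hA])) h3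
    rw [ENNReal.toReal_add (ENNReal.mul_ne_top (by simp) hV) hA, ENNReal.toReal_mul,
      ENNReal.toReal_mul, ENNReal.toReal_add hV hA, ENNReal.toReal_ofReal (sq_nonneg _),
      ENNReal.toReal_ofReal hs0] at h4
    have hV0 : 0 ≤ (verticalEnergy Ω m).toReal := ENNReal.toReal_nonneg
    have hA0 : 0 ≤ (dirichlet Ω m).toReal := ENNReal.toReal_nonneg
    have hp1 := mul_nonneg (sub_nonneg.2 hs1.le) hA0
    have hp2 := mul_nonneg (sub_nonneg.2 hs2.le) hV0
    have hAz : (dirichlet Ω m).toReal = 0 :=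
      (mul_eq_zero.1 (le_antisymm (by nlinarith) hp1)).resolve_left (sub_pos.2 hs1).ne'
    have hVz : (verticalEnergy Ω m).toReal = 0 :=
      (mul_eq_zero.1 (le_antisymm (by nlinarith) hp2)).resolve_left (sub_pos.2 hs2).ne'
    obtain ⟨c, hc1, hc⟩ := hm.exists_isConstOn hΩ
      (((ENNReal.toReal_eq_zero_iff _).1 hAz).resolve_right hA)
    refine ⟨c, hc1, ?_, hc⟩
    have h5 := ((ENNReal.toReal_eq_zero_iff _).1 hVz).resolve_right hV
    rw [verticalEnergy_of_isConstOn hc, mul_eq_zero] at h5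
    have h6 := h5.resolve_right (hΩ.isOpen.measure_pos volume hΩ.isConnected.nonempty).ne'
    rw [ENNReal.ofReal_eq_zero] at h6
    exact pow_eq_zero_iff two_ne_zero |>.1 (le_antisymm h6 (sq_nonneg _))
  · rintro ⟨e, h1, h2, h3⟩
    refine ⟨MemH1Sphere.of_isConstOn hΩ h1 h3, fun m' hm' => ?_⟩
    rw [hconst h1 h2 h3, hen m']
    refine (hlow hm').trans (add_le_add le_rfl ?_)
    rw [mul_add]
    refine add_le_add (mul_le_mul_left (ENNReal.ofReal_le_ofReal hs2.le) _) ?_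
    calc _ ≤ 1 * dirichlet Ω m' := mul_le_mul_left (ENNReal.ofReal_le_one.2 hs1.le) _
      _ = _ := one_mul _

end Minimizers

end PenalizedDirichlet

theorem theorem1p1 (N : ℕ) (hN : 1 ≤ N) (Ω : Set (PenalizedDirichlet.Space N))
    (hΩ : PenalizedDirichlet.IsSmoothBoundedDomain Ω) :
    (∀ γ : ℝ, 0 ≤ γ → ∃ κγ : ℝ, 0 < κγ ∧ ∀ κ : ℝ, 0 ≤ κ → κ < κγ →
      ∀ m : PenalizedDirichlet.Space N → PenalizedDirichlet.Vec3,
        PenalizedDirichlet.IsGlobalMinimizer Ω κ γ m ↔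
          (PenalizedDirichlet.IsConstOn Ω m PenalizedDirichlet.e3 ∨
            PenalizedDirichlet.IsConstOn Ω m (-PenalizedDirichlet.e3))) ∧
    (∀ κ : ℝ, 0 < κ → ∃ γκ : ℝ, 0 < γκ ∧ ∀ γ : ℝ, γκ < γ →
      ∀ m : PenalizedDirichlet.Space N → PenalizedDirichlet.Vec3,
        PenalizedDirichlet.IsGlobalMinimizer Ω κ γ m ↔
          ∃ e : PenalizedDirichlet.Vec3, ‖e‖ = 1 ∧ inner ℝ e PenalizedDirichlet.e3 = 0 ∧
            PenalizedDirichlet.IsConstOn Ω m e) := by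
  obtain ⟨n, rfl⟩ := Nat.exists_eq_succ_of_ne_zero (Nat.one_le_iff_ne_zero.1 hN)
  exact ⟨fun _ hγ => hΩ.isGlobalMinimizer_iff_vertical hγ,
    fun _ hκ => hΩ.isGlobalMinimizer_iff_horizontal hκ⟩
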